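/- **Setting.** For $N\ge 1$, $\rho>0$, $L>0$ let $\Omega=[0,L]^3$ and let $E_0$ be the bottom of the spectrum, on $L^2(\mathbb R^{3N})$, of the jellium Hamiltonian $$H=-\tfrac12\sum_{j=1}^N\Delta_j+U(x_1,\dots,x_N),\qquad U=\sum_{i<j}\frac1{|x_i-x_j|}-\rho\sum_{j}\int_\Omega\frac{dy}{|x_j-y|}+\tfrac12\rho^2\iint_{\Omega\times\Omega}\frac{dx\,dy}{|x-y|}.$$ (No symmetry is imposed on the wave functions; restricting $H$ to bosonic wave functions can only raise the bottom of its spectrum.) Let $0<t<1/2$ and let $\chi\in C_0^\infty(\mathbb R^3)$ satisfy $0\le\chi\le1$, $\operatorname{supp}\chi\subset[(-1+t)/2,(1-t)/2]^3$, $\chi=1$ on $[(-1+2t)/2,(1-2t)/2]^3$, $\chi(-x)=\chi(x)$ and $|D^m\chi|\le C_mt^{-m}$ for all $m\ge0$. For $\ell,\omega>0$ put $$\gamma=\Bigl(\int\chi^2\Bigr)^{-1},\qquad Y_\nu(x)=\frac{e^{-\nu|x|}}{|x|},\qquad w(x,y)=\chi(x/\ell)\,Y_{\omega/\ell}(x-y)\,\chi(y/\ell).$$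 Let $H^n_\ell$ be the Hamiltonian $$H^n_\ell=\sum_{j=1}^n\Bigl(-\tfrac12\gamma^{-1}\Delta_{\ell,j}-\rho\int w(x_j,y)\,dy\Bigr)+\sum_{i<j}w(x_i,x_j)+\tfrac12\rho^2\iint w(x,y)\,dx\,dy$$ acting on symmetric $n$-particle functions on the cube $[-\ell/2,\ell/2]^3$, where $\Delta_\ell$ is the Neumann Laplacian of the cube. **Theorem.** There is a universal constant $C>0$, and for every sequence $(C_m)_{m\ge0}$ there is a function of the form $\omega(t)=c\,t^{-4}$, with $c>0$ depending only on $(C_m)$ and with $\omega(t)\ge1$ for $0<t<1/2$, such that the following holds for all $0<t<1/2$, all $\chi$ as above, and $w$ formed with $\omega=\omega(t)$. First, $1\le\gamma\le(1-2t)^{-3}$. Moreover, for all $N\ge 1$ and $\rho,L,\ell>0$: 1. (Sliding.) For all pairwise distinct $x_1,\dots,x_N\in\mathbb R^3$, $$U(x_1,\dots,x_N)\ \ge\ \gamma\sum_{\lambda\in\mathbb Z^3}\int_{[-\frac12,\frac12]^3}W_{\mu,\lambda}(x_1,\dots,x_N)\,d\mu-\frac{\omega(t)N}{2\ell},$$ where,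 with $s=(\mu+\lambda)\ell$, $$W_{\mu,\lambda}=\sum_{i<j}w(x_i+s,x_j+s)-\rho\sum_j\int_\Omega w(x_j+s,y+s)\,dy+\tfrac12\rho^2\iint_{\Omega\times\Omega}w(x+s,y+s)\,dx\,dy,$$ and the integrals and the sum on the right converge absolutely. 2. (Reduction to one small box.) If $\ell\le L$, then $$E_0\ \ge\ (1+L/\ell)^3\,\gamma\inf_{1\le n\le N}\inf\operatorname{Spec}H^n_\ell-C\,(L/\ell)^2\rho^2\ell^5-\frac{\omega(t)N}{2\ell}.$$ -/

import Mathlib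

open MeasureTheory

noncomputable section

namespace Jellium

/-- Physical space. -/
abbrev R3 : Type := EuclideanSpace ℝ (Fin 3)

/-- Configurations of `n` particles in space. -/
abbrev Config (n : ℕ) : Type := Fin n → R3

/-- The closed cube `[a, b]³`. -/
def cube (a b : ℝ) : Set R3 := {x | ∀ i, a ≤ x i ∧ x i ≤ b}

/-- The open set `(a, b)^{3n}` of `n`-particle configurations. -/
def boxConfig (n : ℕ) (a b : ℝ) : Set (Config n) := {x | ∀ j i, a < x j i ∧ x j i < b}

/-- A point of the lattice `ℤ³`, seen in space. -/
def latticePoint (k : Fin 3 → ℤ) : R3 := WithLp.toLp 2 fun i => (k i : ℝ)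

/-! ### Interactions -/

/-- The Coulomb interaction `|x - y|⁻¹`. -/
def coulomb (x y : R3) : ℝ := ‖x - y‖⁻¹

/-- The Yukawa potential `Y_ν(x) = |x|⁻¹ e^{-ν|x|}`. -/
def yukawa (ν : ℝ) (x : R3) : ℝ := ‖x‖⁻¹ * Real.exp (-ν * ‖x‖)

/-- The potential energy of point charges `+1` at `x₁, …, xₙ` and a uniform background of charge
density `-ρ` in `Ω`, all interacting through `v`:
`∑_{i<j} v(xᵢ, xⱼ) - ρ ∑ⱼ ∫_Ω v(xⱼ, y) dy + ½ ρ² ∫_Ω ∫_Ω v(x, y) dx dy`. -/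
def potential (v : R3 → R3 → ℝ) (Ω : Set R3) (ρ : ℝ) {n : ℕ} (x : Config n) : ℝ :=
  (∑ i, ∑ j ∈ Finset.Ioi i, v (x i) (x j))
    - ρ * (∑ j, ∫ y in Ω, v (x j) y)
    + 1 / 2 * ρ ^ 2 * ∫ y in Ω, ∫ z in Ω, v y z

/-! ### The localization function -/

/-- The admissible localization functions `χ` with parameter `t`; the `m`-th derivatives are bounded
by `B m * t⁻ᵐ`. -/
structure IsCutoff (B : ℕ → ℝ) (t : ℝ) (χ : R3 → ℝ) : Prop where
  contDiff : ContDiff ℝ (⊤ : ℕ∞) χ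
  support_subset : tsupport χ ⊆ cube ((-1 + t) / 2) ((1 - t) / 2)
  nonneg : ∀ x, 0 ≤ χ x
  le_one : ∀ x, χ x ≤ 1
  eq_one : ∀ x ∈ cube ((-1 + 2 * t) / 2) ((1 - 2 * t) / 2), χ x = 1
  even : ∀ x, χ (-x) = χ x
  deriv_le : ∀ (m : ℕ) (x : R3), ‖iteratedFDeriv ℝ m χ x‖ ≤ B m * (t ^ m)⁻¹

/-- The constant `γ = (∫ χ²)⁻¹`. -/
def gam (χ : R3 → ℝ) : ℝ := (∫ y, χ y ^ 2)⁻¹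

/-- The localized Yukawa interaction `w(x, y) = χ(x/ℓ) Y_{ω/ℓ}(x - y) χ(y/ℓ)`. -/
def locYukawa (χ : R3 → ℝ) (ω ℓ : ℝ) (x y : R3) : ℝ :=
  χ (ℓ⁻¹ • x) * yukawa (ω / ℓ) (x - y) * χ (ℓ⁻¹ • y)

/-- The interaction `w(x + s, y + s)`, i.e. `w` slid by the vector `s`. -/
def slide (w : R3 → R3 → ℝ) (s : R3) (x y : R3) : ℝ := w (x + s) (y + s)

/-! ### Schrödinger operators defined by quadratic forms, and their spectra -/

/-- The Hilbert space `L²(D)` of complex wave functions of `n` particles, `D ⊆ ℝ^{3n}`. -/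
abbrev L2 {n : ℕ} (D : Set (Config n)) : Type :=
  Lp ℂ 2 ((volume : Measure (Config n)).restrict D)

/-- The unit vector of `ℝ^{3n}` belonging to the coordinate `a` of particle `j`. -/
def unitVec {n : ℕ} (j : Fin n) (a : Fin 3) : Config n :=
  Pi.single j (EuclideanSpace.single a (1 : ℝ))

/-- `g j a ∈ L²(D)` are the weak partial derivatives of `ψ` in the open set `D`. -/
def HasWeakGradient {n : ℕ} (D : Set (Config n)) (ψ : L2 D) (g : Fin n → Fin 3 → L2 D) : Prop :=
  ∀ (j : Fin n) (a : Fin 3) (f : Config n → ℝ),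
    ContDiff ℝ (⊤ : ℕ∞) f → HasCompactSupport f → tsupport f ⊆ D →
      ∫ x in D, ψ x * ((fderiv ℝ f x (unitVec j a) : ℝ) : ℂ) = -∫ x in D, g j a x * ((f x : ℝ) : ℂ)

/-- `ψ ∈ H¹(D)`. -/
def MemH1 {n : ℕ} (D : Set (Config n)) (ψ : L2 D) : Prop := ∃ g, HasWeakGradient D ψ g

open Classical in
/-- The weak gradient of `ψ ∈ H¹(D)` (and `0` for other `ψ`). -/
def weakGrad {n : ℕ} (D : Set (Config n)) (ψ : L2 D) : Fin n → Fin 3 → L2 D :=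
  if h : MemH1 D ψ then h.choose else 0

/-- The form domain of `-κ ∑ⱼ Δⱼ + V` on `D`: all `ψ ∈ H¹(D)` with `∫_D |V| |ψ|² < ∞`. No boundary
condition is imposed, so that this is the Neumann Laplacian of `D`. -/
def MemFormDomain {n : ℕ} (D : Set (Config n)) (V : Config n → ℝ) (ψ : L2 D) : Prop :=
  MemH1 D ψ ∧ IntegrableOn (fun x => V x * ‖ψ x‖ ^ 2) D

/-- The sesquilinear form `κ ∑ⱼ ∫_D ∇ⱼφ̄ · ∇ⱼψ + ∫_D V φ̄ ψ`. -/
def energyForm {n : ℕ} (κ : ℝ) (D : Set (Config n)) (V : Config n → ℝ) (φ ψ : L2 D) : ℂ :=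
  (κ : ℂ) * (∑ j, ∑ a, inner ℂ (weakGrad D φ j a) (weakGrad D ψ j a))
    + ∫ x in D, (V x : ℂ) * (starRingEnd ℂ (φ x) * ψ x)

/-- The graph of the operator `H = -κ ∑ⱼ Δⱼ + V` that the form defines in the closed subspace `S`
of `L²(D)`: `ψ` is in the domain of `H` and `H ψ = η`. -/
def OperatorGraph {n : ℕ} (κ : ℝ) (D : Set (Config n)) (V : Config n → ℝ) (S : Set (L2 D))
    (ψ η : L2 D) : Prop :=
  ψ ∈ S ∧ η ∈ S ∧ MemFormDomain D V ψ ∧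
    ∀ φ ∈ S, MemFormDomain D V φ → energyForm κ D V φ ψ = inner ℂ φ η

/-- The (real) spectrum of `H = -κ ∑ⱼ Δⱼ + V` in `S`: those `E` for which `H - E` is not a bijection
of the domain of `H` onto `S`. -/
def spec {n : ℕ} (κ : ℝ) (D : Set (Config n)) (V : Config n → ℝ) (S : Set (L2 D)) : Set ℝ :=
  {E | ¬ ∀ η ∈ S, ∃! ψ : L2 D, OperatorGraph κ D V S ψ (η + (E : ℂ) • ψ)}

/-- The bosonic subspace: wave functions that are symmetric under permutations of the particles. -/
def bosons {n : ℕ} (D : Set (Config n)) : Set (L2 D) :=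
  {ψ | ∀ σ : Equiv.Perm (Fin n),
    ∀ᵐ x ∂((volume : Measure (Config n)).restrict D), ψ (fun j => x (σ j)) = ψ x}

/-- The ground state energy `E₀` of the jellium Hamiltonian
`½ ∑ⱼ pⱼ² + U_pp + U_pb + U_bb` on `L²(ℝ^{3N})`, with background in `[0, L]³`. -/
def groundEnergy (N : ℕ) (ρ L : ℝ) : ℝ :=
  sInf (spec (1 / 2) (Set.univ : Set (Config N)) (potential coulomb (cube 0 L) ρ) Set.univ)

/-- `inf Spec Hⁿ_ℓ` for the bosonic Neumann Hamiltonian of the cube `[-ℓ/2, ℓ/2]³`,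
`Hⁿ_ℓ = ∑ⱼ (-½ γ⁻¹ Δ_{ℓ,j} - ρ ∫ w(xⱼ, y) dy) + ∑_{i<j} w(xᵢ, xⱼ) + ½ ρ² ∫∫ w(x, y) dx dy`. -/
def boxEnergy (χ : R3 → ℝ) (ω ρ ℓ : ℝ) (n : ℕ) : ℝ :=
  sInf (spec (1 / 2 * (gam χ)⁻¹) (boxConfig n (-ℓ / 2) (ℓ / 2))
    (potential (locYukawa χ ω ℓ) Set.univ ρ) (bosons (boxConfig n (-ℓ / 2) (ℓ / 2))))

/-- The potential energy in the box at position `μ + k`, with `k ∈ ℤ³` and `μ ∈ [-1/2, 1/2]³`. -/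
def slidPotential (χ : R3 → ℝ) (ω ρ L ℓ : ℝ) {N : ℕ} (x : Config N) (k : Fin 3 → ℤ) (μ : R3) : ℝ :=
  potential (slide (locYukawa χ ω ℓ) (ℓ • (μ + latticePoint k))) (cube 0 L) ρ x

end Jellium

end

/-! Part 1 is electrostatics. Averaging `w(x + ℓu, y + ℓu)` over all `u ∈ ℝ³` and multiplying by `γ`
gives a translation invariant interaction, `h((x - y)/ℓ) Y_{ω/ℓ}(x - y)` with `h = γ χ ⋆ χ` (`corr`,
`slideAverage`). Since `h` is the characteristic function of the probability density `γ |χ̂|²`, the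
Fourier transform of `h Y_ω` is the mean of `4π / (4π²|p - q|² + ω²)` over that density. If `ω²` is
large compared with the second and fourth moments of the density, this mean lies below `4π /
(4π²|p|² + ν²)` for every `ν > 0` with `ν² ≤ ω²/2` (`IsCutoff.integral_resolvent_le`); derivative
bounds on `χ` control the moments, and `ω = c t⁻⁴` is large enough (`IsCutoff.moment_condition`).
Hence `Y_ν - h Y_ω` is of positive type, with the finite value `ω - ν` at the origin, where the
singularities cancel. Onsager's argument applies positivity to the point charges minus the
background: the difference of the two interaction energies is at least minus the self-energies of
the points (`neg_self_energy_le_potential`). The limit `ν → 0` turns the Yukawa potential into the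
Coulomb potential (`slideAverage_le_potential`), and an integral over `ℝ³` is a sum over `ℤ³` of
integrals over the unit cell.

Part 2 uses the same average for the whole energy. For each position `u` of the box, the
configuration space is cut according to the set `A` of particles lying in the box. On each piece the
other particles are frozen, and the wave function of those in `A` is a trial function for the
Neumann problem with `n = |A|` (`boxEnergy_mul_setIntegral_le`). A box inside the background has
energy at least the infimum `e`; a box straddling the boundary loses at most the self-energy of the
background in it, `O(ρ²ℓ⁵)` after multiplication by `γ`; a box away from the background has
nonnegative energy. The relevant `u` fill cubes of sides `L/ℓ + 1` and `L/ℓ - 1`, which accounts for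
the factor `(1 + L/ℓ)³` and for the surface error. An empty box has exactly the background
self-energy, and the constant one-particle function shows that this is no smaller than the energy
with one particle.

Two reductions connect this with the spectra. The bottom of the spectrum of a form operator is the
best constant in the form inequality, because it is a shift of `‖J‖⁻²` for the embedding `J` of the
form domain into the Hilbert space. Moreover, `E₀` is taken without symmetry but the box energies
are bosonic; the root mean square of `ψ` over permutations is symmetric and real, has the same norm
and potential energy, and does not have more kinetic energy (`exists_hasWeakDeriv_symmetrization`).
-/

noncomputable section

namespace Jellium

/-! ### The bottom of the spectrum of an operator defined by a quadratic form. -/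

section Abstract

open ContinuousLinearMap

variable {K H : Type*} [NormedAddCommGroup K] [InnerProductSpace ℂ K] [CompleteSpace K]
  [NormedAddCommGroup H] [InnerProductSpace ℂ H] [CompleteSpace H]

/-- The energies `E₀ + δ` at which the operator `J J†`-inverse minus `δ` is not bijective. -/
def formSpec (J : K →L[ℂ] H) (E₀ : ℝ) : Set ℝ :=
  {E | ¬ ∀ η : H, ∃! k : K, ∀ k' : K,
    inner ℂ k' k = inner ℂ (J k') (η + ((E - E₀ : ℝ) : ℂ) • J k)}

lemma formSpec_equation_iff (J : K →L[ℂ] H) (δ : ℝ) (η : H) (k : K) :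
    (∀ k' : K, inner ℂ k' k = inner ℂ (J k') (η + (δ : ℂ) • J k)) ↔
      (1 - (δ : ℂ) • (J.adjoint ∘L J) : K →L[ℂ] K) k = J.adjoint η := by
  constructor
  · intro h
    refine ext_inner_left ℂ fun k' => ?_
    have := h k'
    rw [inner_add_right, inner_smul_right] at this
    simp only [sub_apply, one_apply_eq_self, smul_apply, comp_apply, inner_sub_right, inner_smul_right,
      adjoint_inner_right]
    rw [this]; ring
  · intro h k'
    have := congrArg (fun z => inner ℂ k' z) h
    simp only [sub_apply, one_apply_eq_self, smul_apply, comp_apply, inner_sub_right, inner_smul_right,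
      adjoint_inner_right] at this
    rw [inner_add_right, inner_smul_right, ← this]; ring

/-- The equation tests the operator `1 - δ J*J` only on right-hand sides in the range of `J*`. That
suffices for invertibility: the operator differs from the identity by something with values in that
range. -/
lemma mem_formSpec_iff (J : K →L[ℂ] H) (E₀ E : ℝ) :
    E ∈ formSpec J E₀ ↔
      ¬ IsUnit (1 - ((E - E₀ : ℝ) : ℂ) • (J.adjoint ∘L J) : K →L[ℂ] K) := by
  set δ : ℝ := E - E₀
  set T : K →L[ℂ] K := 1 - (δ : ℂ) • (J.adjoint ∘L J) with hT
  have key : E ∈ formSpec J E₀ ↔ ¬ ∀ η : H, ∃! k : K, T k = J.adjoint η := by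
    simp only [formSpec, Set.mem_ofPred_eq]
    simp_rw [formSpec_equation_iff]
    rfl
  rw [key, not_iff_not]
  constructor
  · intro h
    rw [ContinuousLinearMap.isUnit_iff_bijective]
    constructor
    · intro a b hab
      have h0 : T (a - b) = J.adjoint 0 := by rw [map_sub, hab, sub_self, map_zero]
      have h1 : T 0 = J.adjoint 0 := by simp
      exact sub_eq_zero.1 ((h 0).unique h0 h1)
    · intro ζ
      -- `T ζ` misses `ζ` by `-δ J*J ζ`, and this defect is removed by the solution `k` with datum
      -- `δ J ζ`.
      obtain ⟨k, hk, -⟩ := h ((δ : ℂ) • J ζ)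
      refine ⟨ζ + k, ?_⟩
      rw [map_add, hk]
      simp [hT]
  · intro h η
    rw [ContinuousLinearMap.isUnit_iff_bijective] at h
    exact h.existsUnique _

/-- Below this threshold `1 - δ J*J` is invertible. For `δ > 0` this is the Neumann series. For `δ ≤
0` the operator is self-adjoint and at least `1`, so its range is closed and has trivial orthogonal
complement. -/
lemma formSpec_ge (J : K →L[ℂ] H) (E₀ E : ℝ) (h : E ∈ formSpec J E₀) :
    1 ≤ (E - E₀) * ‖J‖ ^ 2 := by
  rw [mem_formSpec_iff] at h
  by_contra! hlt
  apply h
  set δ : ℝ := E - E₀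
  have hn : ‖J.adjoint ∘L J‖ = ‖J‖ ^ 2 := by rw [norm_adjoint_comp_self, sq]
  rcases le_or_gt δ 0 with hδ | hδ
  · -- the operator is bounded below by one
    rw [ContinuousLinearMap.isUnit_iff_bijective]
    set T : K →L[ℂ] K := 1 - (δ : ℂ) • (J.adjoint ∘L J) with hT
    have hsa : IsSelfAdjoint T := by
      rw [hT]
      refine (IsSelfAdjoint.one _).sub ?_
      refine IsSelfAdjoint.smul ?_ (isPositive_adjoint_comp_self J).isSelfAdjoint
      exact Complex.conj_ofReal δ
    have hb : ∀ k : K, ‖k‖ ≤ ‖T k‖ := by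
      intro k
      have h1 : ‖k‖ ^ 2 ≤ RCLike.re (inner ℂ k (T k)) := by
        simp only [hT, sub_apply, one_apply_eq_self, smul_apply, comp_apply, inner_sub_right,
          inner_smul_right, adjoint_inner_right, map_sub]
        rw [inner_self_eq_norm_sq_to_K, inner_self_eq_norm_sq_to_K]
        have : RCLike.re ((δ : ℂ) * ((‖J k‖ : ℂ)) ^ 2) = δ * ‖J k‖ ^ 2 := by
          norm_cast
        have h2 : RCLike.re (((‖k‖ : ℝ) : ℂ) ^ 2) = ‖k‖ ^ 2 := by norm_cast
        erw [this, h2]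
        nlinarith [sq_nonneg ‖J k‖]
      have h2 : RCLike.re (inner ℂ k (T k)) ≤ ‖k‖ * ‖T k‖ := re_inner_le_norm _ _
      rcases eq_or_lt_of_le (norm_nonneg k) with h0 | h0
      · rw [← h0]; positivity
      · nlinarith
    have hanti : AntilipschitzWith 1 T :=
      T.antilipschitz_of_bound fun x => by simpa using hb x
    refine ⟨hanti.injective, ?_⟩
    have hcl : IsClosed (T.range : Set K) := hanti.isClosed_range T.uniformContinuous
    have hcomp : T.range.HasOrthogonalProjection := by
      have : CompleteSpace T.range := hcl.completeSpace_coe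
      infer_instance
    have horth : T.rangeᗮ = ⊥ := by
      rw [ContinuousLinearMap.orthogonal_range, hsa.adjoint_eq]
      exact LinearMap.ker_eq_bot.2 hanti.injective
    have := (Submodule.orthogonal_eq_bot_iff (K := T.range)).1 horth
    exact LinearMap.range_eq_top.1 this
  · have hlt' : ‖(δ : ℂ) • (J.adjoint ∘L J)‖ < 1 := by
      rw [norm_smul, hn, Complex.norm_real, Real.norm_of_nonneg hδ.le]; exact hlt
    exact isUnit_one_sub_of_norm_lt_one hlt'

/-- The norm of the positive operator `J*J` is a point of its spectrum, and it equals `‖J‖²`. With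
`formSpec_ge`, the bottom of the spectrum is therefore `E₀ + ‖J‖⁻²`. -/
lemma mem_formSpec (J : K →L[ℂ] H) (E₀ : ℝ) (hJ : J ≠ 0) :
    E₀ + (‖J‖ ^ 2)⁻¹ ∈ formSpec J E₀ := by
  rw [mem_formSpec_iff]
  have hJ' : 0 < ‖J‖ := norm_pos_iff.2 hJ
  have : Nontrivial K := by
    by_contra h
    rw [not_nontrivial_iff_subsingleton] at h
    exact hJ (by ext k; rw [Subsingleton.elim k 0]; simp)
  have hn : ‖J.adjoint ∘L J‖ = ‖J‖ ^ 2 := by rw [norm_adjoint_comp_self, sq]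
  have hpos : (0 : K →L[ℂ] K) ≤ J.adjoint ∘L J := by
    rw [ContinuousLinearMap.nonneg_iff_isPositive]
    exact isPositive_adjoint_comp_self J
  have hmem := CStarAlgebra.norm_mem_spectrum_of_nonneg (a := (J.adjoint ∘L J : K →L[ℂ] K)) hpos
  rw [hn, spectrum.mem_iff] at hmem
  intro hu
  apply hmem
  have h2 : (algebraMap ℝ (K →L[ℂ] K) (‖J‖ ^ 2) - J.adjoint ∘L J)
      = ((‖J‖ ^ 2 : ℝ) : ℂ) •
        (1 - ((E₀ + (‖J‖ ^ 2)⁻¹ - E₀ : ℝ) : ℂ) • (J.adjoint ∘L J) : K →L[ℂ] K) := by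
    rw [smul_sub, smul_smul, ← Complex.ofReal_mul]
    have : ‖J‖ ^ 2 * (E₀ + (‖J‖ ^ 2)⁻¹ - E₀) = 1 := by field_simp; ring
    rw [this, Complex.ofReal_one, one_smul]
    congr 1
  rw [h2]
  have hne : ((‖J‖ ^ 2 : ℝ) : ℂ) ≠ 0 := by
    exact_mod_cast (pow_pos hJ' 2).ne'
  exact hu.smul (Units.mk0 _ hne)

/-- The bottom of the spectrum is a lower bound for the quadratic form. -/
lemma sInf_formSpec_mul_le (J : K →L[ℂ] H) (E₀ : ℝ) (k : K) :
    sInf (formSpec J E₀) * ‖J k‖ ^ 2 ≤ ‖k‖ ^ 2 + E₀ * ‖J k‖ ^ 2 := by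
  rcases eq_or_ne J 0 with rfl | hJ
  · simp
  have hJ' : 0 < ‖J‖ := norm_pos_iff.2 hJ
  have hb : BddBelow (formSpec J E₀) := by
    refine ⟨E₀, fun E hE => ?_⟩
    have := formSpec_ge J E₀ E hE
    by_contra! h
    nlinarith [sq_nonneg ‖J‖]
  have h1 : sInf (formSpec J E₀) ≤ E₀ + (‖J‖ ^ 2)⁻¹ := csInf_le hb (mem_formSpec J E₀ hJ)
  have h2 : (‖J‖ ^ 2)⁻¹ * ‖J k‖ ^ 2 ≤ ‖k‖ ^ 2 := by
    rw [inv_mul_le_iff₀ (by positivity), ← mul_pow]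
    gcongr
    exact J.le_opNorm k
  nlinarith [sq_nonneg ‖J k‖]

/-- A lower bound for the quadratic form is a lower bound for the spectrum. -/
lemma le_sInf_formSpec (J : K →L[ℂ] H) (E₀ b : ℝ) (hJ : J ≠ 0)
    (h : ∀ k, b * ‖J k‖ ^ 2 ≤ ‖k‖ ^ 2 + E₀ * ‖J k‖ ^ 2) :
    b ≤ sInf (formSpec J E₀) := by
  -- Here `J ≠ 0` is essential: it keeps the spectrum nonempty, whereas `sInf ∅ = 0` would carry no
  -- information.
  refine le_csInf ⟨_, mem_formSpec J E₀ hJ⟩ fun E hE => ?_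
  have h1 := formSpec_ge J E₀ E hE
  by_contra! hlt
  have hJ' : 0 < ‖J‖ := norm_pos_iff.2 hJ
  have hE : 0 < E - E₀ := by
    by_contra! h0
    nlinarith [sq_nonneg ‖J‖]
  -- the norm of `J` is at most `(b - E₀)^(-1/2)`
  have hb : 0 < b - E₀ := by linarith
  have h2 : ‖J‖ ≤ (Real.sqrt (b - E₀))⁻¹ := by
    refine J.opNorm_le_bound (by positivity) fun k => ?_
    rw [le_inv_mul_iff₀ (Real.sqrt_pos.2 hb)]
    refine le_of_sq_le_sq ?_ (norm_nonneg _)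
    rw [mul_pow, Real.sq_sqrt hb.le]
    linarith [h k]
  have h3 : ‖J‖ ^ 2 ≤ (b - E₀)⁻¹ := by
    calc ‖J‖ ^ 2 ≤ ((Real.sqrt (b - E₀))⁻¹) ^ 2 := by gcongr
      _ = _ := by rw [inv_pow, Real.sq_sqrt hb.le]
  have h4 : (E - E₀) * ‖J‖ ^ 2 ≤ (E - E₀) * (b - E₀)⁻¹ := by gcongr
  have h5 : (E - E₀) * (b - E₀)⁻¹ < 1 := by
    rw [mul_inv_lt_iff₀ hb]; linarith
  linarith

end Abstract

/-! ### Weak gradients in open sets of configurations. -/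

section WeakGradient

variable {n : ℕ} {D : Set (Config n)}

lemma memLp_ofReal_of_hasCompactSupport {f : Config n → ℝ} (hf : Continuous f)
    (hc : HasCompactSupport f) (μ : Measure (Config n)) [IsFiniteMeasureOnCompacts μ] :
    MemLp (fun x => (f x : ℂ)) 2 μ :=
  (Complex.continuous_ofReal.comp hf).memLp_of_hasCompactSupport
    (hc.comp_left (g := fun r : ℝ => (r : ℂ)) Complex.ofReal_zero)

lemma inner_toLp_ofReal {f : Config n → ℝ} (hf : MemLp (fun x => (f x : ℂ)) 2 (volume.restrict D))
    (ψ : L2 D) : inner ℂ (hf.toLp) ψ = ∫ x in D, ψ x * (f x : ℂ) := by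
  rw [L2.inner_def]
  refine integral_congr_ae ?_
  filter_upwards [hf.coeFn_toLp] with x hx
  rw [hx]
  simp [RCLike.inner_apply]

lemma continuous_fderiv_apply {f : Config n → ℝ} (hf : ContDiff ℝ (⊤ : ℕ∞) f) (v : Config n) :
    Continuous fun x => fderiv ℝ f x v :=
  (hf.continuous_fderiv (by simp)).clm_apply continuous_const

lemma HasCompactSupport.fderiv_apply' {f : Config n → ℝ} (hf : HasCompactSupport f)
    (v : Config n) : HasCompactSupport fun x => fderiv ℝ f x v :=
  (hf.fderiv (𝕜 := ℝ)).comp_left (g := fun T : Config n →L[ℝ] ℝ => T v) (by simp)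

/-- `weakGrad` is defined by a choice; uniqueness makes the choice irrelevant. -/
lemma hasWeakGradient_unique (hD : IsOpen D) {ψ : L2 D} {g g' : Fin n → Fin 3 → L2 D}
    (h : HasWeakGradient D ψ g) (h' : HasWeakGradient D ψ g') : g = g' := by
  funext j a
  rw [← sub_eq_zero]
  have hint : LocallyIntegrable (fun x => (g j a - g' j a : L2 D) x) (volume.restrict D) :=
    (Lp.memLp _).locallyIntegrable (by norm_num)
  rw [Lp.eq_zero_iff_ae_eq_zero]
  suffices hz : ∀ f : Config n → ℝ, ContDiff ℝ (⊤ : ℕ∞) f → HasCompactSupport f → tsupport f ⊆ D →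
      ∫ x in D, f x • (g j a - g' j a : L2 D) x = 0 by
    have key := hD.ae_eq_zero_of_integral_contDiff_smul_eq_zero (hint.locallyIntegrableOn D) hz
    filter_upwards [key, ae_restrict_mem hD.measurableSet] with x hx hxD using hx hxD
  intro f hf hfc hfD
  have h1 := h j a f hf hfc hfD
  have h2 := h' j a f hf hfc hfD
  have hm := memLp_ofReal_of_hasCompactSupport hf.continuous hfc (volume.restrict D)
  have h3 : inner ℂ hm.toLp (g j a - g' j a) = 0 := by
    rw [inner_sub_right, inner_toLp_ofReal hm, inner_toLp_ofReal hm, sub_eq_zero]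
    rw [h1] at h2
    exact neg_inj.1 h2
  rw [inner_toLp_ofReal hm] at h3
  rw [← h3]
  refine integral_congr_ae (Filter.Eventually.of_forall fun x => ?_)
  simp [mul_comm]

lemma hasWeakGradient_weakGrad {ψ : L2 D} (h : MemH1 D ψ) :
    HasWeakGradient D ψ (weakGrad D ψ) := by
  rw [weakGrad, dif_pos h]
  exact h.choose_spec

lemma weakGrad_eq (hD : IsOpen D) {ψ : L2 D} {g : Fin n → Fin 3 → L2 D}
    (h : HasWeakGradient D ψ g) : weakGrad D ψ = g :=
  hasWeakGradient_unique hD (hasWeakGradient_weakGrad ⟨g, h⟩) h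

/-- Pairing with fixed vectors of `L²` makes it evident that the condition is linear and closed in
`(ψ, g)`. -/
lemma hasWeakGradient_iff_inner {ψ : L2 D} {g : Fin n → Fin 3 → L2 D} :
    HasWeakGradient D ψ g ↔ ∀ (j : Fin n) (a : Fin 3) (f : Config n → ℝ)
      (hf : ContDiff ℝ (⊤ : ℕ∞) f) (hc : HasCompactSupport f), tsupport f ⊆ D →
      inner ℂ (memLp_ofReal_of_hasCompactSupport (continuous_fderiv_apply hf (unitVec j a))
        (HasCompactSupport.fderiv_apply' hc (unitVec j a)) (volume.restrict D)).toLp ψ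
      + inner ℂ (memLp_ofReal_of_hasCompactSupport hf.continuous hc
          (volume.restrict D)).toLp (g j a) = 0 := by
  simp only [HasWeakGradient, inner_toLp_ofReal, ← eq_neg_iff_add_eq_zero]

end WeakGradient

/-! ### The form domain as a Hilbert space, and the variational principle. -/

section FormSpace

variable {n : ℕ} (κ : ℝ) (D : Set (Config n)) (V : Config n → ℝ) (c : ℝ)
  (S : Submodule ℂ (L2 D))

/-- The Hilbert space of triples `(ψ, (V + c)^{1/2} ψ, κ^{1/2} ∇ψ)`. -/
abbrev FormAmbient (D : Set (Config n)) : Type :=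
  PiLp 2 fun _ : Option (Option (Fin n × Fin 3)) => L2 D

/-- The form domain with the form norm, as a subspace of `FormAmbient`. -/
def formSpace : Submodule ℂ (FormAmbient D) where
  carrier := {k | k none ∈ S ∧
    (∀ᵐ x ∂(volume.restrict D), k (some none) x = (Real.sqrt (V x + c) : ℂ) * k none x) ∧
    HasWeakGradient D (k none) fun j a => ((Real.sqrt κ)⁻¹ : ℂ) • k (some (some (j, a)))}
  add_mem' := by
    rintro k l ⟨h1, h2, h3⟩ ⟨h1', h2', h3'⟩
    refine ⟨S.add_mem h1 h1', ?_, ?_⟩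
    · simp only [PiLp.add_apply]
      filter_upwards [h2, h2', Lp.coeFn_add (k (some none)) (l (some none)),
        Lp.coeFn_add (k none) (l none)] with x hx hx' e1 e2
      rw [e1, e2, Pi.add_apply, Pi.add_apply, hx, hx', mul_add]
    · rw [hasWeakGradient_iff_inner] at *
      intro j a f hf hc hD
      have e1 := h3 j a f hf hc hD
      have e2 := h3' j a f hf hc hD
      simp only [PiLp.add_apply, smul_add, inner_add_right]
      linear_combination e1 + e2
  zero_mem' := by
    refine ⟨S.zero_mem, ?_, ?_⟩
    · simp only [PiLp.zero_apply]
      filter_upwards [Lp.coeFn_zero ℂ 2 (volume.restrict D)] with x hx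
      rw [hx]; simp
    · rw [hasWeakGradient_iff_inner]
      intro j a f hf hc hD
      simp
  smul_mem' := by
    rintro r k ⟨h1, h2, h3⟩
    refine ⟨S.smul_mem r h1, ?_, ?_⟩
    · simp only [PiLp.smul_apply]
      filter_upwards [h2, Lp.coeFn_smul r (k (some none)), Lp.coeFn_smul r (k none)]
        with x hx e1 e2
      rw [e1, e2, Pi.smul_apply, Pi.smul_apply, hx, smul_eq_mul, smul_eq_mul]; ring
    · rw [hasWeakGradient_iff_inner] at *
      intro j a f hf hc hD
      have e1 := h3 j a f hf hc hD
      simp only [PiLp.smul_apply]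
      rw [smul_comm, inner_smul_right, inner_smul_right]
      linear_combination r * e1

/-- Multiplication by `m` may be unbounded, so continuity is not available. Passing to subsequences
twice makes both components converge almost everywhere, and the pointwise relation survives. -/
lemma isClosed_ae_eq_mul {Ω : Type*} [MeasurableSpace Ω] (μ : Measure Ω) (m : Ω → ℂ) :
    IsClosed {p : Lp ℂ 2 μ × Lp ℂ 2 μ | ∀ᵐ x ∂μ, p.1 x = m x * p.2 x} := by
  rw [← isSeqClosed_iff_isClosed]
  intro p q hp hq
  have h1 : Filter.Tendsto (fun i => (p i).1) Filter.atTop (nhds q.1) :=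
    (continuous_fst.tendsto q).comp hq
  have h2 : Filter.Tendsto (fun i => (p i).2) Filter.atTop (nhds q.2) :=
    (continuous_snd.tendsto q).comp hq
  obtain ⟨s, hs, hs'⟩ := (tendstoInMeasure_of_tendsto_Lp h1).exists_seq_tendsto_ae
  have h3 : Filter.Tendsto (fun i => (p (s i)).2) Filter.atTop (nhds q.2) :=
    h2.comp hs.tendsto_atTop
  obtain ⟨r, hr, hr'⟩ := (tendstoInMeasure_of_tendsto_Lp h3).exists_seq_tendsto_ae
  have hall : ∀ᵐ x ∂μ, ∀ i, (p i).1 x = m x * (p i).2 x := by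
    rw [ae_all_iff]; exact hp
  filter_upwards [hs', hr', hall] with x hx1 hx2 hx3
  have e1 := hx1.comp hr.tendsto_atTop
  have e2 := hx2.const_mul (m x)
  refine tendsto_nhds_unique e1 (e2.congr fun i => ?_)
  exact (hx3 _).symm

-- Closedness gives completeness of the form domain in the form norm, that is, closedness of the
-- quadratic form.
variable {S} in
lemma isClosed_formSpace (hS : IsClosed (S : Set (L2 D))) :
    IsClosed (formSpace κ D V c S : Set (FormAmbient D)) := by
  have hcont : ∀ i, Continuous fun k : FormAmbient D => k i := fun i =>
    PiLp.continuous_apply 2 _ i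
  have h1 : IsClosed {k : FormAmbient D | k none ∈ S} := hS.preimage (hcont none)
  have h2 : IsClosed {k : FormAmbient D |
      ∀ᵐ x ∂(volume.restrict D), k (some none) x = (Real.sqrt (V x + c) : ℂ) * k none x} :=
    (isClosed_ae_eq_mul (volume.restrict D) fun x => (Real.sqrt (V x + c) : ℂ)).preimage
      ((hcont (some none)).prodMk (hcont none))
  have h3 : IsClosed {k : FormAmbient D | HasWeakGradient D (k none)
      fun j a => ((Real.sqrt κ)⁻¹ : ℂ) • k (some (some (j, a)))} := by
    simp only [hasWeakGradient_iff_inner, Set.ofPred_forall]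
    refine isClosed_iInter fun j => isClosed_iInter fun a => isClosed_iInter fun f =>
      isClosed_iInter fun hf => isClosed_iInter fun hc => isClosed_iInter fun _ => ?_
    refine isClosed_eq ?_ continuous_const
    exact (continuous_const.inner (hcont none)).add
      (continuous_const.inner (Continuous.fun_const_smul (hcont (some (some (j, a)))) _))
  exact h1.inter (h2.inter h3)

variable {S} in
/-- The inclusion of the form domain into the Hilbert space. -/
def formIncl : formSpace κ D V c S →L[ℂ] S :=
  ((PiLp.proj 2 (fun _ : Option (Option (Fin n × Fin 3)) => L2 D) none).comp
    (formSpace κ D V c S).subtypeL).codRestrict S fun k => k.2.1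

variable {κ D V c}

/-- Since `V + c ≥ 0` and `ψ ∈ L²`, the two sides differ only by the integrable function `c |ψ|²`.
This identifies the potential part of the form domain with the second component of `formSpace`. -/
lemma integrableOn_mul_norm_sq_iff (hV : Measurable V) (hc : ∀ x, -c ≤ V x) (ψ : L2 D) :
    IntegrableOn (fun x => V x * ‖ψ x‖ ^ 2) D ↔
      MemLp (fun x => (Real.sqrt (V x + c) : ℂ) * ψ x) 2 (volume.restrict D) := by
  have hm : AEStronglyMeasurable (fun x => (Real.sqrt (V x + c) : ℂ) * ψ x)
      (volume.restrict D) := by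
    refine AEStronglyMeasurable.mul ?_ (Lp.aestronglyMeasurable ψ)
    exact (Complex.measurable_ofReal.comp (hV.add_const c).sqrt).aestronglyMeasurable
  have hψ : Integrable (fun x => c * ‖ψ x‖ ^ 2) (volume.restrict D) :=
    ((memLp_two_iff_integrable_sq_norm (Lp.aestronglyMeasurable ψ)).1 (Lp.memLp ψ)).const_mul c
  rw [memLp_two_iff_integrable_sq_norm hm]
  have e : (fun x => ‖(Real.sqrt (V x + c) : ℂ) * ψ x‖ ^ 2)
      = fun x => V x * ‖ψ x‖ ^ 2 + c * ‖ψ x‖ ^ 2 := by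
    funext x
    rw [norm_mul, mul_pow, Complex.norm_real, Real.norm_eq_abs, sq_abs,
      Real.sq_sqrt (by linarith [hc x])]
    ring
  rw [e]
  constructor
  · intro h; exact Integrable.add h hψ
  · intro h
    have := h.sub hψ
    refine this.congr (Filter.Eventually.of_forall fun x => ?_)
    simp

lemma exists_mem_formSpace (hκ : 0 < κ) (hV : Measurable V) (hc : ∀ x, -c ≤ V x)
    {ψ : L2 D} (hS : ψ ∈ S) {g : Fin n → Fin 3 → L2 D} (hg : HasWeakGradient D ψ g)
    (hψ : IntegrableOn (fun x => V x * ‖ψ x‖ ^ 2) D) :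
    ∃ k ∈ formSpace κ D V c S, k none = ψ := by
  have hm := (integrableOn_mul_norm_sq_iff hV hc ψ).1 hψ
  let k : FormAmbient D := WithLp.toLp 2 fun i => match i with
    | none => ψ
    | some none => hm.toLp
    | some (some (j, a)) => (Real.sqrt κ : ℂ) • g j a
  refine ⟨k, ⟨hS, hm.coeFn_toLp, ?_⟩, rfl⟩
  have : (fun j a => ((Real.sqrt κ)⁻¹ : ℂ) • k (some (some (j, a)))) = g := by
    funext j a
    have h0 : (Real.sqrt κ : ℂ) ≠ 0 := by exact_mod_cast (Real.sqrt_pos.2 hκ).ne'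
    change ((Real.sqrt κ)⁻¹ : ℂ) • ((Real.sqrt κ : ℂ) • g j a) = g j a
    rw [smul_smul, inv_mul_cancel₀ h0, one_smul]
  rw [this]
  exact hg

variable {S}

lemma memFormDomain_of_mem_formSpace (hV : Measurable V) (hc : ∀ x, -c ≤ V x)
    {k : FormAmbient D} (hk : k ∈ formSpace κ D V c S) : MemFormDomain D V (k none) := by
  refine ⟨⟨_, hk.2.2⟩, ?_⟩
  rw [integrableOn_mul_norm_sq_iff hV hc]
  exact (Lp.memLp (k (some none))).ae_eq hk.2.1

lemma formSpace_some (hκ : 0 < κ) (hD : IsOpen D) {k : FormAmbient D}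
    (hk : k ∈ formSpace κ D V c S) (j : Fin n) (a : Fin 3) :
    k (some (some (j, a))) = (Real.sqrt κ : ℂ) • weakGrad D (k none) j a := by
  rw [weakGrad_eq hD hk.2.2]
  have h0 : (Real.sqrt κ : ℂ) ≠ 0 := by exact_mod_cast (Real.sqrt_pos.2 hκ).ne'
  rw [smul_smul, mul_inv_cancel₀ h0, one_smul]

/-- The wave function determines the other components. This carries uniqueness of solutions over
from wave functions to the abstract form space. -/
lemma eq_of_mem_formSpace (hκ : 0 < κ) (hD : IsOpen D) {k l : FormAmbient D}
    (hk : k ∈ formSpace κ D V c S) (hl : l ∈ formSpace κ D V c S) (h : k none = l none) :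
    k = l := by
  ext1 i
  match i with
  | none => exact h
  | some none =>
    refine Lp.ext ?_
    filter_upwards [hk.2.1, hl.2.1] with x hx hx'
    rw [hx, hx', h]
  | some (some (j, a)) => rw [formSpace_some hκ hD hk, formSpace_some hκ hD hl, h]

/-- The shift is `c + 1`: the component `(V + c)^{1/2} ψ` contributes `c`, and `ψ` itself
contributes `1`. The latter makes the form norm dominate the `L²` norm. -/
lemma inner_formSpace (hκ : 0 < κ) (hD : IsOpen D) (hc : ∀ x, -c ≤ V x) {k l : FormAmbient D}
    (hk : k ∈ formSpace κ D V c S) (hl : l ∈ formSpace κ D V c S) :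
    inner ℂ k l = energyForm κ D V (k none) (l none)
      + ((c + 1 : ℝ) : ℂ) * inner ℂ (k none) (l none) := by
  rw [PiLp.inner_apply, Fintype.sum_option, Fintype.sum_option, Fintype.sum_prod_type,
    energyForm]
  have e1 : inner ℂ (k (some none)) (l (some none))
      = (∫ x in D, (V x : ℂ) * (starRingEnd ℂ (k none x) * l none x))
        + (c : ℂ) * inner ℂ (k none) (l none) := by
    have i1 := L2.integrable_inner (𝕜 := ℂ) (k (some none)) (l (some none))
    have i2 := (L2.integrable_inner (𝕜 := ℂ) (k none) (l none)).const_mul (c : ℂ)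
    have e : ∀ᵐ x ∂(volume.restrict D), inner ℂ (k (some none) x) (l (some none) x)
        - (c : ℂ) * inner ℂ (k none x) (l none x)
        = (V x : ℂ) * (starRingEnd ℂ (k none x) * l none x) := by
      filter_upwards [hk.2.1, hl.2.1] with x hx hx'
      rw [hx, hx']
      simp only [RCLike.inner_apply, map_mul, Complex.conj_ofReal]
      have : (Real.sqrt (V x + c) : ℂ) * (Real.sqrt (V x + c) : ℂ) = (V x : ℂ) + c := by
        rw [← Complex.ofReal_mul, Real.mul_self_sqrt (by linarith [hc x])]; simp
      linear_combination (l none x * starRingEnd ℂ (k none x)) * this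
    rw [← integral_congr_ae e, integral_sub i1 i2, integral_const_mul, L2.inner_def, L2.inner_def]
    ring
  have e2 : ∀ j a, inner ℂ (k (some (some (j, a)))) (l (some (some (j, a))))
      = (κ : ℂ) * inner ℂ (weakGrad D (k none) j a) (weakGrad D (l none) j a) := by
    intro j a
    rw [formSpace_some hκ hD hk, formSpace_some hκ hD hl, inner_smul_left, inner_smul_right,
      Complex.conj_ofReal, ← mul_assoc, ← Complex.ofReal_mul, Real.mul_self_sqrt hκ.le]
  simp only [e1, e2, ← Finset.mul_sum]
  push_cast
  ring

/-- The eigenvalue-type equation for `E` in the weak sense becomes, after adding `c + 1` times the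
inner product on both sides, the abstract equation in the form space. -/
lemma spec_eq_formSpec (hκ : 0 < κ) (hD : IsOpen D) (hV : Measurable V)
    (hc : ∀ x, -c ≤ V x) :
    spec κ D V (S : Set (L2 D)) = formSpec (formIncl κ D V c (S := S)) (-(c + 1)) := by
  have hform : ∀ φ ∈ S, MemFormDomain D V φ → ∃ k ∈ formSpace κ D V c S, k none = φ := by
    rintro φ hφ ⟨⟨g, hg⟩, hi⟩
    exact exists_mem_formSpace S hκ hV hc hφ hg hi
  have graph_iff : ∀ (E : ℝ) (η : S) (k : formSpace κ D V c S),
      (OperatorGraph κ D V (S : Set (L2 D)) ((k : FormAmbient D) none)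
          (η + (E : ℂ) • (k : FormAmbient D) none) ↔
        ∀ k' : formSpace κ D V c S, inner ℂ k' k =
          inner ℂ (formIncl κ D V c (S := S) k')
            (η + ((E - -(c + 1) : ℝ) : ℂ) • formIncl κ D V c k)) := by
    intro E η k
    have hval : ∀ k' : formSpace κ D V c S,
        (inner ℂ k' k = inner ℂ (formIncl κ D V c (S := S) k')
            (η + ((E - -(c + 1) : ℝ) : ℂ) • formIncl κ D V c k)) ↔
        energyForm κ D V ((k' : FormAmbient D) none) ((k : FormAmbient D) none)
          = inner ℂ ((k' : FormAmbient D) none)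
            ((η : L2 D) + (E : ℂ) • (k : FormAmbient D) none) := by
      intro k'
      rw [Submodule.coe_inner, Submodule.coe_inner, inner_formSpace hκ hD hc k'.2 k.2]
      have e1 : ((η + ((E - -(c + 1) : ℝ) : ℂ) • formIncl κ D V c k : S) : L2 D)
          = (η : L2 D) + (E : ℂ) • (k : FormAmbient D) none
            + ((c + 1 : ℝ) : ℂ) • (k : FormAmbient D) none := by
        have : ((formIncl κ D V c k : S) : L2 D) = (k : FormAmbient D) none := rfl
        rw [Submodule.coe_add, Submodule.coe_smul, this, add_assoc, ← add_smul]
        push_cast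
        congr 2
        ring
      have e2 : ((formIncl κ D V c k' : S) : L2 D) = (k' : FormAmbient D) none := rfl
      rw [e1, e2, inner_add_right _ _ (((c + 1 : ℝ) : ℂ) • (k : FormAmbient D) none),
        inner_smul_right _ ((k : FormAmbient D) none) ((c + 1 : ℝ) : ℂ)]
      exact add_left_inj _
    constructor
    · rintro ⟨-, -, -, h⟩ k'
      rw [hval]
      exact h _ k'.2.1 (memFormDomain_of_mem_formSpace hV hc k'.2)
    · intro h
      refine ⟨k.2.1, S.add_mem η.2 (S.smul_mem _ k.2.1),
        memFormDomain_of_mem_formSpace hV hc k.2, fun φ hφ hφ' => ?_⟩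
      obtain ⟨k', hk', rfl⟩ := hform φ hφ hφ'
      exact (hval ⟨k', hk'⟩).1 (h ⟨k', hk'⟩)
  ext E
  simp only [spec, formSpec, Set.mem_ofPred_eq, not_iff_not]
  constructor
  · intro h η
    obtain ⟨ψ, hψ, huniq⟩ := h η η.2
    obtain ⟨k, hk, rfl⟩ := hform ψ hψ.1 hψ.2.2.1
    refine ⟨⟨k, hk⟩, (graph_iff E η ⟨k, hk⟩).1 hψ, fun l hl => ?_⟩
    exact Subtype.ext (eq_of_mem_formSpace hκ hD l.2 hk (huniq _ ((graph_iff E η l).2 hl)))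
  · intro h η hη
    obtain ⟨k, hk, huniq⟩ := h ⟨η, hη⟩
    refine ⟨(k : FormAmbient D) none, (graph_iff E ⟨η, hη⟩ k).2 hk, fun φ hφ => ?_⟩
    obtain ⟨l, hl, rfl⟩ := hform φ hφ.1 hφ.2.2.1
    have := huniq ⟨l, hl⟩ ((graph_iff E ⟨η, hη⟩ ⟨l, hl⟩).1 hφ)
    rw [← this]

lemma norm_sq_formSpace (hκ : 0 < κ) (hD : IsOpen D) (hc : ∀ x, -c ≤ V x) {k : FormAmbient D}
    (hk : k ∈ formSpace κ D V c S) {g : Fin n → Fin 3 → L2 D}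
    (hg : HasWeakGradient D (k none) g) :
    ‖k‖ ^ 2 = κ * (∑ j, ∑ a, ‖g j a‖ ^ 2) + (∫ x in D, V x * ‖k none x‖ ^ 2)
      + (c + 1) * ‖k none‖ ^ 2 := by
  have h := inner_formSpace hκ hD hc hk hk
  rw [energyForm, weakGrad_eq hD hg] at h
  simp only [inner_self_eq_norm_sq_to_K] at h
  have e : (∫ x in D, (V x : ℂ) * (starRingEnd ℂ (k none x) * k none x))
      = ((∫ x in D, V x * ‖k none x‖ ^ 2 : ℝ) : ℂ) := by
    rw [← integral_complex_ofReal]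
    refine integral_congr_ae (Filter.Eventually.of_forall fun x => ?_)
    simp only
    rw [mul_comm (starRingEnd ℂ _), Complex.mul_conj, Complex.normSq_eq_norm_sq]
    push_cast; ring
  rw [e] at h
  refine Complex.ofReal_injective (Eq.trans ?_ (h.trans ?_)) <;> push_cast <;> rfl

/-- The bottom of the spectrum bounds the energy of every state in the form domain. -/
theorem sInf_spec_mul_norm_sq_le (hκ : 0 < κ) (hD : IsOpen D) (hV : Measurable V)
    (hc : ∀ x, -c ≤ V x) (hS : IsClosed (S : Set (L2 D))) {ψ : L2 D} (hψ : ψ ∈ S)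
    {g : Fin n → Fin 3 → L2 D} (hg : HasWeakGradient D ψ g)
    (hi : IntegrableOn (fun x => V x * ‖ψ x‖ ^ 2) D) :
    sInf (spec κ D V (S : Set (L2 D))) * ‖ψ‖ ^ 2
      ≤ κ * (∑ j, ∑ a, ‖g j a‖ ^ 2) + ∫ x in D, V x * ‖ψ x‖ ^ 2 := by
  obtain ⟨k, hk, rfl⟩ := exists_mem_formSpace S hκ hV hc hψ hg hi
  have : CompleteSpace S := hS.completeSpace_coe
  have : CompleteSpace (formSpace κ D V c S) := (isClosed_formSpace κ D V c hS).completeSpace_coe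
  have h := sInf_formSpec_mul_le (formIncl κ D V c (S := S)) (-(c + 1)) ⟨k, hk⟩
  rw [← spec_eq_formSpec hκ hD hV hc] at h
  have e1 : ‖formIncl κ D V c (S := S) ⟨k, hk⟩‖ = ‖k none‖ := rfl
  have e2 : ‖(⟨k, hk⟩ : formSpace κ D V c S)‖ = ‖k‖ := rfl
  rw [e1, e2, norm_sq_formSpace hκ hD hc hk hg] at h
  linarith

/-- A lower bound for the energy is a lower bound for the spectrum. -/
theorem le_sInf_spec (hκ : 0 < κ) (hD : IsOpen D) (hV : Measurable V)
    (hc : ∀ x, -c ≤ V x) (hS : IsClosed (S : Set (L2 D))) {b : ℝ}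
    (hne : ∃ ψ ∈ S, ψ ≠ 0 ∧ MemFormDomain D V ψ)
    (hb : ∀ ψ ∈ S, ∀ g, HasWeakGradient D ψ g → IntegrableOn (fun x => V x * ‖ψ x‖ ^ 2) D →
      b * ‖ψ‖ ^ 2 ≤ κ * (∑ j, ∑ a, ‖g j a‖ ^ 2) + ∫ x in D, V x * ‖ψ x‖ ^ 2) :
    b ≤ sInf (spec κ D V (S : Set (L2 D))) := by
  have : CompleteSpace S := hS.completeSpace_coe
  have : CompleteSpace (formSpace κ D V c S) := (isClosed_formSpace κ D V c hS).completeSpace_coe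
  rw [spec_eq_formSpec hκ hD hV hc]
  refine le_sInf_formSpec _ _ _ ?_ fun k => ?_
  · obtain ⟨ψ, hψS, hψ0, ⟨g, hg⟩, hi⟩ := hne
    obtain ⟨k, hk, rfl⟩ := exists_mem_formSpace S hκ hV hc hψS hg hi
    intro h0
    apply hψ0
    have : ((formIncl κ D V c (S := S) ⟨k, hk⟩ : S) : L2 D) = 0 := by rw [h0]; rfl
    exact this
  · have h := hb _ k.2.1 _ k.2.2.2 (memFormDomain_of_mem_formSpace hV hc k.2).2
    have e1 : ‖formIncl κ D V c k‖ = ‖(k : FormAmbient D) none‖ := rfl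
    have e2 : ‖k‖ = ‖(k : FormAmbient D)‖ := rfl
    rw [e1, e2, norm_sq_formSpace hκ hD hc k.2 k.2.2.2]
    linarith

end FormSpace

/-! ### The Yukawa potential as a mixture of Gaussians, and its Fourier transform. -/

section Yukawa

open Set Filter Topology Real FourierTransform

/-- The antiderivatives used below involve `1/u` and only have a limit at `0`; the proof redefines
them there by that limit. -/
lemma integral_Ioi_of_hasDerivAt_of_tendsto_right {g g' : ℝ → ℝ} {m l : ℝ}
    (hderiv : ∀ x ∈ Ioi (0 : ℝ), HasDerivAt g (g' x) x) (hpos : ∀ x ∈ Ioi (0 : ℝ), 0 ≤ g' x)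
    (hm : Tendsto g (𝓝[>] 0) (𝓝 m)) (hl : Tendsto g atTop (𝓝 l)) :
    IntegrableOn g' (Ioi 0) ∧ ∫ x in Ioi (0 : ℝ), g' x = l - m := by
  classical
  let G := Function.update g 0 m
  have hG : ∀ x ∈ Ioi (0 : ℝ), G x = g x := fun x hx => Function.update_of_ne (ne_of_gt hx) _ _
  have h0 : G 0 = m := Function.update_self _ _ _
  have hcont : ContinuousWithinAt G (Ici 0) 0 := continuousWithinAt_update_same.2 (by
    rwa [Ici_sdiff_left])
  have hd : ∀ x ∈ Ioi (0 : ℝ), HasDerivAt G (g' x) x := fun x hx =>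
    (hderiv x hx).congr_of_eventuallyEq (by
      filter_upwards [Ioi_mem_nhds hx] with y hy using hG y hy)
  have hl' : Tendsto G atTop (𝓝 l) := hl.congr' (by
    filter_upwards [Ioi_mem_atTop (0 : ℝ)] with y hy using (hG y hy).symm)
  exact ⟨integrableOn_Ioi_deriv_of_nonneg hcont hd hpos hl',
    by rw [integral_Ioi_of_hasDerivAt_of_nonneg hcont hd hpos hl', h0]⟩

/-- The integral `∫₀^∞ exp(-a²u² - b²/u²) du`. -/
lemma integral_exp_neg_sq_add_inv_sq {a b : ℝ} (ha : 0 < a) (hb : 0 < b) :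
    IntegrableOn (fun u => rexp (-(a ^ 2 * u ^ 2) - b ^ 2 / u ^ 2)) (Ioi 0) ∧
      ∫ u in Ioi (0 : ℝ), rexp (-(a ^ 2 * u ^ 2) - b ^ 2 / u ^ 2)
        = √π / (2 * a) * rexp (-(2 * a * b)) := by
  let Φ : ℝ → ℝ := fun v => ∫ s in (0 : ℝ)..v, rexp (-1 * s ^ 2)
  have hint : Integrable fun s : ℝ => rexp (-1 * s ^ 2) := integrable_exp_neg_mul_sq one_pos
  have hΦ : ∀ v, HasDerivAt Φ (rexp (-1 * v ^ 2)) v := fun v =>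
    intervalIntegral.integral_hasDerivAt_right (hint.intervalIntegrable)
      ((by fun_prop : Continuous fun s : ℝ => rexp (-1 * s ^ 2)).stronglyMeasurableAtFilter _ _)
      (by fun_prop : Continuous fun s : ℝ => rexp (-1 * s ^ 2)).continuousAt
  have hG : ∫ s in Ioi (0 : ℝ), rexp (-1 * s ^ 2) = √π / 2 := by
    rw [integral_gaussian_Ioi]; simp
  have htop : Tendsto Φ atTop (𝓝 (√π / 2)) := by
    rw [← hG]
    exact intervalIntegral_tendsto_integral_Ioi 0 hint.integrableOn tendsto_id
  have hodd : ∀ v, Φ (-v) = -Φ v := by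
    intro v
    have := intervalIntegral.integral_comp_neg (a := 0) (b := v) fun s : ℝ => rexp (-1 * s ^ 2)
    simp only [neg_zero] at this
    simp only [Φ]
    rw [intervalIntegral.integral_symm, ← this]
    congr 1
    refine intervalIntegral.integral_congr fun s _ => ?_
    simp
  have hbot : Tendsto Φ atBot (𝓝 (-(√π / 2))) := by
    have := (htop.comp tendsto_neg_atBot_atTop).neg
    refine this.congr fun v => ?_
    simp [hodd]
  -- An antiderivative up to the factor `2a`. Completing squares gives `a²u² + b²/u² = (au ∓ b/u)² ±
  -- 2ab`; in the sum of the two derivatives the inner derivatives `a + b/u²` and `a - b/u²` add up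
  -- to `2a`.
  let A : ℝ → ℝ := fun u => rexp (-(2 * a * b)) * Φ (a * u - b / u)
    + rexp (2 * a * b) * Φ (a * u + b / u)
  have hA : ∀ u ∈ Ioi (0 : ℝ),
      HasDerivAt A (2 * a * rexp (-(a ^ 2 * u ^ 2) - b ^ 2 / u ^ 2)) u := by
    intro u hu
    have hu' : u ≠ 0 := ne_of_gt hu
    have d1 : HasDerivAt (fun u : ℝ => a * u) a u := by simpa using (hasDerivAt_id u).const_mul a
    have d2 : HasDerivAt (fun u : ℝ => b / u) (-b / u ^ 2) u := by
      have := (hasDerivAt_inv hu').const_mul b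
      simpa [div_eq_mul_inv] using this
    have d3 := ((hΦ _).comp u (d1.sub d2)).const_mul (rexp (-(2 * a * b)))
    have d4 := ((hΦ _).comp u (d1.add d2)).const_mul (rexp (2 * a * b))
    have d5 := d3.add d4
    refine d5.congr_deriv ?_
    have e1 : rexp (-(2 * a * b)) * rexp (-1 * (a * u - b / u) ^ 2)
        = rexp (-(a ^ 2 * u ^ 2) - b ^ 2 / u ^ 2) := by
      rw [← Real.exp_add]; congr 1; field_simp; ring
    have e2 : rexp (2 * a * b) * rexp (-1 * (a * u + b / u) ^ 2)
        = rexp (-(a ^ 2 * u ^ 2) - b ^ 2 / u ^ 2) := by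
      rw [← Real.exp_add]; congr 1; field_simp; ring
    simp only [Pi.sub_apply, Pi.add_apply]
    rw [← mul_assoc, ← mul_assoc, e1, e2]
    ring
  have ht1 : Tendsto (fun u : ℝ => a * u - b / u) (𝓝[>] 0) atBot := by
    have h1 : Tendsto (fun u : ℝ => a * u) (𝓝[>] 0) (𝓝 (a * 0)) :=
      ((continuous_const.mul continuous_id).tendsto 0).mono_left nhdsWithin_le_nhds
    have h2 : Tendsto (fun u : ℝ => b / u) (𝓝[>] 0) atTop := by
      simpa [div_eq_mul_inv] using tendsto_inv_nhdsGT_zero.const_mul_atTop hb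
    simpa [sub_eq_add_neg] using h1.add_atBot (tendsto_neg_atTop_atBot.comp h2)
  have ht2 : Tendsto (fun u : ℝ => a * u + b / u) (𝓝[>] 0) atTop := by
    have h1 : Tendsto (fun u : ℝ => a * u) (𝓝[>] 0) (𝓝 (a * 0)) :=
      ((continuous_const.mul continuous_id).tendsto 0).mono_left nhdsWithin_le_nhds
    have h2 : Tendsto (fun u : ℝ => b / u) (𝓝[>] 0) atTop := by
      simpa [div_eq_mul_inv] using tendsto_inv_nhdsGT_zero.const_mul_atTop hb
    exact h1.add_atTop h2
  have ht0 : Tendsto (fun u : ℝ => b / u) atTop (𝓝 0) := tendsto_const_nhds.div_atTop tendsto_id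
  have ht3 : Tendsto (fun u : ℝ => a * u - b / u) atTop atTop := by
    simpa [sub_eq_add_neg] using (tendsto_id.const_mul_atTop ha).atTop_add ht0.neg
  have ht4 : Tendsto (fun u : ℝ => a * u + b / u) atTop atTop :=
    (tendsto_id.const_mul_atTop ha).atTop_add ht0
  have hm := ((hbot.comp ht1).const_mul (rexp (-(2 * a * b)))).add
    ((htop.comp ht2).const_mul (rexp (2 * a * b)))
  have hl := ((htop.comp ht3).const_mul (rexp (-(2 * a * b)))).add
    ((htop.comp ht4).const_mul (rexp (2 * a * b)))
  obtain ⟨h1, h2⟩ := integral_Ioi_of_hasDerivAt_of_tendsto_right hA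
    (fun u _ => by positivity) hm hl
  have h3 : IntegrableOn (fun u => (2 * a)⁻¹ * (2 * a *
      rexp (-(a ^ 2 * u ^ 2) - b ^ 2 / u ^ 2))) (Ioi 0) := h1.const_mul _
  constructor
  · refine h3.congr (Eventually.of_forall fun u => ?_)
    simp only
    field_simp
  · rw [integral_const_mul] at h2
    have h4 : 2 * a ≠ 0 := by positivity
    rw [← mul_right_inj' h4, h2]
    field_simp
    ring

/-- The integral `∫₀^∞ u⁻³ exp(-β/u²) du`. -/
lemma integral_inv_cube_mul_exp {β : ℝ} (hβ : 0 < β) :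
    IntegrableOn (fun u => (u ^ 3)⁻¹ * rexp (-(β / u ^ 2))) (Ioi 0) ∧
      ∫ u in Ioi (0 : ℝ), (u ^ 3)⁻¹ * rexp (-(β / u ^ 2)) = 1 / (2 * β) := by
  let A : ℝ → ℝ := fun u => 1 / (2 * β) * rexp (-(β / u ^ 2))
  have hA : ∀ u ∈ Ioi (0 : ℝ), HasDerivAt A ((u ^ 3)⁻¹ * rexp (-(β / u ^ 2))) u := by
    intro u hu
    have hu' : u ≠ 0 := ne_of_gt hu
    have d1 : HasDerivAt (fun u : ℝ => -(β / u ^ 2)) (2 * β / u ^ 3) u := by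
      have h1 : HasDerivAt (fun u : ℝ => u ^ 2) (2 * u) u := by simpa using hasDerivAt_pow 2 u
      have h2 := ((h1.inv (pow_ne_zero 2 hu')).const_mul β).neg
      refine (h2.congr_deriv ?_).congr_of_eventuallyEq (Eventually.of_forall fun v => ?_)
      · field_simp
      · simp [div_eq_mul_inv]
    refine (d1.exp.const_mul (1 / (2 * β))).congr_deriv ?_
    field_simp
  have hm : Tendsto A (𝓝[>] 0) (𝓝 (1 / (2 * β) * 0)) := by
    refine Tendsto.const_mul _ (Real.tendsto_exp_atBot.comp ?_)
    refine tendsto_neg_atTop_atBot.comp ?_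
    have h1 : Tendsto (fun u : ℝ => (u⁻¹) ^ 2) (𝓝[>] 0) atTop :=
      (tendsto_pow_atTop two_ne_zero).comp tendsto_inv_nhdsGT_zero
    refine (h1.const_mul_atTop hβ).congr fun u => ?_
    simp [div_eq_mul_inv]
  have hl : Tendsto A atTop (𝓝 (1 / (2 * β) * 1)) := by
    refine Tendsto.const_mul _ ?_
    have h1 : Tendsto (fun u : ℝ => -(β / u ^ 2)) atTop (𝓝 0) := by
      have := (tendsto_const_nhds (x := β)).div_atTop (tendsto_pow_atTop (α := ℝ) two_ne_zero)
      simpa using this.neg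
    have := (Real.continuous_exp.tendsto 0).comp h1
    rwa [Real.exp_zero] at this
  obtain ⟨h1, h2⟩ := integral_Ioi_of_hasDerivAt_of_tendsto_right hA
    (fun u hu => by have : 0 < u := hu; positivity) hm hl
  exact ⟨h1, by rw [h2]; ring⟩

lemma yukawa_nonneg (ν : ℝ) (x : R3) : 0 ≤ yukawa ν x := by unfold yukawa; positivity

lemma measurable_yukawa (ν : ℝ) : Measurable (yukawa ν) := by
  unfold yukawa; fun_prop

/-- Subordination: the previous integral with `a = ‖z‖` and `b = ν/2`. Each integrand is Gaussian in
`z`, so its Fourier transform is explicit. -/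
lemma yukawa_eq_integral {ν : ℝ} (hν : 0 < ν) {z : R3} (hz : z ≠ 0) :
    IntegrableOn (fun u => 2 / √π * rexp (-(‖z‖ ^ 2 * u ^ 2) - (ν / 2) ^ 2 / u ^ 2)) (Ioi 0) ∧
    ∫ u in Ioi (0 : ℝ), 2 / √π * rexp (-(‖z‖ ^ 2 * u ^ 2) - (ν / 2) ^ 2 / u ^ 2)
      = yukawa ν z := by
  have hz' : 0 < ‖z‖ := norm_pos_iff.2 hz
  obtain ⟨h1, h2⟩ := integral_exp_neg_sq_add_inv_sq hz' (half_pos hν)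
  refine ⟨h1.const_mul _, ?_⟩
  rw [integral_const_mul, h2, yukawa]
  have : √π ≠ 0 := by positivity
  have e : -(2 * ‖z‖ * (ν / 2)) = -ν * ‖z‖ := by ring
  rw [e]
  field_simp

lemma integrable_yukawa {ν : ℝ} (hν : 0 < ν) : Integrable (yukawa ν) := by
  have h : Integrable (fun x : R3 => (fun r : ℝ => r⁻¹ * rexp (-ν * r)) ‖x‖) := by
    refine (integrable_fun_norm_addHaar (volume : Measure R3)
      (f := fun r : ℝ => r⁻¹ * rexp (-ν * r))).2 ?_
    have h1 : IntegrableOn (fun x : ℝ => x ^ (1 : ℝ) * rexp (-ν * x ^ (1 : ℝ))) (Ioi 0) :=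
      integrableOn_rpow_mul_exp_neg_mul_rpow (by norm_num) one_pos hν
    refine h1.congr_fun (fun x hx => ?_) measurableSet_Ioi
    have : x ≠ 0 := ne_of_gt hx
    simp only [Real.rpow_one, smul_eq_mul]
    have e : Module.finrank ℝ R3 - 1 = 2 := by simp
    rw [e]; field_simp
  exact h

lemma ae_ne_zero : ∀ᵐ z : R3, z ≠ 0 := by
  simp [ae_iff]

/-- The Fourier transform of the Yukawa potential. -/
lemma fourier_yukawa {ν : ℝ} (hν : 0 < ν) (p : R3) :
    𝓕 (fun z : R3 => (yukawa ν z : ℂ)) p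
      = ((4 * π / (4 * π ^ 2 * ‖p‖ ^ 2 + ν ^ 2) : ℝ) : ℂ) := by
  let k : R3 → ℝ → ℝ := fun z u => 2 / √π * rexp (-(‖z‖ ^ 2 * u ^ 2) - (ν / 2) ^ 2 / u ^ 2)
  let e : R3 → ℂ := fun z => Complex.exp (↑(-2 * π * inner ℝ z p) * Complex.I)
  have he : ∀ z, ‖e z‖ = 1 := fun z => Complex.norm_exp_ofReal_mul_I _
  have hk : ∀ z u, 0 ≤ k z u := fun z u => by positivity
  have hkm : Measurable (Function.uncurry k) := by
    simp only [Function.uncurry_def, k]; fun_prop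
  have hem : Measurable e := by fun_prop
  have hF : 𝓕 (fun z : R3 => (yukawa ν z : ℂ)) p
      = ∫ z : R3, ∫ u in Ioi (0 : ℝ), e z * (k z u : ℂ) := by
    rw [Real.fourier_eq']
    refine integral_congr_ae ?_
    filter_upwards [ae_ne_zero] with z hz
    rw [integral_const_mul, integral_complex_ofReal, (yukawa_eq_integral hν hz).2, smul_eq_mul]
  -- Absolute integrability for Fubini: the phase has modulus one, and the remaining kernel is
  -- nonnegative with `u`-integral the integrable Yukawa potential.
  have hint : Integrable (Function.uncurry fun z u => e z * (k z u : ℂ))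
      ((volume : Measure R3).prod (volume.restrict (Ioi (0 : ℝ)))) := by
    have hm : Measurable (Function.uncurry fun z u => e z * (k z u : ℂ)) :=
      (hem.comp measurable_fst).mul (Complex.measurable_ofReal.comp hkm)
    rw [integrable_prod_iff hm.aestronglyMeasurable]
    have hnorm : ∀ z u, ‖e z * (k z u : ℂ)‖ = k z u := fun z u => by
      rw [norm_mul, he, one_mul, Complex.norm_real, Real.norm_of_nonneg (hk z u)]
    constructor
    · filter_upwards [ae_ne_zero] with z hz
      exact ((yukawa_eq_integral hν hz).1.ofReal (𝕜 := ℂ)).const_mul (e z)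
    · refine (integrable_yukawa hν).congr ?_
      filter_upwards [ae_ne_zero] with z hz
      simp only [Function.uncurry_apply_pair, hnorm]
      exact (yukawa_eq_integral hν hz).2.symm
  rw [hF, integral_integral_swap hint]
  have hinner : ∀ u ∈ Ioi (0 : ℝ), ∫ z : R3, e z * (k z u : ℂ)
      = ((2 * π * ((u ^ 3)⁻¹ * rexp (-((π ^ 2 * ‖p‖ ^ 2 + (ν / 2) ^ 2) / u ^ 2))) : ℝ) : ℂ) := by
    intro u hu
    have hu' : 0 < u := hu
    have hg := fourier_gaussian_innerProductSpace (V := R3) (b := ((u ^ 2 : ℝ) : ℂ))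
      (by rw [Complex.ofReal_re]; positivity) p
    rw [Real.fourier_eq'] at hg
    have e1 : ∀ z : R3, e z * (k z u : ℂ) = ((2 / √π * rexp (-((ν / 2) ^ 2 / u ^ 2)) : ℝ) : ℂ) *
        (e z • Complex.exp (-((u ^ 2 : ℝ) : ℂ) * ‖z‖ ^ 2)) := by
      intro z
      have : k z u = 2 / √π * rexp (-((ν / 2) ^ 2 / u ^ 2)) * rexp (-(u ^ 2) * ‖z‖ ^ 2) := by
        simp only [k]; rw [mul_assoc, ← Real.exp_add]; congr 2; ring
      rw [this]; push_cast; rw [smul_eq_mul]; ring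
    simp_rw [e1]
    rw [integral_const_mul, hg]
    have e2 : ((π : ℂ) / ((u ^ 2 : ℝ) : ℂ)) ^ ((Module.finrank ℝ R3 : ℂ) / 2)
        = ((π * √π * (u ^ 3)⁻¹ : ℝ) : ℂ) := by
      have h1 : ((π : ℂ) / ((u ^ 2 : ℝ) : ℂ)) = ((π / u ^ 2 : ℝ) : ℂ) := by push_cast; rfl
      have h2 : ((Module.finrank ℝ R3 : ℂ) / 2) = (((3 : ℝ) / 2 : ℝ) : ℂ) := by simp
      rw [h1, h2, ← Complex.ofReal_cpow (by positivity)]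
      congr 1
      have h3 : (3 / 2 : ℝ) = 1 + 1 / 2 := by norm_num
      rw [h3, Real.rpow_add (by positivity), Real.rpow_one, ← Real.sqrt_eq_rpow,
        Real.sqrt_div pi_nonneg, Real.sqrt_sq hu'.le]
      field_simp
    have e3 : Complex.exp (-(π : ℂ) ^ 2 * (‖p‖ : ℂ) ^ 2 / ((u ^ 2 : ℝ) : ℂ))
        = ((rexp (-π ^ 2 * ‖p‖ ^ 2 / u ^ 2) : ℝ) : ℂ) := by push_cast; rfl
    rw [e2, e3, ← Complex.ofReal_mul, ← Complex.ofReal_mul]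
    congr 1
    have e4 : rexp (-((π ^ 2 * ‖p‖ ^ 2 + (ν / 2) ^ 2) / u ^ 2))
        = rexp (-((ν / 2) ^ 2 / u ^ 2)) * rexp (-π ^ 2 * ‖p‖ ^ 2 / u ^ 2) := by
      rw [← Real.exp_add]; congr 1; ring
    rw [e4]
    have : √π ≠ 0 := by positivity
    field_simp
  rw [setIntegral_congr_fun measurableSet_Ioi hinner, integral_complex_ofReal, integral_const_mul,
    (integral_inv_cube_mul_exp (by positivity)).2]
  congr 1
  have : π ^ 2 * ‖p‖ ^ 2 + (ν / 2) ^ 2 ≠ 0 := by positivity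
  have h2 : 4 * π ^ 2 * ‖p‖ ^ 2 + ν ^ 2 ≠ 0 := by positivity
  field_simp
  ring

end Yukawa

/-! ### The cutoff, its autocorrelation and its momentum density. -/

section Cutoff

open Set Filter Topology Real FourierTransform

lemma cube_eq_preimage (a b : ℝ) :
    cube a b = WithLp.ofLp ⁻¹' (Icc (fun _ : Fin 3 => a) fun _ => b) := by
  ext x
  simp [cube, Pi.le_def, forall_and]

lemma isClosed_cube (a b : ℝ) : IsClosed (cube a b) := by
  rw [cube_eq_preimage]
  exact isClosed_Icc.preimage (PiLp.continuous_ofLp 2 _)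

lemma measurableSet_cube (a b : ℝ) : MeasurableSet (cube a b) := (isClosed_cube a b).measurableSet

lemma isCompact_cube (a b : ℝ) : IsCompact (cube a b) := by
  rw [cube_eq_preimage]
  exact (EuclideanSpace.equiv (Fin 3) ℝ).toHomeomorph.isCompact_preimage.2 isCompact_Icc

lemma volume_cube (a b : ℝ) : volume (cube a b) = ENNReal.ofReal (b - a) ^ 3 := by
  rw [cube_eq_preimage, (PiLp.volume_preserving_ofLp (Fin 3)).measure_preimage
    measurableSet_Icc.nullMeasurableSet, Real.volume_Icc_pi]
  simp

lemma volume_real_cube {a b : ℝ} (h : a ≤ b) : volume.real (cube a b) = (b - a) ^ 3 := by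
  rw [Measure.real, volume_cube, ENNReal.toReal_pow, ENNReal.toReal_ofReal (by linarith)]

lemma volume_cube_lt_top (a b : ℝ) : volume (cube a b) < ⊤ := (isCompact_cube a b).measure_lt_top

variable {B : ℕ → ℝ} {t : ℝ} {χ : R3 → ℝ}

lemma IsCutoff.continuous (hχ : IsCutoff B t χ) : Continuous χ := hχ.contDiff.continuous

lemma IsCutoff.hasCompactSupport (hχ : IsCutoff B t χ) : HasCompactSupport χ :=
  (isCompact_cube _ _).of_isClosed_subset (isClosed_tsupport χ) hχ.support_subset

lemma IsCutoff.eq_zero (hχ : IsCutoff B t χ) {x : R3}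
    (hx : x ∉ cube ((-1 + t) / 2) ((1 - t) / 2)) : χ x = 0 := by
  by_contra h
  exact hx (hχ.support_subset (subset_tsupport χ h))

lemma IsCutoff.integrable_sq (hχ : IsCutoff B t χ) : Integrable fun x => χ x ^ 2 := by
  have h : HasCompactSupport fun x => χ x * χ x := hχ.hasCompactSupport.mul_right
  simp only [sq]
  exact (hχ.continuous.mul hχ.continuous).integrable_of_hasCompactSupport h

lemma IsCutoff.integrable (hχ : IsCutoff B t χ) : Integrable χ :=
  hχ.continuous.integrable_of_hasCompactSupport hχ.hasCompactSupport

lemma setIntegral_const_cube_le {f : R3 → ℝ} {a b m : ℝ} (hab : a ≤ b) (hf : Integrable f)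
    (h0 : ∀ x, 0 ≤ f x) (hm : ∀ x ∈ cube a b, m ≤ f x) : m * (b - a) ^ 3 ≤ ∫ x, f x := by
  calc m * (b - a) ^ 3 = ∫ x in cube a b, m := by
        rw [setIntegral_const, volume_real_cube hab, smul_eq_mul, mul_comm]
    _ ≤ ∫ x in cube a b, f x :=
        setIntegral_mono_on (integrableOn_const (volume_cube_lt_top a b).ne) hf.integrableOn
          (measurableSet_cube a b) hm
    _ ≤ ∫ x, f x := setIntegral_le_integral hf (Eventually.of_forall h0)

lemma IsCutoff.integral_sq_ge (hχ : IsCutoff B t χ) (ht : t < 1 / 2) :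
    (1 - 2 * t) ^ 3 ≤ ∫ x, χ x ^ 2 := by
  have := setIntegral_const_cube_le (a := (-1 + 2 * t) / 2) (b := (1 - 2 * t) / 2) (m := 1)
    (by linarith) hχ.integrable_sq (fun x => sq_nonneg _) fun x hx => by
      rw [hχ.eq_one x hx]; norm_num
  refine le_trans (le_of_eq ?_) this
  ring

lemma IsCutoff.integral_sq_pos (hχ : IsCutoff B t χ) (ht : t < 1 / 2) :
    0 < ∫ x, χ x ^ 2 :=
  lt_of_lt_of_le (by have : 0 < 1 - 2 * t := by linarith
                     positivity) (hχ.integral_sq_ge ht)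

lemma IsCutoff.gam_pos (hχ : IsCutoff B t χ) (ht : t < 1 / 2) : 0 < gam χ :=
  inv_pos.2 (hχ.integral_sq_pos ht)

lemma IsCutoff.gam_le (hχ : IsCutoff B t χ) (ht : t < 1 / 2) :
    gam χ ≤ ((1 - 2 * t) ^ 3)⁻¹ :=
  inv_anti₀ (by have : 0 < 1 - 2 * t := by linarith
                positivity) (hχ.integral_sq_ge ht)

lemma IsCutoff.one_le_gam (hχ : IsCutoff B t χ) (ht0 : 0 < t) (ht : t < 1 / 2) :
    1 ≤ gam χ := by
  refine (one_le_inv₀ (hχ.integral_sq_pos ht)).2 ?_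
  have h1 : ∫ x, χ x ^ 2 = ∫ x in cube ((-1 + t) / 2) ((1 - t) / 2), χ x ^ 2 := by
    refine (setIntegral_eq_integral_of_forall_compl_eq_zero fun x hx => ?_).symm
    rw [hχ.eq_zero hx]; norm_num
  rw [h1]
  calc ∫ x in cube ((-1 + t) / 2) ((1 - t) / 2), χ x ^ 2
      ≤ ∫ x in cube ((-1 + t) / 2) ((1 - t) / 2), (1 : ℝ) :=
        setIntegral_mono hχ.integrable_sq.integrableOn
          (integrableOn_const (volume_cube_lt_top _ _).ne) fun x =>
          pow_le_one₀ (hχ.nonneg x) (hχ.le_one x)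
    _ = (1 - t) ^ 3 := by
        rw [setIntegral_const, volume_real_cube (by linarith), smul_eq_mul]; ring
    _ ≤ 1 := pow_le_one₀ (by linarith) (by linarith)

lemma norm_le_of_mem_cube {r : ℝ} (hr : 0 ≤ r) {x : R3} (hx : x ∈ cube (-r) r) :
    ‖x‖ ≤ 2 * r := by
  have h : ∀ i, x i ^ 2 ≤ r ^ 2 := fun i => by
    have := hx i
    exact sq_le_sq' this.1 this.2
  rw [EuclideanSpace.norm_eq, Real.sqrt_le_left (by positivity), Fin.sum_univ_three]
  simp only [Real.norm_eq_abs, sq_abs]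
  nlinarith [h 0, h 1, h 2, sq_nonneg r]

/-- The bound by `(1 - 2t)⁻³` degenerates as `t → 1/2`. This one stays finite there because `χ`
cannot leave the value `χ(0) = 1` faster than its first derivative allows. -/
lemma IsCutoff.gam_le_of_deriv (hχ : IsCutoff B t χ) (ht0 : 0 < t) (ht : t < 1 / 2) :
    gam χ ≤ 32 * max (B 1) 1 ^ 3 * (t ^ 3)⁻¹ := by
  set b := max (B 1) 1
  have hb : 0 < b := lt_of_lt_of_le one_pos (le_max_right _ _)
  have hχ0 : χ 0 = 1 := hχ.eq_one 0 fun i => by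
    rw [PiLp.zero_apply]; constructor <;> linarith
  have hlip : ∀ x, |χ x - χ 0| ≤ b * t⁻¹ * ‖x‖ := by
    intro x
    have := Convex.norm_image_sub_le_of_norm_fderiv_le (𝕜 := ℝ) (f := χ) (C := b * t⁻¹)
      (s := univ) (x := 0) (y := x)
      (fun y _ => (hχ.contDiff.differentiable (by simp)).differentiableAt)
      (fun y _ => by
        rw [← norm_iteratedFDeriv_one]
        refine (hχ.deriv_le 1 y).trans ?_
        rw [pow_one]
        gcongr
        exact le_max_left _ _) convex_univ (mem_univ _) (mem_univ _)
    simpa using this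
  -- In the cube of half side `r` one has `‖x‖ ≤ 2r`, so `χ` drops by at most `b t⁻¹ · 2r = 1/2`.
  -- Then `χ² ≥ 1/4` on a volume `(2r)³`, which gives the constant `32`.
  set r := t / (4 * b)
  have hr : 0 < r := by positivity
  have h1 := setIntegral_const_cube_le (a := -r) (b := r) (m := 1 / 4)
    (by linarith) hχ.integrable_sq (fun x => sq_nonneg _) fun x hx => by
      have h2 := hlip x
      have h3 := norm_le_of_mem_cube hr.le hx
      have h4 : b * t⁻¹ * ‖x‖ ≤ 1 / 2 := by
        calc b * t⁻¹ * ‖x‖ ≤ b * t⁻¹ * (2 * r) := by gcongr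
          _ = 1 / 2 := by simp only [r]; field_simp; norm_num
      rw [hχ0] at h2
      have h5 := abs_le.1 (h2.trans h4)
      nlinarith [h5.1]
  have h2 : 1 / 4 * (r - -r) ^ 3 = (32 * b ^ 3 * (t ^ 3)⁻¹)⁻¹ := by
    simp only [r]; field_simp; norm_num
  rw [h2] at h1
  exact inv_le_of_inv_le₀ (by positivity) h1

/-- The cutoff as a complex-valued Schwartz function. -/
def IsCutoff.schwartz (hχ : IsCutoff B t χ) : SchwartzMap R3 ℂ :=
  (hχ.hasCompactSupport.comp_left (g := fun r : ℝ => (r : ℂ)) Complex.ofReal_zero).toSchwartzMap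
    (Complex.ofRealCLM.contDiff.comp hχ.contDiff)

lemma IsCutoff.schwartz_apply (hχ : IsCutoff B t χ) (x : R3) : hχ.schwartz x = (χ x : ℂ) := rfl

/-- The autocorrelation `γ χ ⋆ χ`. -/
def corr (χ : R3 → ℝ) (z : R3) : ℝ := gam χ * ∫ y, χ (y + z) * χ y

/-- The probability density `γ |χ̂|²`. -/
def IsCutoff.dens (hχ : IsCutoff B t χ) (q : R3) : ℝ := gam χ * ‖(𝓕 hχ.schwartz) q‖ ^ 2

lemma IsCutoff.dens_nonneg (hχ : IsCutoff B t χ) (ht : t < 1 / 2) (q : R3) : 0 ≤ hχ.dens q :=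
  mul_nonneg (hχ.gam_pos ht).le (sq_nonneg _)

lemma IsCutoff.continuous_dens (hχ : IsCutoff B t χ) : Continuous hχ.dens :=
  continuous_const.mul ((𝓕 hχ.schwartz).continuous.norm.pow 2)

/-- One factor of `χ̂` is bounded and the other decays rapidly. -/
lemma IsCutoff.integrable_pow_mul_dens (hχ : IsCutoff B t χ) (k : ℕ) :
    Integrable fun q => ‖q‖ ^ k * hχ.dens q := by
  have h1 := (𝓕 hχ.schwartz).integrable_pow_mul (μ := volume) k
  obtain ⟨C, hC, hC'⟩ := (𝓕 hχ.schwartz).decay 0 0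
  have h2 : ∀ q, ‖(𝓕 hχ.schwartz) q‖ ≤ C := fun q => by simpa using hC' q
  refine (h1.const_mul (|gam χ| * C)).mono'
    ((continuous_norm.pow k).mul hχ.continuous_dens).aestronglyMeasurable
    (Eventually.of_forall fun q => ?_)
  rw [IsCutoff.dens, norm_mul, norm_mul, norm_pow, norm_norm, norm_pow, norm_norm,
    Real.norm_eq_abs]
  have := h2 q
  calc ‖q‖ ^ k * (|gam χ| * ‖(𝓕 hχ.schwartz) q‖ ^ 2)
      = |gam χ| * ‖(𝓕 hχ.schwartz) q‖ * (‖q‖ ^ k * ‖(𝓕 hχ.schwartz) q‖) := by ring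
    _ ≤ |gam χ| * C * (‖q‖ ^ k * ‖(𝓕 hχ.schwartz) q‖) := by gcongr

lemma IsCutoff.integrable_dens (hχ : IsCutoff B t χ) : Integrable hχ.dens := by
  simpa using hχ.integrable_pow_mul_dens 0

lemma integrable_exp_smul {f : R3 → ℝ} (hf : Integrable f) (θ : R3 → ℝ) (hθ : Continuous θ) :
    Integrable fun q => (f q : ℂ) * Complex.exp ((θ q : ℂ) * Complex.I) := by
  refine hf.norm.mono' ?_ (Eventually.of_forall fun q => ?_)
  · exact (Complex.continuous_ofReal.comp_aestronglyMeasurable hf.1).mul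
      (by fun_prop : Continuous fun q => Complex.exp ((θ q : ℂ) * Complex.I)).aestronglyMeasurable
  · rw [norm_mul, Complex.norm_exp_ofReal_mul_I, mul_one, Complex.norm_real]

/-- The autocorrelation is the characteristic function of `dens`. -/
lemma IsCutoff.corr_eq_integral (hχ : IsCutoff B t χ) (z : R3) :
    (corr χ z : ℂ)
      = ∫ q, (hχ.dens q : ℂ) * Complex.exp (((2 * π * inner ℝ q z : ℝ) : ℂ) * Complex.I) := by
  have hc : HasCompactSupport fun y : R3 => ((χ (y + z) : ℝ) : ℂ) := by
    have := hχ.hasCompactSupport.comp_homeomorph (Homeomorph.addRight z)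
    exact this.comp_left (g := fun r : ℝ => (r : ℂ)) Complex.ofReal_zero
  have hd : ContDiff ℝ (⊤ : ℕ∞) fun y : R3 => ((χ (y + z) : ℝ) : ℂ) :=
    Complex.ofRealCLM.contDiff.comp (hχ.contDiff.comp (contDiff_id.add contDiff_const))
  let g : SchwartzMap R3 ℂ := hc.toSchwartzMap hd
  -- A translation of `χ` becomes a phase in momentum space; Plancherel then turns the correlation
  -- integral into the stated one.
  have hg : ∀ q, (𝓕 g) q
      = Complex.exp (((2 * π * inner ℝ q z : ℝ) : ℂ) * Complex.I) * (𝓕 hχ.schwartz) q := by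
    intro q
    rw [SchwartzMap.fourier_coe, SchwartzMap.fourier_coe, Real.fourier_eq', Real.fourier_eq',
      ← integral_const_mul]
    rw [← integral_add_right_eq_self (fun v => Complex.exp
      (((2 * π * inner ℝ q z : ℝ) : ℂ) * Complex.I) *
        Complex.exp (((-2 * π * inner ℝ v q : ℝ) : ℂ) * Complex.I) • hχ.schwartz v) z]
    refine integral_congr_ae (Eventually.of_forall fun v => ?_)
    have e : g v = hχ.schwartz (v + z) := rfl
    simp only [smul_eq_mul, e, ← mul_assoc, ← Complex.exp_add]
    congr 2
    rw [inner_add_left, real_inner_comm z q]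
    push_cast; ring
  have hP := SchwartzMap.integral_inner_fourier_fourier hχ.schwartz g
  have e1 : ∀ y : R3, inner ℂ (hχ.schwartz y) (g y) = ((χ (y + z) * χ y : ℝ) : ℂ) := fun y => by
    have e : g y = ((χ (y + z) : ℝ) : ℂ) := rfl
    rw [e, hχ.schwartz_apply, RCLike.inner_apply, Complex.conj_ofReal, Complex.ofReal_mul]
  simp_rw [e1, integral_complex_ofReal] at hP
  rw [corr, Complex.ofReal_mul, ← hP, ← integral_const_mul]
  refine integral_congr_ae (Eventually.of_forall fun q => ?_)
  simp only [hg, RCLike.inner_apply, IsCutoff.dens]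
  rw [mul_assoc, Complex.mul_conj, Complex.normSq_eq_norm_sq]
  push_cast; ring

lemma IsCutoff.corr_zero (hχ : IsCutoff B t χ) (ht : t < 1 / 2) : corr χ 0 = 1 := by
  have h := (hχ.integral_sq_pos ht).ne'
  simp only [corr, gam, add_zero, ← sq]
  exact inv_mul_cancel₀ h

lemma IsCutoff.integral_dens (hχ : IsCutoff B t χ) (ht : t < 1 / 2) : ∫ q, hχ.dens q = 1 := by
  have h := hχ.corr_eq_integral 0
  rw [hχ.corr_zero ht] at h
  simp only [inner_zero_right, mul_zero, Complex.ofReal_zero, zero_mul, Complex.exp_zero,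
    mul_one, integral_complex_ofReal] at h
  exact_mod_cast h.symm

lemma IsCutoff.corr_eq_integral_cos (hχ : IsCutoff B t χ) (z : R3) :
    corr χ z = ∫ q, hχ.dens q * Real.cos (2 * π * inner ℝ q z) := by
  have h := congrArg Complex.re (hχ.corr_eq_integral z)
  rw [Complex.ofReal_re] at h
  have hi := integrable_exp_smul hχ.integrable_dens (fun q => 2 * π * inner ℝ q z) (by fun_prop)
  have h2 := integral_re hi
  simp only [RCLike.re_to_complex] at h2
  rw [h, ← h2]
  refine integral_congr_ae (Eventually.of_forall fun q => ?_)
  simp only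
  rw [Complex.re_ofReal_mul, Complex.exp_ofReal_mul_I_re]

lemma IsCutoff.continuous_corr (hχ : IsCutoff B t χ) (ht : t < 1 / 2) : Continuous (corr χ) := by
  have : corr χ = fun z => ∫ q, hχ.dens q * Real.cos (2 * π * inner ℝ q z) :=
    funext hχ.corr_eq_integral_cos
  rw [this]
  refine continuous_of_dominated (bound := hχ.dens) (fun z => ?_) (fun z => ?_)
    hχ.integrable_dens (Eventually.of_forall fun q => by fun_prop)
  · exact (hχ.continuous_dens.mul (by fun_prop)).aestronglyMeasurable
  · refine Eventually.of_forall fun q => ?_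
    rw [norm_mul, Real.norm_of_nonneg (hχ.dens_nonneg ht q)]
    exact mul_le_of_le_one_right (hχ.dens_nonneg ht q) (Real.abs_cos_le_one _)

lemma corr_nonneg (hχ : IsCutoff B t χ) (ht : t < 1 / 2) (z : R3) : 0 ≤ corr χ z :=
  mul_nonneg (hχ.gam_pos ht).le
    (integral_nonneg fun _ => mul_nonneg (hχ.nonneg _) (hχ.nonneg _))

/-- Quadratic vanishing of `1 - corr` at the origin, from `1 - cos θ ≤ θ²/2` under the probability
density. It beats the singularity `1/‖z‖` of the Yukawa potential. -/
lemma IsCutoff.one_sub_corr (hχ : IsCutoff B t χ) (ht : t < 1 / 2) (z : R3) :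
    0 ≤ 1 - corr χ z ∧
      1 - corr χ z ≤ 2 * π ^ 2 * (∫ q, ‖q‖ ^ 2 * hχ.dens q) * ‖z‖ ^ 2 := by
  have hi : Integrable fun q => hχ.dens q * Real.cos (2 * π * inner ℝ q z) := by
    refine hχ.integrable_dens.mono'
      (hχ.continuous_dens.mul (by fun_prop)).aestronglyMeasurable
      (Eventually.of_forall fun q => ?_)
    rw [norm_mul, Real.norm_of_nonneg (hχ.dens_nonneg ht q)]
    exact mul_le_of_le_one_right (hχ.dens_nonneg ht q) (Real.abs_cos_le_one _)
  have e : 1 - corr χ z = ∫ q, hχ.dens q * (1 - Real.cos (2 * π * inner ℝ q z)) := by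
    simp_rw [mul_sub, mul_one]
    rw [integral_sub hχ.integrable_dens hi, hχ.integral_dens ht, hχ.corr_eq_integral_cos]
  rw [e]
  constructor
  · exact integral_nonneg fun q => mul_nonneg (hχ.dens_nonneg ht q)
      (sub_nonneg.2 (Real.cos_le_one _))
  · rw [← integral_const_mul, ← integral_mul_const]
    refine integral_mono_of_nonneg (Eventually.of_forall fun q => mul_nonneg
      (hχ.dens_nonneg ht q) (sub_nonneg.2 (Real.cos_le_one _)))
      (((hχ.integrable_pow_mul_dens 2).const_mul _).mul_const _)
      (Eventually.of_forall fun q => ?_)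
    have h1 := Real.one_sub_sq_div_two_le_cos (x := 2 * π * inner ℝ q z)
    have h2 : inner ℝ q z ^ 2 ≤ ‖q‖ ^ 2 * ‖z‖ ^ 2 := by
      rw [← mul_pow]
      exact sq_le_sq' (neg_le_of_abs_le (abs_real_inner_le_norm q z)) (real_inner_le_norm q z)
    have h3 := hχ.dens_nonneg ht q
    calc hχ.dens q * (1 - Real.cos (2 * π * inner ℝ q z))
        ≤ hχ.dens q * (2 * π ^ 2 * (‖q‖ ^ 2 * ‖z‖ ^ 2)) := by
          gcongr
          nlinarith [sq_nonneg π]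
      _ = _ := by ring

/-- The fourth moment of the momentum density. -/
lemma IsCutoff.fourth_moment_le (hχ : IsCutoff B t χ) (ht0 : 0 < t) (ht : t < 1 / 2) :
    ∫ q, (2 * π) ^ 4 * (‖q‖ ^ 4 * hχ.dens q) ≤ 9 * gam χ * (B 2 * (t ^ 2)⁻¹) ^ 2 := by
  let e : Fin 3 → R3 := fun i => EuclideanSpace.single i 1
  -- The pure second derivatives `∂ᵢ²χ`: by Plancherel their `L²` norms are the moments of `qᵢ⁴`.
  let d : Fin 3 → SchwartzMap R3 ℂ := fun i => LineDeriv.lineDerivOp (e i)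
    (LineDeriv.lineDerivOp (e i) hχ.schwartz)
  have hin : ∀ i (q : R3), inner ℝ q (e i) = q i := fun i q => by
    simp [e, EuclideanSpace.inner_single_right]
  have hF1 : ∀ i (f : SchwartzMap R3 ℂ) q,
      ‖(𝓕 (LineDeriv.lineDerivOp (e i) f)) q‖ ^ 2 = (2 * π) ^ 2 * (q i ^ 2 * ‖(𝓕 f) q‖ ^ 2) := by
    intro i f q
    have hg : (fun q : R3 => inner ℝ q (e i)).HasTemperateGrowth := by fun_prop
    rw [SchwartzMap.fourier_lineDerivOp_eq, smul_apply, SchwartzMap.smulLeftCLM_apply_apply hg, hin]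
    have h2 : ‖(2 : ℂ)‖ = 2 := by simp
    rw [norm_smul, norm_smul, norm_mul, norm_mul, Complex.norm_I, Complex.norm_real,
      Real.norm_eq_abs, Real.norm_eq_abs, h2, mul_pow, mul_pow, mul_pow, mul_pow, sq_abs, sq_abs]
    ring
  have hF : ∀ i q, ‖(𝓕 (d i)) q‖ ^ 2 = (2 * π) ^ 4 * (q i ^ 4 * ‖(𝓕 hχ.schwartz) q‖ ^ 2) := by
    intro i q
    rw [hF1, hF1]; ring
  have hd : ∀ i x, ‖d i x‖ ≤ B 2 * (t ^ 2)⁻¹ := by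
    intro i x
    have h1 : d i x = iteratedFDeriv ℝ 2 (fun y => (χ y : ℂ)) x ![e i, e i] := by
      have := SchwartzMap.iteratedLineDerivOp_eq_iteratedFDeriv (m := ![e i, e i])
        (f := hχ.schwartz) (x := x)
      rw [LineDeriv.iteratedLineDerivOp_succ_left, LineDeriv.iteratedLineDerivOp_one] at this
      exact this
    have h2 : iteratedFDeriv ℝ 2 (fun y => (χ y : ℂ)) x
        = Complex.ofRealCLM.compContinuousMultilinearMap (iteratedFDeriv ℝ 2 χ x) := by
      exact ContinuousLinearMap.iteratedFDeriv_comp_left Complex.ofRealCLM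
        (hχ.contDiff.of_le (m := 2) (WithTop.coe_le_coe.2 le_top)).contDiffAt le_rfl
    rw [h1, h2]
    simp only [ContinuousLinearMap.compContinuousMultilinearMap_coe, Function.comp_apply,
      Complex.ofRealCLM_apply, Complex.norm_real]
    refine (ContinuousMultilinearMap.le_opNorm _ _).trans ?_
    have : ∏ j, ‖(![e i, e i] : Fin 2 → R3) j‖ = 1 := by
      simp [Fin.prod_univ_two, e]
    rw [this, mul_one]
    exact hχ.deriv_le 2 x
  have hsupp : ∀ i x, x ∉ cube (-1 / 2) (1 / 2) → d i x = 0 := by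
    intro i x hx
    by_contra h
    apply hx
    have h1 : x ∈ tsupport (d i) := subset_tsupport _ h
    have h2 := SchwartzMap.tsupport_lineDerivOp_subset (e i)
      (LineDeriv.lineDerivOp (e i) hχ.schwartz) h1
    have h3 := SchwartzMap.tsupport_lineDerivOp_subset (e i) hχ.schwartz h2
    have h4 : x ∈ tsupport χ := by
      refine tsupport_comp_subset (g := fun r : ℝ => (r : ℂ)) Complex.ofReal_zero χ h3
    intro j
    have := hχ.support_subset h4 j
    constructor <;> linarith [this.1, this.2]
  -- The support lies in a cube of volume one, so the supremum bound is also the `L²` bound.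
  have hint : ∀ i, ∫ x, ‖d i x‖ ^ 2 ≤ (B 2 * (t ^ 2)⁻¹) ^ 2 := by
    intro i
    have h1 : ∫ x, ‖d i x‖ ^ 2 = ∫ x in cube (-1 / 2) (1 / 2), ‖d i x‖ ^ 2 := by
      refine (setIntegral_eq_integral_of_forall_compl_eq_zero fun x hx => ?_).symm
      rw [hsupp i x hx]; simp
    rw [h1]
    calc ∫ x in cube (-1 / 2) (1 / 2), ‖d i x‖ ^ 2
        ≤ ∫ x in cube (-1 / 2) (1 / 2), (B 2 * (t ^ 2)⁻¹) ^ 2 := by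
          refine integral_mono_of_nonneg (Eventually.of_forall fun x => sq_nonneg _)
            (integrableOn_const (volume_cube_lt_top _ _).ne) (Eventually.of_forall fun x => ?_)
          exact pow_le_pow_left₀ (norm_nonneg _) (hd i x) 2
      _ = _ := by
          rw [setIntegral_const, volume_real_cube (by norm_num)]; norm_num
  have hmom : ∀ i, ∫ q : R3, (2 * π) ^ 4 * (q i ^ 4 * hχ.dens q)
      ≤ gam χ * (B 2 * (t ^ 2)⁻¹) ^ 2 := by
    intro i
    have := SchwartzMap.integral_norm_sq_fourier (d i)
    have e1 : ∀ q : R3, (2 * π) ^ 4 * (q i ^ 4 * hχ.dens q) = gam χ * ‖(𝓕 (d i)) q‖ ^ 2 := by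
      intro q; rw [hF, IsCutoff.dens]; ring
    simp_rw [e1]
    rw [integral_const_mul, this]
    exact mul_le_mul_of_nonneg_left (hint i) (hχ.gam_pos ht).le
  have hIi : ∀ i, Integrable fun q : R3 => (2 * π) ^ 4 * (q i ^ 4 * hχ.dens q) := by
    intro i
    refine ((hχ.integrable_pow_mul_dens 4).const_mul ((2 * π) ^ 4)).mono'
      (by have := hχ.continuous_dens
          exact Continuous.aestronglyMeasurable (by fun_prop)) (Eventually.of_forall fun q => ?_)
    have h0 := hχ.dens_nonneg ht q
    rw [Real.norm_of_nonneg (by positivity)]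
    have : |q i| ≤ ‖q‖ := PiLp.norm_apply_le q i
    refine mul_le_mul_of_nonneg_left (mul_le_mul_of_nonneg_right ?_ h0) (by positivity)
    calc q i ^ 4 = |q i| ^ 4 := by rw [Even.pow_abs (by decide)]
      _ ≤ ‖q‖ ^ 4 := by gcongr
  calc ∫ q, (2 * π) ^ 4 * (‖q‖ ^ 4 * hχ.dens q)
      ≤ ∫ q, 3 * ∑ i, (2 * π) ^ 4 * (q i ^ 4 * hχ.dens q) := by
        refine integral_mono ((hχ.integrable_pow_mul_dens 4).const_mul _)
          ((integrable_finsetSum _ fun i _ => hIi i).const_mul 3) fun q => ?_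
        have h0 := hχ.dens_nonneg ht q
        -- Cauchy–Schwarz in three coordinates. This `3` and the three summands make the factor `9`.
        have h1 : ‖q‖ ^ 4 ≤ 3 * ∑ i, q i ^ 4 := by
          have : ‖q‖ ^ 2 = ∑ i, q i ^ 2 := by
            rw [EuclideanSpace.norm_sq_eq]; simp
          have h2 : ‖q‖ ^ 4 = (∑ i, q i ^ 2) ^ 2 := by rw [← this]; ring
          rw [h2, Fin.sum_univ_three, Fin.sum_univ_three]
          nlinarith [sq_nonneg (q 0 ^ 2 - q 1 ^ 2), sq_nonneg (q 0 ^ 2 - q 2 ^ 2),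
            sq_nonneg (q 1 ^ 2 - q 2 ^ 2)]
        simp only [← Finset.mul_sum, ← Finset.sum_mul]
        have h3 : (0 : ℝ) ≤ (2 * π) ^ 4 := by positivity
        nlinarith [mul_le_mul_of_nonneg_right h1 (mul_nonneg h3 h0)]
    _ = 3 * ∑ i : Fin 3, ∫ q : R3, (2 * π) ^ 4 * (q i ^ 4 * hχ.dens q) := by
        rw [integral_const_mul, integral_finsetSum _ fun i _ => hIi i]
    _ ≤ 3 * ∑ i : Fin 3, gam χ * (B 2 * (t ^ 2)⁻¹) ^ 2 := by
        gcongr with i; exact hmom i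
    _ = _ := by simp; ring

end Cutoff

/-! ### Domination of the smeared resolvent. -/

section PositiveType

open Set Filter Topology Real FourierTransform

/-- If `r` is small compared with `s`, then `Δ` is comparable to `D²`. Otherwise `s r ≤ 16 r²`, so
the quadratic term `q` can absorb the bad term: when the bracket is nonnegative the lower bound `Δ ≥
w D` is enough; when it is negative, `r ≤ w/32`, and `Δ` is at most slightly larger than `D²`. -/
lemma resolvent_numerator_le {s r w D Δ q : ℝ} (hs : 0 ≤ s) (hr : 0 ≤ r) (hw : 0 < w)
    (hD : D = s + w) (hq : 0 ≤ q) (hqw : q * w = 48 * r ^ 2) (hΔw : w * D ≤ Δ)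
    (hΔA : Δ ≤ (D + r) ^ 2) (hsmall : r ≤ s / 16 → 3 / 4 * D ^ 2 ≤ Δ) :
    D * (3 * s * r - D * w / 2) ≤ (-(w / 8) + 4 * r + q) * Δ := by
  have hsD : s ≤ D := by rw [hD]; linarith
  have hwD : w ≤ D := by rw [hD]; linarith
  have hDpos : 0 < D := by linarith
  have hΔpos : 0 < Δ := lt_of_lt_of_le (by positivity) hΔw
  have e5 : 0 ≤ w * D ^ 2 := by positivity
  rcases le_or_gt r (s / 16) with hc | hc
  · have hΔ1 := hsmall hc
    have hΔ2 : Δ ≤ 5 / 4 * D ^ 2 := by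
      have h1 : (D + r) ^ 2 ≤ (17 / 16 * D) ^ 2 :=
        pow_le_pow_left₀ (by positivity) (by linarith) 2
      have h2 : (17 / 16 * D) ^ 2 = 289 / 256 * D ^ 2 := by ring
      have h3 : 0 ≤ D ^ 2 := by positivity
      linarith
    have e1 : w / 8 * Δ ≤ w / 8 * (5 / 4 * D ^ 2) := by gcongr
    have e2 : 4 * r * (3 / 4 * D ^ 2) ≤ 4 * r * Δ := by gcongr
    have e3 : 0 ≤ q * Δ := by positivity
    have e4 : 3 * r * D * s ≤ 3 * r * D * D := by gcongr
    linarith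
  · rcases le_or_gt 0 (-(w / 8) + 4 * r + q) with hX | hX
    · have e1 : (-(w / 8) + 4 * r + q) * (w * D) ≤ (-(w / 8) + 4 * r + q) * Δ := by gcongr
      refine le_trans ?_ e1
      have e2 : (-(w / 8) + 4 * r + q) * (w * D)
          = D * (-(w ^ 2 / 8) + 4 * r * w + 48 * r ^ 2) := by rw [← hqw]; ring
      rw [e2]
      refine mul_le_mul_of_nonneg_left ?_ hDpos.le
      have e3 : 3 * s * r ≤ 48 * r ^ 2 := by
        have : s * r ≤ (16 * r) * r := by gcongr; linarith
        linarith
      have e4 : w * w ≤ D * w := by gcongr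
      have e6 := mul_nonneg hr hw.le
      have e7 := mul_nonneg hDpos.le hw.le
      linarith
    · have hrw : r ≤ w / 32 := by linarith
      have hΔ3 : Δ ≤ 9 / 8 * D ^ 2 := by
        have h1 : (D + r) ^ 2 ≤ (33 / 32 * D) ^ 2 :=
          pow_le_pow_left₀ (by positivity) (by linarith) 2
        have h2 : (33 / 32 * D) ^ 2 = 1089 / 1024 * D ^ 2 := by ring
        have h3 : 0 ≤ D ^ 2 := by positivity
        linarith
      have e1 : w / 8 * Δ ≤ w / 8 * (9 / 8 * D ^ 2) := by gcongr
      have e2 : 0 ≤ (4 * r + q) * Δ := by positivity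
      have e3 : D * (3 * s * r) ≤ D * (3 * D * (w / 32)) := by gcongr
      linarith

/-- The pointwise estimate behind the positivity of the Fourier transform. Here `s = |P|²`,
`r = |Q|²`, `b = 2 P·Q`, `w = ω²`. -/
lemma symmetrized_resolvent_le {s r b w a : ℝ} (hs : 0 ≤ s) (hr : 0 ≤ r) (hw : 0 < w)
    (hb : b ^ 2 ≤ 4 * s * r) (ha0 : 0 < a) (ha : a ≤ s + w / 2) :
    1 / 2 * (1 / (s + r + w - b) + 1 / (s + r + w + b)) - 1 / a
      ≤ 1 / (a * (s + w)) * (-(w / 8) + 4 * r + 48 * r ^ 2 / w) := by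
  set D := s + w with hD
  have hDpos : 0 < D := by positivity
  have hbA : |b| ≤ s + r := by
    refine abs_le_of_sq_le_sq ?_ (by positivity)
    nlinarith [sq_nonneg (s - r)]
  have hb1 := abs_le.1 hbA
  have hA1 : w ≤ s + r + w - b := by linarith
  have hA2 : w ≤ s + r + w + b := by linarith
  have h1 : 0 < s + r + w - b := by linarith
  have h2 : 0 < s + r + w + b := by linarith
  set Δ := (s + r + w - b) * (s + r + w + b) with hΔ
  have hΔpos : 0 < Δ := mul_pos h1 h2
  have hΔw : w * D ≤ Δ := by
    rcases le_total 0 b with h | h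
    · calc w * D ≤ (s + r + w - b) * (s + r + w + b) := by gcongr; linarith
        _ = Δ := rfl
    · calc w * D = D * w := by ring
        _ ≤ (s + r + w - b) * (s + r + w + b) := by gcongr; linarith
        _ = Δ := rfl
  have hΔA : Δ ≤ (D + r) ^ 2 := by
    have : Δ = (D + r) ^ 2 - b ^ 2 := by rw [hΔ, hD]; ring
    rw [this]
    linarith [sq_nonneg b]
  have key : D * (a * (s + r + w) - Δ) ≤ (-(w / 8) + 4 * r + 48 * r ^ 2 / w) * Δ := by
    -- The mean of the two fractions is `(s + r + w)/Δ`. The negative term `-D w / 2` is the gain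
    -- from `a ≤ s + w/2` instead of `s + w`: the smeared resolvent has the larger mass. The loss `3
    -- s r` comes from `b² ≤ 4 s r`.
    have hnum : D * (a * (s + r + w) - Δ) ≤ D * (3 * s * r - D * w / 2) := by
      refine mul_le_mul_of_nonneg_left ?_ hDpos.le
      have : a * (s + r + w) ≤ (s + w / 2) * (s + r + w) := by gcongr
      rw [hΔ, hD]
      have h3 : a * (s + r + w) - (s + r + w - b) * (s + r + w + b)
          ≤ (s + w / 2) * (s + r + w) - (s + r + w) ^ 2 + 4 * s * r := by
        have : (s + r + w - b) * (s + r + w + b) = (s + r + w) ^ 2 - b ^ 2 := by ring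
        linarith
      have h4 : 0 ≤ w * r + r * w / 2 + r ^ 2 := by positivity
      linarith
    refine hnum.trans ?_
    refine resolvent_numerator_le hs hr hw hD (by positivity) (by field_simp) hΔw hΔA fun hc => ?_
    have hb2 : b ^ 2 ≤ D ^ 2 / 4 := by
      have h3 : 4 * s * r ≤ s ^ 2 / 4 := by
        have := mul_le_mul_of_nonneg_left hc hs
        linarith
      have h4 : s ^ 2 ≤ D ^ 2 := pow_le_pow_left₀ hs (by rw [hD]; linarith) 2
      linarith
    have h5 : (D + r) ^ 2 - b ^ 2 = Δ := by rw [hΔ, hD]; ring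
    have h6 : D ^ 2 ≤ (D + r) ^ 2 := pow_le_pow_left₀ hDpos.le (by linarith) 2
    linarith
  have e : 1 / 2 * (1 / (s + r + w - b) + 1 / (s + r + w + b)) - 1 / a
      = 1 / (a * D) * ((D * (a * (s + r + w) - Δ)) / Δ) := by
    rw [hΔ]; field_simp; ring
  rw [e]
  refine mul_le_mul_of_nonneg_left ?_ (by positivity)
  rw [div_le_iff₀ hΔpos]
  exact key

variable {B : ℕ → ℝ} {t : ℝ} {χ : R3 → ℝ}

lemma integrable_ofReal_mul_corr_yukawa (hχ : IsCutoff B t χ) (ht : t < 1 / 2) {ω : ℝ}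
    (hω : 0 < ω) : Integrable fun z => corr χ z * yukawa ω z := by
  refine (integrable_yukawa hω).mono' ?_ (Eventually.of_forall fun z => ?_)
  · exact (hχ.continuous_corr ht).aestronglyMeasurable.mul
      (measurable_yukawa ω).aestronglyMeasurable
  · rw [norm_mul, Real.norm_of_nonneg (corr_nonneg hχ ht z),
      Real.norm_of_nonneg (yukawa_nonneg ω z)]
    exact mul_le_of_le_one_left (yukawa_nonneg ω z) (by linarith [(hχ.one_sub_corr ht z).1])

/-- The Fourier transform of the cut off Yukawa potential. -/
lemma IsCutoff.fourier_corr_mul_yukawa (hχ : IsCutoff B t χ) {ω : ℝ} (hω : 0 < ω) (p : R3) :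
    𝓕 (fun z : R3 => ((corr χ z * yukawa ω z : ℝ) : ℂ)) p
      = ((∫ q, hχ.dens q * (4 * π / (4 * π ^ 2 * ‖p - q‖ ^ 2 + ω ^ 2)) : ℝ) : ℂ) := by
  let k : R3 → R3 → ℂ := fun z q => (hχ.dens q : ℂ) *
    (Complex.exp (((-2 * π * inner ℝ z (p - q) : ℝ) : ℂ) * Complex.I) * (yukawa ω z : ℂ))
  have hk : Integrable (Function.uncurry k) ((volume : Measure R3).prod volume) := by
    have h1 : Integrable (fun x : R3 × R3 => yukawa ω x.1 * hχ.dens x.2)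
        ((volume : Measure R3).prod volume) := (integrable_yukawa hω).mul_prod hχ.integrable_dens
    have hm : Measurable (Function.uncurry k) := by
      have := hχ.continuous_dens.measurable
      have h2 := measurable_yukawa ω
      simp only [Function.uncurry_def, k]
      fun_prop
    refine h1.norm.mono' hm.aestronglyMeasurable (Eventually.of_forall fun x => ?_)
    simp only [Function.uncurry_def, k, norm_mul, Complex.norm_exp_ofReal_mul_I, Complex.norm_real,
      one_mul]
    rw [mul_comm]
  have e1 : 𝓕 (fun z : R3 => ((corr χ z * yukawa ω z : ℝ) : ℂ)) p = ∫ z : R3, ∫ q : R3, k z q := by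
    rw [Real.fourier_eq']
    refine integral_congr_ae (Eventually.of_forall fun z => ?_)
    simp only [smul_eq_mul]
    rw [Complex.ofReal_mul (corr χ z), hχ.corr_eq_integral, mul_comm (∫ q, _), ← mul_assoc,
      ← integral_const_mul]
    refine integral_congr_ae (Eventually.of_forall fun q => ?_)
    have : Complex.exp (((-2 * π * inner ℝ z (p - q) : ℝ) : ℂ) * Complex.I)
        = Complex.exp (((-2 * π * inner ℝ z p : ℝ) : ℂ) * Complex.I)
          * Complex.exp (((2 * π * inner ℝ q z : ℝ) : ℂ) * Complex.I) := by
      rw [← Complex.exp_add, inner_sub_right, real_inner_comm z q]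
      congr 1; push_cast; ring
    simp only [k, this]
    ring
  rw [e1, integral_integral_swap hk, ← integral_complex_ofReal]
  refine integral_congr_ae (Eventually.of_forall fun q => ?_)
  have h := fourier_yukawa hω (p - q)
  rw [Real.fourier_eq'] at h
  simp only [k]
  rw [integral_const_mul, Complex.ofReal_mul, ← h]
  simp only [smul_eq_mul]

lemma IsCutoff.dens_neg (hχ : IsCutoff B t χ) (q : R3) : hχ.dens (-q) = hχ.dens q := by
  have : (𝓕 hχ.schwartz) (-q) = (𝓕 hχ.schwartz) q := by
    rw [SchwartzMap.fourier_coe, Real.fourier_eq', Real.fourier_eq', ← integral_neg_eq_self]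
    refine integral_congr_ae (Eventually.of_forall fun v => ?_)
    simp only [inner_neg_left, inner_neg_right, neg_neg, hχ.schwartz_apply, hχ.even]
  rw [IsCutoff.dens, IsCutoff.dens, this]

/-- The smeared resolvent is dominated by the resolvent at zero momentum transfer. -/
lemma IsCutoff.integral_resolvent_le (hχ : IsCutoff B t χ) (ht : t < 1 / 2)
    {ω ν : ℝ} (hω : 0 < ω) (hν : 0 < ν) (hνω : ν ^ 2 ≤ ω ^ 2 / 2)
    (hmom : ∫ q, hχ.dens q * (4 * (4 * π ^ 2 * ‖q‖ ^ 2) + 48 * (4 * π ^ 2 * ‖q‖ ^ 2) ^ 2 / ω ^ 2)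
      ≤ ω ^ 2 / 8) (p : R3) :
    ∫ q, hχ.dens q * (4 * π / (4 * π ^ 2 * ‖p - q‖ ^ 2 + ω ^ 2))
      ≤ 4 * π / (4 * π ^ 2 * ‖p‖ ^ 2 + ν ^ 2) := by
  let R : R3 → ℝ := fun x => 1 / (4 * π ^ 2 * ‖x‖ ^ 2 + ω ^ 2)
  have hω2 : 0 < ω ^ 2 := by positivity
  have hden : ∀ x : R3, 0 < 4 * π ^ 2 * ‖x‖ ^ 2 + ω ^ 2 := fun x => by positivity
  have hRc : Continuous R := by
    refine continuous_const.div (by fun_prop) fun x => (hden x).ne'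
  have hR0 : ∀ x, 0 ≤ R x := fun x => by
    have := hden x
    positivity
  have hRb : ∀ x, R x ≤ 1 / ω ^ 2 := fun x => by
    apply one_div_le_one_div_of_le hω2
    have : 0 ≤ 4 * π ^ 2 * ‖x‖ ^ 2 := by positivity
    linarith
  have hIR : ∀ s : R3 → R3, Continuous s → Integrable fun q => hχ.dens q * R (s q) := by
    intro s hs
    refine (hχ.integrable_dens.mul_const (1 / ω ^ 2)).mono'
      (hχ.continuous_dens.mul (hRc.comp hs)).aestronglyMeasurable (Eventually.of_forall fun q => ?_)
    rw [norm_mul, Real.norm_of_nonneg (hχ.dens_nonneg ht q), Real.norm_of_nonneg (hR0 _)]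
    exact mul_le_mul_of_nonneg_left (hRb _) (hχ.dens_nonneg ht q)
  have hI1 := hIR (fun q => p - q) (by fun_prop)
  have hI2 := hIR (fun q => p + q) (by fun_prop)
  -- Evenness of `χ` makes the density even. Averaging over `±q` removes the first-order term in
  -- `q`, which the moments could not control.
  have hsym : ∫ q, hχ.dens q * R (p + q) = ∫ q, hχ.dens q * R (p - q) := by
    rw [← integral_neg_eq_self]
    refine integral_congr_ae (Eventually.of_forall fun q => ?_)
    simp only [hχ.dens_neg, sub_eq_add_neg]
  set a := 4 * π ^ 2 * ‖p‖ ^ 2 + ν ^ 2 with ha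
  have ha0 : 0 < a := by positivity
  set s := 4 * π ^ 2 * ‖p‖ ^ 2 with hs
  set X : R3 → ℝ := fun q => 4 * (4 * π ^ 2 * ‖q‖ ^ 2) + 48 * (4 * π ^ 2 * ‖q‖ ^ 2) ^ 2 / ω ^ 2
    with hX
  have hpt : ∀ q, 1 / 2 * (R (p - q) + R (p + q)) - 1 / a
      ≤ 1 / (a * (s + ω ^ 2)) * (-(ω ^ 2 / 8) + X q) := by
    intro q
    have h := symmetrized_resolvent_le (s := s) (r := 4 * π ^ 2 * ‖q‖ ^ 2)
      (b := 8 * π ^ 2 * inner ℝ p q) (w := ω ^ 2) (a := a) (by positivity) (by positivity) hω2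
      (by
        have h2 : inner ℝ p q ^ 2 ≤ ‖p‖ ^ 2 * ‖q‖ ^ 2 := by
          rw [← mul_pow]
          exact sq_le_sq' (neg_le_of_abs_le (abs_real_inner_le_norm p q)) (real_inner_le_norm p q)
        have h3 : (0 : ℝ) ≤ 64 * π ^ 4 := by positivity
        have := mul_le_mul_of_nonneg_left h2 h3
        rw [hs]
        nlinarith) ha0 (by rw [ha]; linarith)
    have e1 : R (p - q) = 1 / (s + 4 * π ^ 2 * ‖q‖ ^ 2 + ω ^ 2 - 8 * π ^ 2 * inner ℝ p q) := by
      simp only [R]; congr 1; rw [norm_sub_sq_real, hs]; ring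
    have e2 : R (p + q) = 1 / (s + 4 * π ^ 2 * ‖q‖ ^ 2 + ω ^ 2 + 8 * π ^ 2 * inner ℝ p q) := by
      simp only [R]; congr 1; rw [norm_add_sq_real, hs]; ring
    rw [e1, e2]
    refine h.trans (le_of_eq ?_)
    rw [hX]; ring
  have hIX : Integrable fun q => hχ.dens q * X q := by
    have h1 := (hχ.integrable_pow_mul_dens 2).const_mul (16 * π ^ 2)
    have h2 := (hχ.integrable_pow_mul_dens 4).const_mul (48 * 16 * π ^ 4 / ω ^ 2)
    refine (h1.add h2).congr (Eventually.of_forall fun q => ?_)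
    simp only [hX, Pi.add_apply]
    ring
  have hmono : ∫ q, hχ.dens q * (1 / 2 * (R (p - q) + R (p + q)) - 1 / a)
      ≤ ∫ q, hχ.dens q * (1 / (a * (s + ω ^ 2)) * (-(ω ^ 2 / 8) + X q)) := by
    refine integral_mono ?_ ?_ fun q => mul_le_mul_of_nonneg_left (hpt q) (hχ.dens_nonneg ht q)
    · refine (((hI1.add hI2).const_mul (1 / 2)).sub (hχ.integrable_dens.mul_const (1 / a))).congr
        (Eventually.of_forall fun q => ?_)
      simp only [Pi.add_apply, Pi.sub_apply]; ring
    · refine (((hχ.integrable_dens.mul_const (-(ω ^ 2 / 8))).add hIX).const_mul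
        (1 / (a * (s + ω ^ 2)))).congr (Eventually.of_forall fun q => ?_)
      simp only [Pi.add_apply]; ring
  have e3 : ∫ q, hχ.dens q * (1 / 2 * (R (p - q) + R (p + q)) - 1 / a)
      = (∫ q, hχ.dens q * R (p - q)) - 1 / a := by
    have : ∀ q, hχ.dens q * (1 / 2 * (R (p - q) + R (p + q)) - 1 / a)
      = 1 / 2 * (hχ.dens q * R (p - q) + hχ.dens q * R (p + q)) - hχ.dens q * (1 / a) :=
      fun q => by ring
    simp_rw [this]
    have hI12 : Integrable fun q => 1 / 2 * (hχ.dens q * R (p - q) + hχ.dens q * R (p + q)) :=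
      (hI1.add hI2).const_mul (1 / 2)
    rw [integral_sub hI12 (hχ.integrable_dens.mul_const (1 / a)), integral_const_mul, integral_add hI1 hI2, hsym, integral_mul_const, hχ.integral_dens ht]
    ring
  have e4 : ∫ q, hχ.dens q * (1 / (a * (s + ω ^ 2)) * (-(ω ^ 2 / 8) + X q))
      = 1 / (a * (s + ω ^ 2)) * (-(ω ^ 2 / 8) + ∫ q, hχ.dens q * X q) := by
    have : ∀ q, hχ.dens q * (1 / (a * (s + ω ^ 2)) * (-(ω ^ 2 / 8) + X q))
      = 1 / (a * (s + ω ^ 2)) * (hχ.dens q * (-(ω ^ 2 / 8)) + hχ.dens q * X q) :=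
      fun q => by ring
    simp_rw [this]
    rw [integral_const_mul, integral_add (hχ.integrable_dens.mul_const _) hIX,
      integral_mul_const, hχ.integral_dens ht, one_mul]
  rw [e3, e4] at hmono
  -- The prefactor depends on `p` but not on `q`, so a single moment condition settles all `p` at
  -- once.
  have h5 : 1 / (a * (s + ω ^ 2)) * (-(ω ^ 2 / 8) + ∫ q, hχ.dens q * X q) ≤ 0 :=
    mul_nonpos_of_nonneg_of_nonpos (by positivity) (by linarith)
  have h6 : ∫ q, hχ.dens q * R (p - q) ≤ 1 / a := by linarith
  have e5 : ∀ q, hχ.dens q * (4 * π / (4 * π ^ 2 * ‖p - q‖ ^ 2 + ω ^ 2))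
      = 4 * π * (hχ.dens q * R (p - q)) := fun q => by simp only [R]; ring
  simp_rw [e5]
  rw [integral_const_mul, div_eq_mul_one_div]
  gcongr

end PositiveType

/-! ### Bounds for the Coulomb interaction with a background of finite volume. -/

section Coulomb

open Set Filter Topology

lemma integrableOn_inv_norm_ball (R : ℝ) :
    IntegrableOn (fun z : R3 => ‖z‖⁻¹) (Metric.ball 0 R) := by
  refine (integrableOn_fun_norm_addHaar (volume : Measure R3) (f := fun r : ℝ => r⁻¹)).2 ?_
  have h : IntegrableOn (fun y : ℝ => y) (Ioo 0 R) :=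
    (continuous_id.integrableOn_Icc (a := 0) (b := R)).mono_set Ioo_subset_Icc_self
  refine h.congr_fun (fun y hy => ?_) measurableSet_Ioo
  have h0 : y ≠ 0 := hy.1.ne'
  have e : Module.finrank ℝ R3 - 1 = 2 := by simp
  simp only [e, smul_eq_mul]
  field_simp

/-- The potential at the origin of the uniformly charged unit ball. -/
def ballPotential : ℝ := ∫ z in Metric.ball (0 : R3) 1, ‖z‖⁻¹

lemma ballPotential_nonneg : 0 ≤ ballPotential := integral_nonneg fun _ => by positivity

lemma setIntegral_inv_norm_ball {R : ℝ} (hR : 0 < R) :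
    ∫ z in Metric.ball (0 : R3) R, ‖z‖⁻¹ = ballPotential * R ^ 2 := by
  have h := Measure.setIntegral_comp_smul_of_pos (volume : Measure R3) (fun z : R3 => ‖z‖⁻¹)
    (Metric.ball 0 1) hR
  rw [smul_unitBall_of_pos hR] at h
  have e : ∀ z : R3, ‖R • z‖⁻¹ = R⁻¹ * ‖z‖⁻¹ := fun z => by
    rw [norm_smul, Real.norm_of_nonneg hR.le, mul_inv]
  simp_rw [e] at h
  rw [integral_const_mul] at h
  have e2 : Module.finrank ℝ R3 = 3 := by simp
  rw [e2, smul_eq_mul] at h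
  rw [ballPotential]
  have h3 : R⁻¹ * ∫ z in Metric.ball (0 : R3) 1, ‖z‖⁻¹ = (R ^ 3)⁻¹ *
    ∫ z in Metric.ball (0 : R3) R, ‖z‖⁻¹ := h
  have h4 : (R ^ 3) * (R⁻¹ * ∫ z in Metric.ball (0 : R3) 1, ‖z‖⁻¹)
      = ∫ z in Metric.ball (0 : R3) R, ‖z‖⁻¹ := by
    rw [h3, mul_inv_cancel_left₀ (by positivity)]
  rw [← h4]
  field_simp

lemma coulomb_nonneg (x y : R3) : 0 ≤ coulomb x y := by unfold coulomb; positivity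

lemma coulomb_comm (x y : R3) : coulomb x y = coulomb y x := by
  unfold coulomb; rw [norm_sub_rev]

lemma coulomb_le_add {R : ℝ} (hR : 0 < R) (x y : R3) :
    coulomb x y ≤ (Metric.ball (0 : R3) R).indicator (fun z => ‖z‖⁻¹) (x - y) + R⁻¹ := by
  by_cases h : x - y ∈ Metric.ball (0 : R3) R
  · rw [indicator_of_mem h, coulomb]
    have : 0 < R⁻¹ := inv_pos.2 hR
    linarith
  · rw [indicator_of_notMem h, zero_add, coulomb]
    rw [mem_ball_zero_iff, not_lt] at h
    exact inv_anti₀ hR h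

lemma integrable_indicator_ball (x : R3) (R : ℝ) :
    Integrable fun y => (Metric.ball (0 : R3) R).indicator (fun z => ‖z‖⁻¹) (x - y) :=
  ((integrable_indicator_iff Metric.isOpen_ball.measurableSet).2
    (integrableOn_inv_norm_ball R)).comp_sub_left x

lemma measurable_coulomb : Measurable (Function.uncurry coulomb) := by
  simp only [Function.uncurry_def, coulomb]; fun_prop

variable {Ω : Set R3}

lemma integrableOn_coulomb (hΩ : volume Ω ≠ ⊤) (x : R3) : IntegrableOn (coulomb x) Ω := by
  have h1 : IntegrableOn (fun _ : R3 => (1 : ℝ)⁻¹) Ω := integrableOn_const hΩ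
  refine ((integrable_indicator_ball x 1).integrableOn.add h1).mono'
    (measurable_coulomb.comp measurable_prodMk_left).aestronglyMeasurable
    (Eventually.of_forall fun y => ?_)
  rw [Real.norm_of_nonneg (coulomb_nonneg x y)]
  exact coulomb_le_add one_pos x y

/-- Split the kernel at distance `R`: the near part is at most the potential of a ball of radius
`R`, the far part at most `1/R`. The bound is uniform in `x`; the choice `R = ℓ` later gives the
order `ℓ²` for a box. -/
lemma setIntegral_coulomb_le (hΩ : volume Ω ≠ ⊤) (x : R3) {R : ℝ} (hR : 0 < R) :
    ∫ y in Ω, coulomb x y ≤ ballPotential * R ^ 2 + volume.real Ω / R := by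
  have h1 : IntegrableOn (fun _ : R3 => R⁻¹) Ω := integrableOn_const hΩ
  calc ∫ y in Ω, coulomb x y
      ≤ ∫ y in Ω, ((Metric.ball (0 : R3) R).indicator (fun z => ‖z‖⁻¹) (x - y) + R⁻¹) :=
        integral_mono (integrableOn_coulomb hΩ x)
          ((integrable_indicator_ball x R).integrableOn.add h1) fun y => coulomb_le_add hR x y
    _ = (∫ y in Ω, (Metric.ball (0 : R3) R).indicator (fun z => ‖z‖⁻¹) (x - y))
        + volume.real Ω / R := by
        rw [integral_add (integrable_indicator_ball x R).integrableOn h1, setIntegral_const,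
          smul_eq_mul, div_eq_mul_inv]
    _ ≤ (∫ y, (Metric.ball (0 : R3) R).indicator (fun z => ‖z‖⁻¹) (x - y))
        + volume.real Ω / R := by
        refine add_le_add_left (setIntegral_le_integral (integrable_indicator_ball x R)
          (Eventually.of_forall fun y => ?_)) _
        exact indicator_nonneg (fun z _ => by positivity) _
    _ = _ := by
        rw [integral_sub_left_eq_self (fun z => (Metric.ball (0 : R3) R).indicator
          (fun z => ‖z‖⁻¹) z) volume x, integral_indicator Metric.isOpen_ball.measurableSet,
          setIntegral_inv_norm_ball hR]

/-- Measurable pair interactions bounded by the Coulomb interaction. -/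
structure CoulombBounded (v : R3 → R3 → ℝ) : Prop where
  measurable : Measurable (Function.uncurry v)
  abs_le : ∀ x y, |v x y| ≤ coulomb x y

lemma coulombBounded_coulomb : CoulombBounded coulomb :=
  ⟨measurable_coulomb, fun x y => (abs_of_nonneg (coulomb_nonneg x y)).le⟩

variable {v v' : R3 → R3 → ℝ}

lemma CoulombBounded.integrableOn (hv : CoulombBounded v) (hΩ : volume Ω ≠ ⊤) (x : R3) :
    IntegrableOn (v x) Ω :=
  (integrableOn_coulomb hΩ x).mono'
    (hv.measurable.comp measurable_prodMk_left).aestronglyMeasurable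
    (Eventually.of_forall fun y => hv.abs_le x y)

lemma CoulombBounded.abs_setIntegral_le (hv : CoulombBounded v) (hΩ : volume Ω ≠ ⊤) (x : R3)
    {R : ℝ} (hR : 0 < R) :
    |∫ y in Ω, v x y| ≤ ballPotential * R ^ 2 + volume.real Ω / R := by
  refine le_trans ?_ (setIntegral_coulomb_le hΩ x hR)
  refine (abs_integral_le_integral_abs).trans ?_
  exact integral_mono (hv.integrableOn hΩ x).abs (integrableOn_coulomb hΩ x) fun y => hv.abs_le x y

lemma CoulombBounded.measurable_setIntegral (hv : CoulombBounded v) (Ω : Set R3) :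
    Measurable fun x => ∫ y in Ω, v x y :=
  (hv.measurable.stronglyMeasurable.integral_prod_right
    (ν := volume.restrict Ω)).measurable

lemma CoulombBounded.integrableOn_setIntegral (hv : CoulombBounded v) {Ω Ω' : Set R3}
    (hΩ : volume Ω ≠ ⊤) (hΩ' : volume Ω' ≠ ⊤) :
    IntegrableOn (fun x => ∫ y in Ω, v x y) Ω' :=
  (integrableOn_const hΩ').mono' (hv.measurable_setIntegral Ω).aestronglyMeasurable
    (Eventually.of_forall fun x => hv.abs_setIntegral_le hΩ x one_pos)

lemma CoulombBounded.integrable_prod (hv : CoulombBounded v) {Ω Ω' : Set R3}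
    (hΩ : volume Ω ≠ ⊤) (hΩ' : volume Ω' ≠ ⊤) :
    Integrable (Function.uncurry v) ((volume.restrict Ω').prod (volume.restrict Ω)) := by
  rw [integrable_prod_iff hv.measurable.aestronglyMeasurable]
  refine ⟨Eventually.of_forall fun x => hv.integrableOn hΩ x, ?_⟩
  have h : CoulombBounded fun x y => ‖v x y‖ :=
    ⟨hv.measurable.norm, fun x y => by simpa using hv.abs_le x y⟩
  exact h.integrableOn_setIntegral hΩ hΩ'

lemma measurable_potential (hv : CoulombBounded v) (Ω : Set R3) (ρ : ℝ) (n : ℕ) :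
    Measurable (potential v Ω ρ : Config n → ℝ) := by
  have h1 := hv.measurable_setIntegral Ω
  have h2 := hv.measurable
  unfold potential
  refine Measurable.add (Measurable.sub ?_ ?_) measurable_const
  · refine Finset.measurable_fun_sum _ fun i _ => Finset.measurable_fun_sum _ fun j _ => ?_
    have h3 : Measurable fun x : Config n => (x i, x j) :=
      (measurable_pi_apply i).prodMk (measurable_pi_apply j)
    exact h2.comp h3
  · refine measurable_const.mul (Finset.measurable_fun_sum _ fun i _ => ?_)
    exact h1.comp (measurable_pi_apply i)

lemma potential_sub (hv : CoulombBounded v) (hv' : CoulombBounded v') (hΩ : volume Ω ≠ ⊤)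
    (ρ : ℝ) {n : ℕ} (x : Config n) :
    potential (fun x y => v x y - v' x y) Ω ρ x
      = potential v Ω ρ x - potential v' Ω ρ x := by
  unfold potential
  have e1 : ∀ a, ∫ y in Ω, (v a y - v' a y) = (∫ y in Ω, v a y) - ∫ y in Ω, v' a y := fun a =>
    integral_sub (hv.integrableOn hΩ a) (hv'.integrableOn hΩ a)
  simp only [e1, Finset.sum_sub_distrib]
  rw [integral_sub (hv.integrableOn_setIntegral hΩ hΩ) (hv'.integrableOn_setIntegral hΩ hΩ)]
  ring

lemma pair_sum_nonneg (hv0 : ∀ x y, 0 ≤ v x y) {n : ℕ} (x : Config n) :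
    0 ≤ ∑ i, ∑ j ∈ Finset.Ioi i, v (x i) (x j) :=
  Finset.sum_nonneg fun _ _ => Finset.sum_nonneg fun _ _ => hv0 _ _

lemma background_nonneg (hv0 : ∀ x y, 0 ≤ v x y) (Ω : Set R3) (ρ : ℝ) :
    0 ≤ 1 / 2 * ρ ^ 2 * ∫ y in Ω, ∫ z in Ω, v y z :=
  mul_nonneg (by positivity) (integral_nonneg fun _ => integral_nonneg fun _ => hv0 _ _)

/-- A bound on the attraction of one particle to the background. -/
def backgroundBound (Ω : Set R3) : ℝ := ballPotential + volume.real Ω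

lemma CoulombBounded.setIntegral_le (hv : CoulombBounded v) (hΩ : volume Ω ≠ ⊤) (x : R3) :
    ∫ y in Ω, v x y ≤ backgroundBound Ω := by
  have := (le_abs_self _).trans (hv.abs_setIntegral_le hΩ x one_pos)
  simpa [backgroundBound] using this

/-- The attraction is bounded, so finite potential energy forces the pair repulsion alone to be
integrable. This supplies the dominating function for all localized potentials. -/
lemma pair_sum_le_potential (hv : CoulombBounded v) (hv0 : ∀ x y, 0 ≤ v x y)
    (hΩ : volume Ω ≠ ⊤) {ρ : ℝ} (hρ : 0 ≤ ρ) {n : ℕ} (x : Config n) :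
    (∑ i, ∑ j ∈ Finset.Ioi i, v (x i) (x j)) - ρ * (n * backgroundBound Ω)
      ≤ potential v Ω ρ x := by
  have h2 := background_nonneg hv0 Ω ρ
  have h3 : ∑ j, ∫ y in Ω, v (x j) y ≤ n * backgroundBound Ω := by
    calc ∑ j, ∫ y in Ω, v (x j) y ≤ ∑ _j : Fin n, backgroundBound Ω :=
          Finset.sum_le_sum fun j _ => hv.setIntegral_le hΩ _
      _ = _ := by simp
  have h4 := mul_le_mul_of_nonneg_left h3 hρ
  unfold potential
  linarith

lemma potential_le_pair_sum (hv0 : ∀ x y, 0 ≤ v x y)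
    {ρ : ℝ} (hρ : 0 ≤ ρ) {n : ℕ} (x : Config n) :
    potential v Ω ρ x ≤ (∑ i, ∑ j ∈ Finset.Ioi i, v (x i) (x j))
      + 1 / 2 * ρ ^ 2 * ∫ y in Ω, ∫ z in Ω, v y z := by
  have h3 : 0 ≤ ∑ j, ∫ y in Ω, v (x j) y :=
    Finset.sum_nonneg fun j _ => integral_nonneg fun _ => hv0 _ _
  have h4 := mul_nonneg hρ h3
  unfold potential
  linarith

lemma neg_le_potential (hv : CoulombBounded v) (hv0 : ∀ x y, 0 ≤ v x y) (hΩ : volume Ω ≠ ⊤)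
    {ρ : ℝ} (hρ : 0 ≤ ρ) {n : ℕ} (x : Config n) :
    -(ρ * (n * backgroundBound Ω)) ≤ potential v Ω ρ x := by
  have h1 := pair_sum_le_potential hv hv0 hΩ hρ x
  have h2 := pair_sum_nonneg hv0 x
  linarith

end Coulomb

/-! ### Functions of positive type. -/

section PositiveType

open Set Filter Topology Real FourierTransform

/-- The mutual energy of two charge distributions interacting through `f (x - y)`. -/
def mutualEnergy (f : R3 → ℝ) (μ ν : Measure R3) : ℝ := ∫ z, f (z.1 - z.2) ∂(μ.prod ν)

/-- Functions of positive type. -/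
def PositiveType (f : R3 → ℝ) : Prop :=
  ∀ (μ ν : Measure R3) [IsFiniteMeasure μ] [IsFiniteMeasure ν] (ρ : ℝ),
    0 ≤ mutualEnergy f μ μ - 2 * ρ * mutualEnergy f μ ν + ρ ^ 2 * mutualEnergy f ν ν

lemma continuous_integral_cos (μ : Measure R3) [IsFiniteMeasure μ] :
    Continuous (fun w : R3 => ∫ x, Real.cos (2 * π * inner ℝ w x) ∂μ) ∧
    Continuous (fun w : R3 => ∫ x, Real.sin (2 * π * inner ℝ w x) ∂μ) := by
  constructor
  · refine continuous_of_dominated (bound := fun _ => 1)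
      (fun w => (by fun_prop : Continuous _).aestronglyMeasurable)
      (fun w => Eventually.of_forall fun x => Real.abs_cos_le_one _) (integrable_const _)
      (Eventually.of_forall fun x => by fun_prop)
  · refine continuous_of_dominated (bound := fun _ => 1)
      (fun w => (by fun_prop : Continuous _).aestronglyMeasurable)
      (fun w => Eventually.of_forall fun x => Real.abs_sin_le_one _) (integrable_const _)
      (Eventually.of_forall fun x => by fun_prop)

lemma abs_integral_trig_le (μ : Measure R3) [IsFiniteMeasure μ] (w : R3) :
    |∫ x, Real.cos (2 * π * inner ℝ w x) ∂μ| ≤ μ.real univ ∧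
    |∫ x, Real.sin (2 * π * inner ℝ w x) ∂μ| ≤ μ.real univ := by
  constructor
  · simpa using norm_integral_le_of_norm_le_const (μ := μ) (C := 1)
      (f := fun x => Real.cos (2 * π * inner ℝ w x)) (Eventually.of_forall fun x => Real.abs_cos_le_one _)
  · simpa using norm_integral_le_of_norm_le_const (μ := μ) (C := 1)
      (f := fun x => Real.sin (2 * π * inner ℝ w x)) (Eventually.of_forall fun x => Real.abs_sin_le_one _)

lemma mutual_integral_cos {g : R3 → ℝ} (hg : Integrable g) (μ ν : Measure R3)
    [IsFiniteMeasure μ] [IsFiniteMeasure ν] :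
    mutualEnergy (fun z => ∫ w, g w * Real.cos (2 * π * inner ℝ w z)) μ ν
      = ∫ w, g w * ((∫ x, Real.cos (2 * π * inner ℝ w x) ∂μ)
            * (∫ x, Real.cos (2 * π * inner ℝ w x) ∂ν)
          + (∫ x, Real.sin (2 * π * inner ℝ w x) ∂μ)
            * (∫ x, Real.sin (2 * π * inner ℝ w x) ∂ν)) := by
  have hint : Integrable (Function.uncurry fun (z : R3 × R3) (w : R3) =>
      g w * Real.cos (2 * π * inner ℝ w (z.1 - z.2))) ((μ.prod ν).prod volume) := by
    have h1 : Integrable (fun p : (R3 × R3) × R3 => (1 : ℝ) * g p.2) ((μ.prod ν).prod volume) :=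
      (integrable_const (1 : ℝ)).mul_prod hg
    refine h1.norm.mono' ?_ (Eventually.of_forall fun p => ?_)
    · simp only [one_mul] at h1
      exact h1.aestronglyMeasurable.mul
        (by fun_prop : Continuous fun p : (R3 × R3) × R3 =>
          Real.cos (2 * π * inner ℝ p.2 (p.1.1 - p.1.2))).aestronglyMeasurable
    · simp only [Function.uncurry_def, norm_mul, one_mul]
      exact mul_le_of_le_one_right (norm_nonneg _) (Real.abs_cos_le_one _)
  rw [mutualEnergy, integral_integral_swap hint]
  refine integral_congr_ae (Eventually.of_forall fun w => ?_)
  simp only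
  rw [integral_const_mul]
  congr 1
  have hc : ∀ (m : Measure R3) [IsFiniteMeasure m],
      Integrable (fun x => Real.cos (2 * π * inner ℝ w x)) m := fun m _ =>
    (integrable_const (1 : ℝ)).mono' (by fun_prop : Continuous _).aestronglyMeasurable
      (Eventually.of_forall fun x => Real.abs_cos_le_one _)
  have hs : ∀ (m : Measure R3) [IsFiniteMeasure m],
      Integrable (fun x => Real.sin (2 * π * inner ℝ w x)) m := fun m _ =>
    (integrable_const (1 : ℝ)).mono' (by fun_prop : Continuous _).aestronglyMeasurable
      (Eventually.of_forall fun x => Real.abs_sin_le_one _)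
  have e : ∀ z : R3 × R3, Real.cos (2 * π * inner ℝ w (z.1 - z.2))
      = Real.cos (2 * π * inner ℝ w z.1) * Real.cos (2 * π * inner ℝ w z.2)
        + Real.sin (2 * π * inner ℝ w z.1) * Real.sin (2 * π * inner ℝ w z.2) := fun z => by
    rw [inner_sub_right, mul_sub, Real.cos_sub]
  simp_rw [e]
  rw [integral_add ((hc μ).mul_prod (hc ν)) ((hs μ).mul_prod (hs ν)),
    integral_prod_mul (μ := μ) (ν := ν) (fun x => Real.cos (2 * π * inner ℝ w x))
      (fun x => Real.cos (2 * π * inner ℝ w x)),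
    integral_prod_mul (μ := μ) (ν := ν) (fun x => Real.sin (2 * π * inner ℝ w x))
      (fun x => Real.sin (2 * π * inner ℝ w x))]

/-- By `cos(a - b) = cos a cos b + sin a sin b`, the quadratic form is an integral of `g` times the
sum of the squares of the cosine and sine transforms of `μ - ρν`. -/
lemma positiveType_integral_cos {g : R3 → ℝ} (hg : Integrable g) (hg0 : ∀ w, 0 ≤ g w) :
    PositiveType fun z => ∫ w, g w * Real.cos (2 * π * inner ℝ w z) := by
  intro μ ν _ _ ρ
  set c : Measure R3 → R3 → ℝ := fun m w => ∫ x, Real.cos (2 * π * inner ℝ w x) ∂m with hc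
  set s : Measure R3 → R3 → ℝ := fun m w => ∫ x, Real.sin (2 * π * inner ℝ w x) ∂m with hs
  have hI : ∀ (m m' : Measure R3) [IsFiniteMeasure m] [IsFiniteMeasure m'],
      Integrable fun w => g w * (c m w * c m' w + s m w * s m' w) := by
    intro m m' _ _
    have h1 := continuous_integral_cos m
    have h2 := continuous_integral_cos m'
    refine hg.mul_bdd (c := m.real univ * m'.real univ + m.real univ * m'.real univ)
      ((h1.1.mul h2.1).add (h1.2.mul h2.2)).aestronglyMeasurable
      (Eventually.of_forall fun w => ?_)
    have b1 := abs_integral_trig_le m w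
    have b2 := abs_integral_trig_le m' w
    refine (norm_add_le _ _).trans ?_
    rw [norm_mul, norm_mul]
    exact add_le_add (mul_le_mul b1.1 b2.1 (norm_nonneg _) measureReal_nonneg)
      (mul_le_mul b1.2 b2.2 (norm_nonneg _) measureReal_nonneg)
  rw [mutual_integral_cos hg, mutual_integral_cos hg, mutual_integral_cos hg,
    ← integral_const_mul, ← integral_const_mul, ← integral_sub (hI μ μ) ((hI μ ν).const_mul _)]
  have hsub : Integrable fun w => g w * (c μ w * c μ w + s μ w * s μ w)
      - 2 * ρ * (g w * (c μ w * c ν w + s μ w * s ν w)) :=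
    (hI μ μ).sub ((hI μ ν).const_mul (2 * ρ))
  refine le_of_le_of_eq ?_ (integral_add hsub ((hI ν ν).const_mul (ρ ^ 2)))
  refine integral_nonneg fun w => ?_
  have : g w * (c μ w * c μ w + s μ w * s μ w) - 2 * ρ * (g w * (c μ w * c ν w + s μ w * s ν w))
      + ρ ^ 2 * (g w * (c ν w * c ν w + s ν w * s ν w))
      = g w * ((c μ w - ρ * c ν w) ^ 2 + (s μ w - ρ * s ν w) ^ 2) := by ring
  refine le_of_le_of_eq ?_ this.symm
  have := hg0 w
  positivity

lemma tendsto_mutual {F : ℕ → R3 → ℝ} {f : R3 → ℝ} {M : ℝ} (hF : ∀ n, Measurable (F n))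
    (hb : ∀ᶠ n in atTop, ∀ z, |F n z| ≤ M) (h : ∀ z, Tendsto (fun n => F n z) atTop (𝓝 (f z)))
    (μ ν : Measure R3) [IsFiniteMeasure μ] [IsFiniteMeasure ν] :
    Tendsto (fun n => mutualEnergy (F n) μ ν) atTop (𝓝 (mutualEnergy f μ ν)) := by
  refine tendsto_integral_filter_of_dominated_convergence (fun _ => M) ?_ ?_
    (integrable_const _) (Eventually.of_forall fun z => h _)
  · exact Eventually.of_forall fun n =>
      ((hF n).comp (measurable_fst.sub measurable_snd)).aestronglyMeasurable
  · filter_upwards [hb] with n hn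
    exact Eventually.of_forall fun z => hn _

/-- Bounded pointwise convergence passes to integrals against finite measures, by dominated
convergence. -/
lemma PositiveType.of_tendsto {F : ℕ → R3 → ℝ} {f : R3 → ℝ} {M : ℝ}
    (hF : ∀ n, Measurable (F n)) (hP : ∀ᶠ n in atTop, PositiveType (F n))
    (hb : ∀ᶠ n in atTop, ∀ z, |F n z| ≤ M)
    (h : ∀ z, Tendsto (fun n => F n z) atTop (𝓝 (f z))) : PositiveType f := by
  intro μ ν _ _ ρ
  have h1 := tendsto_mutual hF hb h μ μ
  have h2 := tendsto_mutual hF hb h μ ν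
  have h3 := tendsto_mutual hF hb h ν ν
  refine ge_of_tendsto ((h1.sub (h2.const_mul (2 * ρ))).add (h3.const_mul (ρ ^ 2))) ?_
  filter_upwards [hP] with n hn using hn μ ν ρ

lemma mutual_comp_smul {f : R3 → ℝ} (hf : Measurable f) (r : ℝ) (μ ν : Measure R3)
    [IsFiniteMeasure μ] [IsFiniteMeasure ν] :
    mutualEnergy (fun z => f (r • z)) μ ν
      = mutualEnergy f (μ.map fun x => r • x) (ν.map fun x => r • x) := by
  have hm : Measurable fun x : R3 => r • x := measurable_const_smul r
  rw [mutualEnergy, mutualEnergy, Measure.map_prod_map μ ν hm hm, integral_map]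
  · simp only [Prod.map_fst, Prod.map_snd, smul_sub]
  · exact (hm.prodMap hm).aemeasurable
  · exact (hf.comp (measurable_fst.sub measurable_snd)).aestronglyMeasurable

lemma PositiveType.comp_smul {f : R3 → ℝ} (hf : Measurable f) (h : PositiveType f) (r : ℝ) :
    PositiveType fun z => f (r • z) := by
  intro μ ν _ _ ρ
  rw [mutual_comp_smul hf, mutual_comp_smul hf, mutual_comp_smul hf]
  exact h _ _ ρ

lemma PositiveType.const_mul {f : R3 → ℝ} (h : PositiveType f) {a : ℝ} (ha : 0 ≤ a) :
    PositiveType fun z => a * f z := by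
  intro μ ν _ _ ρ
  have := mul_nonneg ha (h μ ν ρ)
  simp only [mutualEnergy, integral_const_mul] at this ⊢
  linarith

/-- A continuous integrable function with nonnegative Fourier transform is of positive
type. -/
lemma positiveType_of_fourier {f : R3 → ℝ} (hcont : Continuous f) (hi : Integrable f) {F : R3 → ℝ} (hF0 : ∀ w, 0 ≤ F w)
    (hF : ∀ w, 𝓕 (fun z => (f z : ℂ)) w = (F w : ℂ)) : PositiveType f := by
  have hfc : Integrable fun z => (f z : ℂ) := hi.ofReal
  have hFcont : Continuous F := by
    have h1 : Continuous (𝓕 fun z => (f z : ℂ)) :=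
      VectorFourier.fourierIntegral_continuous Real.continuous_fourierChar
        (by exact continuous_inner) hfc
    have h2 : F = fun w => (𝓕 (fun z => (f z : ℂ)) w).re := by
      funext w; rw [hF, Complex.ofReal_re]
    rw [h2]; exact Complex.continuous_re.comp h1
  have hFb : ∀ w, |F w| ≤ ∫ z, |f z| := by
    intro w
    have h1 : ‖𝓕 (fun z => (f z : ℂ)) w‖ ≤ ∫ z, ‖(f z : ℂ)‖ :=
      VectorFourier.norm_fourierIntegral_le_integral_norm _ _ _ _ _
    rw [hF, Complex.norm_real] at h1
    simpa using h1
  -- `F` is not assumed integrable, so Fourier inversion is applied with a Gaussian damping, removed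
  -- as `c → ∞`. In position space the damping is convolution of `f` with a Gaussian concentrating
  -- at the origin, and continuity of `f` gives convergence at every point.
  let g : ℝ → R3 → ℝ := fun c w => rexp (-c⁻¹ * ‖w‖ ^ 2) * F w
  have hg : ∀ c : ℝ, 0 < c → Integrable (g c) := by
    intro c hc
    have h1 : Integrable fun w : R3 => rexp (-c⁻¹ * ‖w‖ ^ 2) := by
      have := GaussianFourier.integrable_cexp_neg_mul_sq_norm_add (V := R3) (b := ((c⁻¹ : ℝ) : ℂ))
        (by rw [Complex.ofReal_re]; positivity) 0 0
      refine this.norm.congr (Eventually.of_forall fun w => ?_)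
      simp only [Complex.norm_exp, zero_mul, add_zero]
      norm_cast
    exact h1.mul_bdd hFcont.aestronglyMeasurable (Eventually.of_forall hFb)
  let φ : ℝ → R3 → ℝ := fun c z => ∫ w, g c w * Real.cos (2 * π * inner ℝ w z)
  let G : ℝ → R3 → ℂ := fun c v =>
    (π * c : ℂ) ^ ((Module.finrank ℝ R3 : ℂ) / 2) * Complex.exp (-π ^ 2 * c * ‖v‖ ^ 2)
  -- the two expressions of the mollified function
  have hφ : ∀ c : ℝ, 0 < c → ∀ v, (φ c v : ℂ) = (∫ w, G c (v - w) • (f w : ℂ)) := by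
    intro c hc v
    have J : Integrable (fun w : R3 =>
        Complex.exp (- (c⁻¹ : ℂ) * ‖w‖ ^ 2 + 2 * π * Complex.I * inner ℝ v w)) :=
      GaussianFourier.integrable_cexp_neg_mul_sq_norm_add
        (by rw [← Complex.ofReal_inv, Complex.ofReal_re]; positivity) _ _
    have h1 : ∫ w : R3, 𝓕 (fun w : R3 => Complex.exp (- (c⁻¹ : ℂ) * ‖w‖ ^ 2
          + 2 * π * Complex.I * inner ℝ v w)) w • (f w : ℂ)
        = ∫ w : R3, Complex.exp (- (c⁻¹ : ℂ) * ‖w‖ ^ 2 + 2 * π * Complex.I * inner ℝ v w)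
          • 𝓕 (fun z => (f z : ℂ)) w := by
      simpa using! (VectorFourier.integral_fourierIntegral_smul_eq_flip (L := innerₗ R3)
        Real.continuous_fourierChar continuous_inner J hfc)
    have h2 : ∀ w, 𝓕 (fun w : R3 => Complex.exp (- (c⁻¹ : ℂ) * ‖w‖ ^ 2
          + 2 * π * Complex.I * inner ℝ v w)) w = G c (v - w) := by
      intro w
      rw [fourier_gaussian_innerProductSpace'
        (by rw [← Complex.ofReal_inv, Complex.ofReal_re]; positivity)]
      simp only [G, div_inv_eq_mul]
      congr 2
      ring
    simp_rw [h2] at h1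
    rw [h1]
    have h3 : ∀ w : R3, Complex.exp (- (c⁻¹ : ℂ) * ‖w‖ ^ 2 + 2 * π * Complex.I * inner ℝ v w)
          • 𝓕 (fun z => (f z : ℂ)) w
        = (g c w : ℂ) * Complex.exp (((2 * π * inner ℝ w v : ℝ) : ℂ) * Complex.I) := by
      intro w
      have hsymm : inner ℝ v w = inner ℝ w v := real_inner_comm w v
      rw [hF, Complex.exp_add, hsymm]
      simp only [g, smul_eq_mul]
      push_cast
      have : 2 * (π : ℂ) * Complex.I * (inner ℝ w v : ℝ) = 2 * π * (inner ℝ w v : ℝ) * Complex.I := by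
        ring
      rw [this]; ring
    simp_rw [h3]
    have hint := integrable_exp_smul (hg c hc) (fun w => 2 * π * inner ℝ w v) (by fun_prop)
    refine Complex.ext ?_ ?_
    · have h4 := integral_re hint
      simp only [RCLike.re_to_complex] at h4
      rw [← h4, Complex.ofReal_re]
      refine integral_congr_ae (Eventually.of_forall fun w => ?_)
      simp only
      rw [Complex.re_ofReal_mul, Complex.exp_ofReal_mul_I_re]
    · -- the imaginary part vanishes because the left-hand side of `h1` is real
      have h4 : ∀ w, G c (v - w) • (f w : ℂ)
          = (((π * c) ^ ((Module.finrank ℝ R3 : ℝ) / 2) * rexp (-π ^ 2 * c * ‖v - w‖ ^ 2) * f w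
            : ℝ) : ℂ) := by
        intro w
        simp only [G, smul_eq_mul]
        push_cast
        rw [Complex.ofReal_cpow (by positivity)]
        push_cast; rfl
      rw [Complex.ofReal_im]
      simp_rw [h3] at h1
      rw [← h1]
      simp_rw [h4]
      rw [integral_complex_ofReal, Complex.ofReal_im]
  have hlim : ∀ v, Tendsto (fun c => φ c v) atTop (𝓝 (f v)) := by
    intro v
    have h1 := Real.tendsto_integral_gaussian_smul' hfc (v := v)
      (Complex.continuous_ofReal.comp hcont).continuousAt
    have h2 : Tendsto (fun c => ((φ c v : ℝ) : ℂ)) atTop (𝓝 (f v : ℂ)) := by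
      refine h1.congr' ?_
      filter_upwards [Ioi_mem_atTop (0 : ℝ)] with c hc
      rw [hφ c hc v]
    have h3 := (Complex.continuous_re.tendsto _).comp h2
    simpa [Function.comp_def] using h3
  have hg0 : ∀ c w, 0 ≤ g c w := fun c w => mul_nonneg (Real.exp_pos _).le (hF0 w)
  have hgcos : ∀ c : ℝ, 0 < c → ∀ z,
      Integrable fun w => g c w * Real.cos (2 * π * inner ℝ w z) := fun c hc z =>
    (hg c hc).mul_bdd (c := 1) (by fun_prop : Continuous _).aestronglyMeasurable
      (Eventually.of_forall fun w => Real.abs_cos_le_one _)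
  have hφb : ∀ c : ℝ, 0 < c → ∀ z, |φ c z| ≤ φ c 0 := by
    intro c hc z
    refine abs_integral_le_integral_abs.trans ?_
    simp only [φ, inner_zero_right, mul_zero, Real.cos_zero, mul_one]
    refine integral_mono (hgcos c hc z).abs (hg c hc) fun w => ?_
    simp only [abs_mul, abs_of_nonneg (hg0 c w)]
    exact mul_le_of_le_one_right (hg0 c w) (Real.abs_cos_le_one _)
  have hφm : ∀ c : ℝ, 0 < c → Continuous (φ c) := by
    intro c hc
    refine continuous_of_dominated (bound := g c) (fun z => (hgcos c hc z).aestronglyMeasurable)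
      (fun z => Eventually.of_forall fun w => ?_) (hg c hc)
      (Eventually.of_forall fun w => by fun_prop)
    rw [norm_mul, Real.norm_of_nonneg (hg0 c w)]
    exact mul_le_of_le_one_right (hg0 c w) (Real.abs_cos_le_one _)
  have hpos : ∀ n : ℕ, (0 : ℝ) < n + 1 := fun n => by positivity
  have hseq : Tendsto (fun n : ℕ => (n : ℝ) + 1) atTop atTop :=
    tendsto_atTop_add_const_right _ _ tendsto_natCast_atTop_atTop
  refine PositiveType.of_tendsto (F := fun n : ℕ => φ (n + 1)) (M := f 0 + 1)
    (fun n => (hφm _ (hpos n)).measurable)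
    (Eventually.of_forall fun n => positiveType_integral_cos (hg _ (hpos n)) (hg0 _)) ?_
    (fun z => (hlim z).comp hseq)
  -- The maximum of each damped function is its value at the origin, since `g ≥ 0`; these values
  -- converge to `f 0`, so the bound is eventually uniform.
  have h1 := ((hlim 0).comp hseq).eventually (gt_mem_nhds (lt_add_one (f 0)))
  filter_upwards [h1] with n hn
  exact fun z => (hφb _ (hpos n) z).trans hn.le

end PositiveType

/-! ### The regularized difference of potentials, and Onsager's lemma. -/

section RegularizedDifference

open Set Filter Topology Real FourierTransform

variable {B : ℕ → ℝ} {t : ℝ} {χ : R3 → ℝ}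

open Classical in
/-- The difference of a Yukawa potential and a cut off Yukawa potential, continuously extended to
the origin. -/
def yukawaDiff (χ : R3 → ℝ) (ν ω : ℝ) (z : R3) : ℝ :=
  if z = 0 then ω - ν else yukawa ν z - corr χ z * yukawa ω z

lemma yukawaDiff_zero (ν ω : ℝ) : yukawaDiff χ ν ω 0 = ω - ν := if_pos rfl

lemma yukawaDiff_of_ne {ν ω : ℝ} {z : R3} (hz : z ≠ 0) :
    yukawaDiff χ ν ω z = yukawa ν z - corr χ z * yukawa ω z := if_neg hz

/-- Near the origin write the difference as `(e^{-νr} - e^{-ωr})/r + (1 - corr) Y_ω`. The first term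
is a difference quotient with limit `ω - ν`; the second is `O(r)` by `IsCutoff.one_sub_corr`. -/
lemma continuous_yukawaDiff (hχ : IsCutoff B t χ) (ht : t < 1 / 2) {ν ω : ℝ} (hω : 0 ≤ ω) :
    Continuous (yukawaDiff χ ν ω) := by
  rw [continuous_iff_continuousAt]
  intro z
  rcases eq_or_ne z 0 with rfl | hz
  · rw [continuousAt_iff_punctured_nhds, yukawaDiff_zero]
    have h1 : Tendsto (fun r : ℝ => r⁻¹ * (rexp (-ν * r) - rexp (-ω * r))) (𝓝[≠] 0)
        (𝓝 (ω - ν)) := by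
      have hd : HasDerivAt (fun r : ℝ => rexp (-ν * r) - rexp (-ω * r)) (ω - ν) 0 := by
        have d1 : HasDerivAt (fun r : ℝ => rexp (-ν * r)) (rexp (-ν * 0) * (-ν * 1)) 0 :=
          ((hasDerivAt_id (0 : ℝ)).const_mul (-ν)).exp
        have d2 : HasDerivAt (fun r : ℝ => rexp (-ω * r)) (rexp (-ω * 0) * (-ω * 1)) 0 :=
          ((hasDerivAt_id (0 : ℝ)).const_mul (-ω)).exp
        refine (d1.sub d2).congr_deriv ?_
        simp; ring
      have := hasDerivAt_iff_tendsto_slope_zero.1 hd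
      simpa using this
    have h2 : Tendsto (fun z : R3 => ‖z‖) (𝓝[≠] 0) (𝓝[≠] 0) := tendsto_norm_nhdsNE_zero.mono_right
      (nhdsWithin_mono _ fun x hx => ne_of_gt hx)
    have h3 := h1.comp h2
    have h4 : Tendsto (fun z : R3 => (1 - corr χ z) * yukawa ω z) (𝓝[≠] 0) (𝓝 0) := by
      set C := 2 * π ^ 2 * ∫ q, ‖q‖ ^ 2 * hχ.dens q
      have hb : ∀ z : R3, (1 - corr χ z) * yukawa ω z ≤ C * ‖z‖ := by
        intro z
        rcases eq_or_ne z 0 with rfl | hz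
        · simp [yukawa]
        have h5 := (hχ.one_sub_corr ht z).2
        have h6 : yukawa ω z ≤ ‖z‖⁻¹ := by
          unfold yukawa
          refine mul_le_of_le_one_right (by positivity) (Real.exp_le_one_iff.2 ?_)
          have := norm_nonneg z
          nlinarith
        calc (1 - corr χ z) * yukawa ω z ≤ (C * ‖z‖ ^ 2) * ‖z‖⁻¹ :=
              mul_le_mul h5 h6 (yukawa_nonneg _ _) (le_trans (hχ.one_sub_corr ht z).1 h5)
          _ = C * ‖z‖ := by
              have := norm_ne_zero_iff.2 hz
              field_simp
      have h7 : Tendsto (fun z : R3 => C * ‖z‖) (𝓝[≠] 0) (𝓝 0) := by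
        have : Continuous fun z : R3 => C * ‖z‖ := by fun_prop
        have := this.tendsto 0
        rw [norm_zero, mul_zero] at this
        exact this.mono_left nhdsWithin_le_nhds
      exact squeeze_zero (fun z => mul_nonneg (hχ.one_sub_corr ht z).1 (yukawa_nonneg _ _)) hb h7
    have h5 := h3.add h4
    rw [add_zero] at h5
    refine h5.congr' ?_
    filter_upwards [self_mem_nhdsWithin] with z hz
    rw [yukawaDiff_of_ne hz]
    simp only [Function.comp, yukawa]
    ring
  · have h1 : ContinuousAt (fun z => yukawa ν z - corr χ z * yukawa ω z) z := by
      have hn : ‖z‖ ≠ 0 := norm_ne_zero_iff.2 hz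
      have hy : ∀ a : ℝ, ContinuousAt (yukawa a) z := fun a => by
        unfold yukawa
        exact (continuous_norm.continuousAt.inv₀ hn).mul (by fun_prop)
      exact (hy ν).sub ((hχ.continuous_corr ht).continuousAt.mul (hy ω))
    refine h1.congr ?_
    filter_upwards [isOpen_ne.mem_nhds hz] with y hy
    exact (yukawaDiff_of_ne hy).symm

lemma yukawaDiff_ae_eq (ν ω : ℝ) :
    yukawaDiff χ ν ω =ᵐ[volume] fun z => yukawa ν z - corr χ z * yukawa ω z := by
  filter_upwards [ae_ne_zero] with z hz using yukawaDiff_of_ne hz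

lemma corr_neg (χ : R3 → ℝ) (z : R3) : corr χ (-z) = corr χ z := by
  rw [corr, corr, ← integral_add_right_eq_self _ z]
  congr 1
  refine integral_congr_ae (Eventually.of_forall fun y => ?_)
  simp [mul_comm]

lemma yukawaDiff_neg (ν ω : ℝ) (z : R3) : yukawaDiff χ ν ω (-z) = yukawaDiff χ ν ω z := by
  simp only [yukawaDiff, neg_eq_zero, yukawa, norm_neg, corr_neg]

/-- The Fourier transform is the resolvent of mass `ν` minus the smeared resolvent of mass `ω`. A
mass `ν > 0` is kept so that the function is integrable. -/
lemma positiveType_yukawaDiff (hχ : IsCutoff B t χ) (ht : t < 1 / 2)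
    {ω ν : ℝ} (hω : 0 < ω) (hν : 0 < ν) (hνω : ν ^ 2 ≤ ω ^ 2 / 2)
    (hmom : ∫ q, hχ.dens q * (4 * (4 * π ^ 2 * ‖q‖ ^ 2) + 48 * (4 * π ^ 2 * ‖q‖ ^ 2) ^ 2 / ω ^ 2)
      ≤ ω ^ 2 / 8) : PositiveType (yukawaDiff χ ν ω) := by
  have hi1 := integrable_yukawa hν
  have hi2 := integrable_ofReal_mul_corr_yukawa hχ ht hω
  refine positiveType_of_fourier (F := fun p => 4 * π / (4 * π ^ 2 * ‖p‖ ^ 2 + ν ^ 2)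
      - ∫ q, hχ.dens q * (4 * π / (4 * π ^ 2 * ‖p - q‖ ^ 2 + ω ^ 2)))
    (continuous_yukawaDiff hχ ht hω.le) ((hi1.sub hi2).congr (yukawaDiff_ae_eq ν ω).symm)
    (fun p => sub_nonneg.2 (hχ.integral_resolvent_le ht hω hν hνω hmom p)) fun p => ?_
  rw [Complex.ofReal_sub, ← fourier_yukawa hν, ← hχ.fourier_corr_mul_yukawa hω, Real.fourier_eq',
    Real.fourier_eq', Real.fourier_eq']
  have hint : ∀ f : R3 → ℝ, Integrable f → Integrable fun v : R3 =>
      Complex.exp (↑(-2 * π * inner ℝ v p) * Complex.I) • (f v : ℂ) := by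
    intro f hf
    refine (integrable_exp_smul hf (fun v => -2 * π * inner ℝ v p) (by fun_prop)).congr
      (Eventually.of_forall fun v => ?_)
    simp only [smul_eq_mul, mul_comm]
  rw [← integral_sub (hint _ hi1) (hint _ hi2)]
  refine integral_congr_ae ?_
  filter_upwards [yukawaDiff_ae_eq (χ := χ) ν ω] with z hz
  rw [hz]
  push_cast
  simp only [smul_eq_mul]
  ring

/-- Test with unit charges at `z` and `0`, of opposite or of equal sign. -/
lemma abs_le_of_positiveType {f : R3 → ℝ} (hf : Measurable f) (hP : PositiveType f)
    (z : R3) : |f z| ≤ f 0 := by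
  have hm : Measurable fun p : R3 × R3 => f (p.1 - p.2) :=
    hf.comp (measurable_fst.sub measurable_snd)
  have hd : ∀ a b : R3, mutualEnergy f (Measure.dirac a) (Measure.dirac b) = f (a - b) := by
    intro a b
    rw [mutualEnergy, Measure.dirac_prod_dirac, integral_dirac' _ _ hm.stronglyMeasurable]
  have h1 := hP (Measure.dirac z) (Measure.dirac 0) 1
  have h2 := hP (Measure.dirac z) (Measure.dirac 0) (-1)
  simp only [hd, sub_self, sub_zero] at h1 h2
  exact abs_le.2 ⟨by linarith, by linarith⟩

/-- A symmetric double sum consists of twice the sum over all pairs and the diagonal. -/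
lemma sum_sum_eq_two_mul_add {n : ℕ} {f : Fin n → Fin n → ℝ} (hf : ∀ i j, f i j = f j i) :
    ∑ i, ∑ j, f i j = 2 * (∑ i, ∑ j ∈ Finset.Ioi i, f i j) + ∑ i, f i i := by
  have hsplit : ∀ i : Fin n, ∑ j, f i j
      = (∑ j ∈ Finset.Ioi i, f i j) + (∑ j ∈ Finset.Iio i, f i j) + f i i := by
    intro i
    have hu : (Finset.univ : Finset (Fin n)) = (Finset.Ioi i ∪ Finset.Iio i) ∪ {i} := by
      ext j
      simp only [Finset.mem_univ, Finset.mem_union, Finset.mem_Ioi, Finset.mem_Iio,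
        Finset.mem_singleton, true_iff]
      rcases lt_trichotomy i j with h | h | h <;> simp [h]
    rw [hu, Finset.sum_union, Finset.sum_union, Finset.sum_singleton]
    · rw [Finset.disjoint_left]
      intro j hj hj'
      rw [Finset.mem_Ioi] at hj
      rw [Finset.mem_Iio] at hj'
      exact absurd hj (not_lt.2 hj'.le)
    · simp
  have hswap : ∑ i, ∑ j ∈ Finset.Iio i, f i j = ∑ i, ∑ j ∈ Finset.Ioi i, f i j := by
    rw [Finset.sum_comm' (t' := Finset.univ) (s' := fun j => Finset.Ioi j) (by simp)]
    exact Finset.sum_congr rfl fun i _ => Finset.sum_congr rfl fun j _ => hf _ _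
  simp_rw [hsplit]
  rw [Finset.sum_add_distrib, Finset.sum_add_distrib, hswap]
  ring

/-- Onsager's lemma: the interaction energy of charges through a function of positive type is
bounded below by minus the self-energy. -/
lemma neg_self_energy_le_potential {f : R3 → ℝ} (hf : Measurable f) (hP : PositiveType f)
    (heven : ∀ z, f (-z) = f z) {Ω : Set R3} (hΩ : volume Ω ≠ ⊤) (ρ : ℝ) {n : ℕ} (x : Config n) :
    -(n * f 0 / 2) ≤ potential (fun a b => f (a - b)) Ω ρ x := by
  have hb := abs_le_of_positiveType hf hP
  have hm : Measurable fun p : R3 × R3 => f (p.1 - p.2) :=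
    hf.comp (measurable_fst.sub measurable_snd)
  have : IsFiniteMeasure (volume.restrict Ω) := isFiniteMeasure_restrict.2 hΩ
  -- Positivity is applied to the point charges against the background. The double sum over the
  -- points counts every pair twice and produces the diagonal `n f 0`.
  set μ : Measure R3 := ∑ i, Measure.dirac (x i) with hμ
  have hfin : IsFiniteMeasure μ := by
    refine ⟨?_⟩
    rw [hμ, Measure.finsetSum_apply]
    simp
  have hint : ∀ (m m' : Measure R3) [IsFiniteMeasure m] [IsFiniteMeasure m'],
      mutualEnergy f m m' = ∫ a, ∫ b, f (a - b) ∂m' ∂m := by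
    intro m m' _ _
    refine integral_prod _ ?_
    exact (integrable_const (f 0)).mono' hm.aestronglyMeasurable (Eventually.of_forall fun p => hb _)
  have hsum : ∀ g : R3 → ℝ, Measurable g → ∫ a, g a ∂μ = ∑ i, g (x i) := by
    intro g hg
    rw [hμ, integral_finsetSum_measure fun i _ => integrable_dirac' hg.stronglyMeasurable
      (by simp)]
    exact Finset.sum_congr rfl fun i _ => integral_dirac' _ _ hg.stronglyMeasurable
  have h := hP μ (volume.restrict Ω) ρ
  have hma : ∀ a : R3, Measurable fun b => f (a - b) := fun a => hm.comp measurable_prodMk_left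
  have hmb : ∀ b : R3, Measurable fun a => f (a - b) := fun b => hm.comp measurable_prodMk_right
  have hms : Measurable fun a => ∫ b in Ω, f (a - b) :=
    (hm.stronglyMeasurable.integral_prod_right (ν := volume.restrict Ω)).measurable
  rw [hint, hint, hint, hsum (fun a => ∫ b in Ω, f (a - b)) hms] at h
  have e1 : ∫ a, ∫ b, f (a - b) ∂μ ∂μ = ∑ i, ∑ j, f (x i - x j) := by
    have : ∀ a, ∫ b, f (a - b) ∂μ = ∑ j, f (a - x j) := fun a => hsum _ (hma a)
    simp_rw [this]
    exact hsum (fun a => ∑ j, f (a - x j)) (Finset.measurable_fun_sum _ fun j _ => hmb (x j))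
  have e2 : ∑ i, ∑ j, f (x i - x j)
      = 2 * (∑ i, ∑ j ∈ Finset.Ioi i, f (x i - x j)) + n * f 0 := by
    rw [sum_sum_eq_two_mul_add fun i j => by rw [← heven, neg_sub]]
    simp
  rw [e1, e2] at h
  unfold potential
  linarith

end RegularizedDifference

/-! ### The choice of `ω(t)`. -/

section MomentCondition

open Set Filter Topology Real

variable {B : ℕ → ℝ} {t : ℝ} {χ : R3 → ℝ}

/-- The constant in `ω(t) = c t⁻⁴`. -/
def omegaConst (B : ℕ → ℝ) : ℝ := 8 * (4 + 52 * (288 * max (B 1) 1 ^ 3 * B 2 ^ 2))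

lemma one_le_omegaConst (B : ℕ → ℝ) : 1 ≤ omegaConst B := by
  have h : 0 ≤ max (B 1) 1 := le_trans zero_le_one (le_max_right _ _)
  have : 0 ≤ 288 * max (B 1) 1 ^ 3 * B 2 ^ 2 := by positivity
  unfold omegaConst
  linarith

lemma one_le_omega (B : ℕ → ℝ) (ht0 : 0 < t) (ht : t < 1 / 2) :
    1 ≤ omegaConst B * (t ^ 4)⁻¹ := by
  have h1 : 1 ≤ (t ^ 4)⁻¹ := (one_le_inv₀ (by positivity)).2 (pow_le_one₀ ht0.le (by linarith))
  exact one_le_mul_of_one_le_of_one_le (one_le_omegaConst B) h1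

/-- With `r = 4π²|q|²`, the left side is at most `4 + 52 ∫ r²`, where `4r ≤ 4 + 4r²` and `ω ≥ 1`
were used. The fourth moment is `O(t⁻⁷)`: `t⁻³` from `γ` and `t⁻⁴` from two second derivatives. This
is below `ω² ∼ t⁻⁸`, and `omegaConst` is the resulting constant. -/
lemma IsCutoff.moment_condition (hχ : IsCutoff B t χ) (ht0 : 0 < t) (ht : t < 1 / 2) :
    ∫ q, hχ.dens q * (4 * (4 * π ^ 2 * ‖q‖ ^ 2)
        + 48 * (4 * π ^ 2 * ‖q‖ ^ 2) ^ 2 / (omegaConst B * (t ^ 4)⁻¹) ^ 2)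
      ≤ (omegaConst B * (t ^ 4)⁻¹) ^ 2 / 8 := by
  set ω := omegaConst B * (t ^ 4)⁻¹ with hω
  have hω1 : 1 ≤ ω := one_le_omega B ht0 ht
  set m : ℝ := ∫ q, (2 * π) ^ 4 * (‖q‖ ^ 4 * hχ.dens q)
  set M : ℝ := 288 * max (B 1) 1 ^ 3 * B 2 ^ 2 with hM
  have hb : 0 ≤ max (B 1) 1 := le_trans zero_le_one (le_max_right _ _)
  have hM0 : 0 ≤ M := by positivity
  have hm : m ≤ M * (t ^ 7)⁻¹ := by
    refine (hχ.fourth_moment_le ht0 ht).trans ?_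
    calc 9 * gam χ * (B 2 * (t ^ 2)⁻¹) ^ 2
        ≤ 9 * (32 * max (B 1) 1 ^ 3 * (t ^ 3)⁻¹) * (B 2 * (t ^ 2)⁻¹) ^ 2 := by
          gcongr
          exact hχ.gam_le_of_deriv ht0 ht
      _ = M * (t ^ 7)⁻¹ := by rw [hM]; field_simp; ring
  have h4 := hχ.integrable_pow_mul_dens 4
  have h2 := hχ.integrable_pow_mul_dens 2
  have h1 : ∫ q, hχ.dens q * (4 * (4 * π ^ 2 * ‖q‖ ^ 2)
        + 48 * (4 * π ^ 2 * ‖q‖ ^ 2) ^ 2 / ω ^ 2)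
      ≤ ∫ q, (4 * hχ.dens q + 52 * ((2 * π) ^ 4 * (‖q‖ ^ 4 * hχ.dens q))) := by
    refine integral_mono ?_ ((hχ.integrable_dens.const_mul 4).add ((h4.const_mul _).const_mul 52))
      fun q => ?_
    · refine ((h2.const_mul (16 * π ^ 2)).add (h4.const_mul (768 * π ^ 4 / ω ^ 2))).congr
        (Eventually.of_forall fun q => ?_)
      simp only [Pi.add_apply]; ring
    · have hd := hχ.dens_nonneg ht q
      set r := 4 * π ^ 2 * ‖q‖ ^ 2
      have h3 : 48 * r ^ 2 / ω ^ 2 ≤ 48 * r ^ 2 :=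
        div_le_self (by positivity) (one_le_pow₀ hω1)
      have h5 : 4 * r ≤ 4 + 4 * r ^ 2 := by nlinarith [sq_nonneg (2 * r - 1)]
      have h6 : (2 * π) ^ 4 * ‖q‖ ^ 4 = r ^ 2 := by simp only [r]; ring
      calc hχ.dens q * (4 * r + 48 * r ^ 2 / ω ^ 2)
          ≤ hχ.dens q * (4 + 52 * r ^ 2) :=
            mul_le_mul_of_nonneg_left (by linarith) hd
        _ = _ := by rw [← h6]; ring
  refine h1.trans ?_
  rw [integral_add (hχ.integrable_dens.const_mul 4) ((h4.const_mul _).const_mul 52),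
    integral_const_mul, integral_const_mul, hχ.integral_dens ht]
  have h7 : 1 ≤ (t ^ 7)⁻¹ := (one_le_inv₀ (by positivity)).2 (pow_le_one₀ ht0.le (by linarith))
  have h8 : (t ^ 7)⁻¹ ≤ ((t ^ 4)⁻¹) ^ 2 := by
    have : ((t ^ 4)⁻¹) ^ 2 = (t ^ 8)⁻¹ := by rw [inv_pow, ← pow_mul]
    rw [this]
    exact inv_anti₀ (by positivity) (pow_le_pow_of_le_one ht0.le (by linarith) (by norm_num))
  have h9 : omegaConst B ≤ omegaConst B ^ 2 := by nlinarith [one_le_omegaConst B]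
  have h10 : omegaConst B = 8 * (4 + 52 * M) := rfl
  calc 4 * 1 + 52 * m ≤ 4 * (t ^ 7)⁻¹ + 52 * (M * (t ^ 7)⁻¹) := by gcongr
    _ = omegaConst B * (t ^ 7)⁻¹ / 8 := by rw [h10]; ring
    _ ≤ omegaConst B ^ 2 * ((t ^ 4)⁻¹) ^ 2 / 8 := by gcongr
    _ = ω ^ 2 / 8 := by rw [hω, mul_pow]

end MomentCondition

/-! ### The sliding estimate for the Coulomb energy. -/

section Sliding

open Set Filter Topology Real

variable {B : ℕ → ℝ} {t : ℝ} {χ : R3 → ℝ}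

/-! ### Summation over the lattice -/

/-- The half-open unit cube centred at the lattice point `k`. -/
def unitCell (k : Fin 3 → ℤ) : Set R3 := {x | ∀ i, (k i : ℝ) - 1 / 2 ≤ x i ∧ x i < k i + 1 / 2}

lemma measurableSet_unitCell (k : Fin 3 → ℤ) : MeasurableSet (unitCell k) := by
  unfold unitCell
  simp only [ofPred_forall]
  refine MeasurableSet.iInter fun i => ?_
  have h : Measurable fun x : R3 => x i := by fun_prop
  exact (measurableSet_le measurable_const h).inter (measurableSet_lt h measurable_const)

lemma pairwise_disjoint_unitCell : Pairwise (Function.onFun Disjoint unitCell) := by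
  intro k l hkl
  refine Set.disjoint_left.2 fun x hx hx' => hkl (funext fun i => ?_)
  have h1 := hx i
  have h2 := hx' i
  have h3 : (k i : ℝ) < l i + 1 := by linarith [h1.1, h2.2]
  have h4 : (l i : ℝ) < k i + 1 := by linarith [h2.1, h1.2]
  have h5 : k i < l i + 1 := by exact_mod_cast h3
  have h6 : l i < k i + 1 := by exact_mod_cast h4
  omega

lemma iUnion_unitCell : ⋃ k, unitCell k = univ := by
  refine eq_univ_of_forall fun x => mem_iUnion.2 ⟨fun i => ⌊x i + 1 / 2⌋, fun i => ?_⟩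
  have h1 := Int.floor_le (x i + 1 / 2)
  have h2 := Int.lt_floor_add_one (x i + 1 / 2)
  constructor <;> linarith

lemma unitCell_zero_ae_eq : (unitCell 0 : Set R3) =ᵐ[volume] cube (-1 / 2) (1 / 2) := by
  have hsub : unitCell 0 ⊆ cube (-1 / 2) (1 / 2) := by
    intro x hx i
    have := hx i
    simp only [Pi.zero_apply, Int.cast_zero] at this
    constructor <;> linarith [this.1, this.2]
  refine LE.le.eventuallyLE hsub |>.antisymm ?_
  have hN : volume (⋃ i : Fin 3, {x : R3 | x i = 1 / 2}) = 0 := by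
    rw [measure_iUnion_null_iff]
    intro i
    have h1 : {x : R3 | x i = 1 / 2} = WithLp.ofLp ⁻¹' {x : Fin 3 → ℝ | x i = 1 / 2} := rfl
    have hm : MeasurableSet {x : Fin 3 → ℝ | x i = 1 / 2} :=
      measurableSet_eq_fun (measurable_pi_apply i) measurable_const
    rw [h1, (PiLp.volume_preserving_ofLp (Fin 3)).measure_preimage hm.nullMeasurableSet]
    exact Measure.pi_hyperplane (fun _ : Fin 3 => (volume : Measure ℝ)) i (1 / 2)
  rw [← compl_mem_ae_iff] at hN
  filter_upwards [hN] with x hx hxc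
  simp only [mem_compl_iff, mem_iUnion, not_exists] at hx
  intro i
  have h1 := hxc i
  have h2 : x i ≠ 1 / 2 := hx i
  simp only [Pi.zero_apply, Int.cast_zero]
  exact ⟨by linarith [h1.1], lt_of_le_of_ne (by linarith [h1.2]) (by simpa using h2)⟩

lemma setIntegral_unitCell (h : R3 → ℝ) (k : Fin 3 → ℤ) :
    ∫ u in unitCell k, h u = ∫ μ in cube (-1 / 2) (1 / 2), h (μ + latticePoint k) := by
  have hpre : (fun μ : R3 => μ + latticePoint k) ⁻¹' unitCell k = unitCell 0 := by
    ext x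
    simp only [unitCell, mem_preimage, mem_ofPred_eq, PiLp.add_apply, latticePoint, Pi.zero_apply,
      Int.cast_zero]
    refine forall_congr' fun i => ?_
    constructor <;> rintro ⟨h1, h2⟩ <;> constructor <;> linarith
  rw [← setIntegral_congr_set unitCell_zero_ae_eq, ← hpre]
  exact ((measurePreserving_add_right volume (latticePoint k)).setIntegral_preimage_emb
    (measurableEmbedding_addRight _) h (unitCell k)).symm

/-- The half-open unit cells partition space; replacing them by closed cubes changes only null sets.
-/
lemma hasSum_lattice {h : R3 → ℝ} (hi : Integrable h) :
    HasSum (fun k : Fin 3 → ℤ => ∫ μ in cube (-1 / 2) (1 / 2), h (μ + latticePoint k))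
      (∫ u, h u) := by
  have := hasSum_integral_iUnion (μ := (volume : Measure R3)) (f := h)
    (fun k : Fin 3 → ℤ => measurableSet_unitCell k)
    pairwise_disjoint_unitCell hi.integrableOn
  rw [iUnion_unitCell, setIntegral_univ] at this
  simpa only [setIntegral_unitCell] using this

/-! ### The sliding average of the localized interaction -/

variable {ω ℓ : ℝ}

/-- The average of the localized interaction over all positions of the box, multiplied by `γ`. -/
def slideAverage (χ : R3 → ℝ) (ω ℓ : ℝ) (x y : R3) : ℝ :=
  corr χ (ℓ⁻¹ • (x - y)) * yukawa (ω / ℓ) (x - y)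

lemma yukawa_le_coulomb {ν : ℝ} (hν : 0 ≤ ν) (x y : R3) : yukawa ν (x - y) ≤ coulomb x y := by
  unfold yukawa coulomb
  refine mul_le_of_le_one_right (by positivity) (Real.exp_le_one_iff.2 ?_)
  have := norm_nonneg (x - y)
  nlinarith

lemma locYukawa_nonneg (hχ : IsCutoff B t χ) (x y : R3) : 0 ≤ locYukawa χ ω ℓ x y :=
  mul_nonneg (mul_nonneg (hχ.nonneg _) (yukawa_nonneg _ _)) (hχ.nonneg _)

lemma coulombBounded_slide_locYukawa (hχ : IsCutoff B t χ) (hω : 0 ≤ ω) (hℓ : 0 < ℓ) (s : R3) :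
    CoulombBounded (slide (locYukawa χ ω ℓ) s) := by
  have hm := hχ.continuous.measurable
  have hy := measurable_yukawa (ω / ℓ)
  constructor
  · simp only [Function.uncurry_def, slide, locYukawa]; fun_prop
  · intro x y
    rw [slide, abs_of_nonneg (locYukawa_nonneg hχ _ _), locYukawa, add_sub_add_right_eq_sub]
    have h1 := yukawa_le_coulomb (div_nonneg hω hℓ.le) x y
    have h2 := yukawa_nonneg (ω / ℓ) (x - y)
    calc χ (ℓ⁻¹ • (x + s)) * yukawa (ω / ℓ) (x - y) * χ (ℓ⁻¹ • (y + s))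
        ≤ 1 * yukawa (ω / ℓ) (x - y) * 1 := by
          gcongr
          · exact hχ.nonneg _
          · exact hχ.le_one _
          · exact hχ.le_one _
      _ ≤ coulomb x y := by linarith

lemma coulombBounded_locYukawa (hχ : IsCutoff B t χ) (hω : 0 ≤ ω) (hℓ : 0 < ℓ) :
    CoulombBounded (locYukawa χ ω ℓ) := by
  have h : slide (locYukawa χ ω ℓ) 0 = locYukawa χ ω ℓ := by
    funext x y; rw [slide, add_zero, add_zero]
  exact h ▸ coulombBounded_slide_locYukawa hχ hω hℓ (0 : R3)

lemma coulombBounded_slideAverage (hχ : IsCutoff B t χ) (ht : t < 1 / 2) (hω : 0 ≤ ω)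
    (hℓ : 0 < ℓ) : CoulombBounded (slideAverage χ ω ℓ) := by
  have hm := (hχ.continuous_corr ht).measurable
  have hy := measurable_yukawa (ω / ℓ)
  constructor
  · simp only [Function.uncurry_def, slideAverage]; fun_prop
  · intro x y
    rw [slideAverage, abs_of_nonneg (mul_nonneg (corr_nonneg hχ ht _) (yukawa_nonneg _ _))]
    refine le_trans ?_ (yukawa_le_coulomb (div_nonneg hω hℓ.le) x y)
    exact mul_le_of_le_one_left (yukawa_nonneg _ _) (by linarith [(hχ.one_sub_corr ht
      (ℓ⁻¹ • (x - y))).1])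

lemma slide_locYukawa_eq (hℓ : 0 < ℓ) (u x y : R3) :
    slide (locYukawa χ ω ℓ) (ℓ • u) x y
      = yukawa (ω / ℓ) (x - y) * (χ (ℓ⁻¹ • x + u) * χ (ℓ⁻¹ • y + u)) := by
  have e : ∀ z : R3, ℓ⁻¹ • (z + ℓ • u) = ℓ⁻¹ • z + u := fun z => by
    rw [smul_add, smul_smul, inv_mul_cancel₀ hℓ.ne', one_smul]
  rw [slide, locYukawa, add_sub_add_right_eq_sub, e, e]; ring

lemma integrable_slide_locYukawa (hχ : IsCutoff B t χ) (hℓ : 0 < ℓ) (x y : R3) :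
    Integrable fun u => slide (locYukawa χ ω ℓ) (ℓ • u) x y := by
  simp_rw [slide_locYukawa_eq hℓ]
  refine Integrable.const_mul ?_ _
  have hc := hχ.continuous
  have h1 : Integrable fun u => χ (ℓ⁻¹ • x + u) := hχ.integrable.comp_add_left (ℓ⁻¹ • x)
  refine h1.mul_bdd (c := 1) (by fun_prop : Continuous _).aestronglyMeasurable
    (Eventually.of_forall fun u => ?_)
  rw [Real.norm_of_nonneg (hχ.nonneg _)]
  exact hχ.le_one _

/-- The Yukawa factor depends only on `x - y` and leaves the integral; the two cutoffs integrate to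
the autocorrelation at `(x - y)/ℓ`. -/
lemma gam_mul_integral_slide (hℓ : 0 < ℓ) (x y : R3) :
    gam χ * ∫ u, slide (locYukawa χ ω ℓ) (ℓ • u) x y = slideAverage χ ω ℓ x y := by
  simp_rw [slide_locYukawa_eq hℓ]
  rw [integral_const_mul, slideAverage, corr]
  have : ∫ u, χ (ℓ⁻¹ • x + u) * χ (ℓ⁻¹ • y + u) = ∫ v, χ (v + ℓ⁻¹ • (x - y)) * χ v := by
    rw [← integral_add_left_eq_self (fun v => χ (v + ℓ⁻¹ • (x - y)) * χ v) (ℓ⁻¹ • y)]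
    refine integral_congr_ae (Eventually.of_forall fun u => ?_)
    simp only
    congr 2
    rw [smul_sub]; abel
  rw [this]; ring

lemma integral_slide_eq (hχ : IsCutoff B t χ) (ht : t < 1 / 2) (hℓ : 0 < ℓ) (x y : R3) :
    ∫ u, slide (locYukawa χ ω ℓ) (ℓ • u) x y = (gam χ)⁻¹ * slideAverage χ ω ℓ x y := by
  rw [← gam_mul_integral_slide hℓ, inv_mul_cancel_left₀ (hχ.gam_pos ht).ne']

lemma measurable_slide_uncurry (hχ : IsCutoff B t χ) :
    Measurable fun p : (R3 × R3) × R3 => slide (locYukawa χ ω ℓ) (ℓ • p.2) p.1.1 p.1.2 := by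
  have hm := hχ.continuous.measurable
  have hy := measurable_yukawa (ω / ℓ)
  simp only [slide, locYukawa]; fun_prop

/-- A general measure `m` serves both background terms at once: a point mass times the background,
and the background times itself. -/
lemma integrable_slide_prod (hχ : IsCutoff B t χ) (ht : t < 1 / 2) (hℓ : 0 < ℓ)
    {m : Measure (R3 × R3)} [SFinite m]
    (hm : Integrable (Function.uncurry (slideAverage χ ω ℓ)) m) :
    Integrable (Function.uncurry fun (z : R3 × R3) (u : R3) =>
      slide (locYukawa χ ω ℓ) (ℓ • u) z.1 z.2) (m.prod volume) := by
  have hmeas : Measurable (Function.uncurry fun (z : R3 × R3) (u : R3) =>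
      slide (locYukawa χ ω ℓ) (ℓ • u) z.1 z.2) := measurable_slide_uncurry hχ
  have hnorm : ∀ z : R3 × R3, ∫ u, ‖slide (locYukawa χ ω ℓ) (ℓ • u) z.1 z.2‖
      = (gam χ)⁻¹ * Function.uncurry (slideAverage χ ω ℓ) z := by
    intro z
    refine Eq.trans ?_ (integral_slide_eq hχ ht hℓ z.1 z.2)
    congr 1
    funext u
    exact Real.norm_of_nonneg (locYukawa_nonneg hχ _ _)
  refine (integrable_prod_iff hmeas.aestronglyMeasurable).2 ⟨Eventually.of_forall fun z =>
    integrable_slide_locYukawa hχ hℓ z.1 z.2, ?_⟩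
  exact (hm.const_mul (gam χ)⁻¹).congr (Eventually.of_forall fun z => (hnorm z).symm)

variable {Ω : Set R3}

/-- The slid potential energy, averaged over all positions of the box. -/
lemma integral_potential_slide (hχ : IsCutoff B t χ) (ht : t < 1 / 2) (hω : 0 ≤ ω) (hℓ : 0 < ℓ)
    (hΩ : volume Ω ≠ ⊤) (ρ : ℝ) {n : ℕ} (x : Config n) :
    Integrable (fun u => potential (slide (locYukawa χ ω ℓ) (ℓ • u)) Ω ρ x) ∧
      gam χ * ∫ u, potential (slide (locYukawa χ ω ℓ) (ℓ • u)) Ω ρ x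
        = potential (slideAverage χ ω ℓ) Ω ρ x := by
  have hK := coulombBounded_slideAverage (χ := χ) hχ ht hω hℓ
  have : IsFiniteMeasure (volume.restrict Ω) := isFiniteMeasure_restrict.2 hΩ
  set s : R3 → R3 → R3 → ℝ := fun u => slide (locYukawa χ ω ℓ) (ℓ • u) with hs
  have hsC : ∀ u, CoulombBounded (s u) := fun u => coulombBounded_slide_locYukawa hχ hω hℓ _
  -- the three contributions
  have h1 : ∀ a b : R3, Integrable fun u => s u a b := fun a b =>
    integrable_slide_locYukawa hχ hℓ a b
  have h2 : ∀ a : R3, Integrable (fun u => ∫ y in Ω, s u a y) ∧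
      gam χ * ∫ u, ∫ y in Ω, s u a y = ∫ y in Ω, slideAverage χ ω ℓ a y := by
    intro a
    have hm : Integrable (Function.uncurry (slideAverage χ ω ℓ))
        ((Measure.dirac a).prod (volume.restrict Ω)) := by
      rw [integrable_prod_iff hK.measurable.aestronglyMeasurable]
      refine ⟨?_, integrable_dirac' ?_ (by simp)⟩
      · exact Eventually.of_forall fun z => hK.integrableOn hΩ z
      · exact hK.measurable.norm.stronglyMeasurable.integral_prod_right
    have hp := integrable_slide_prod hχ ht hℓ hm
    have e : ∀ u, ∫ z, s u z.1 z.2 ∂((Measure.dirac a).prod (volume.restrict Ω))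
        = ∫ y in Ω, s u a y := by
      intro u
      rw [Measure.dirac_prod, integral_map (by fun_prop)]
      exact (hsC u).measurable.aestronglyMeasurable
    constructor
    · refine hp.integral_prod_right.congr (Eventually.of_forall fun u => ?_)
      exact e u
    · have h3 := integral_integral_swap hp
      have h4 : ∫ u, ∫ y in Ω, s u a y
          = ∫ z, (∫ u, s u z.1 z.2) ∂((Measure.dirac a).prod (volume.restrict Ω)) := by
        rw [h3]
        exact integral_congr_ae (Eventually.of_forall fun u => (e u).symm)
      rw [h4, ← integral_const_mul]
      simp only [hs, gam_mul_integral_slide hℓ]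
      rw [Measure.dirac_prod, integral_map (by fun_prop)]
      exact hK.measurable.aestronglyMeasurable
  have h3 : Integrable (fun u => ∫ y in Ω, ∫ z in Ω, s u y z) ∧
      gam χ * ∫ u, ∫ y in Ω, ∫ z in Ω, s u y z
        = ∫ y in Ω, ∫ z in Ω, slideAverage χ ω ℓ y z := by
    have hm := hK.integrable_prod hΩ hΩ
    have hp := integrable_slide_prod hχ ht hℓ hm
    have e : ∀ u, ∫ z, s u z.1 z.2 ∂((volume.restrict Ω).prod (volume.restrict Ω))
        = ∫ y in Ω, ∫ z in Ω, s u y z := fun u => integral_prod _ ((hsC u).integrable_prod hΩ hΩ)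
    constructor
    · exact hp.integral_prod_right.congr (Eventually.of_forall fun u => e u)
    · have h3 := integral_integral_swap hp
      have h4 : ∫ u, ∫ y in Ω, ∫ z in Ω, s u y z
          = ∫ z, (∫ u, s u z.1 z.2) ∂((volume.restrict Ω).prod (volume.restrict Ω)) := by
        rw [h3]
        exact integral_congr_ae (Eventually.of_forall fun u => (e u).symm)
      rw [h4, ← integral_const_mul]
      simp only [hs, gam_mul_integral_slide hℓ]
      exact integral_prod _ hm
  have i1 : Integrable fun u => ∑ i, ∑ j ∈ Finset.Ioi i, s u (x i) (x j) :=
    integrable_finsetSum _ fun i _ => integrable_finsetSum _ fun j _ => h1 _ _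
  have i2 : Integrable fun u => ρ * ∑ j, ∫ y in Ω, s u (x j) y :=
    (integrable_finsetSum _ fun j _ => (h2 (x j)).1).const_mul ρ
  have i3 : Integrable fun u => 1 / 2 * ρ ^ 2 * ∫ y in Ω, ∫ z in Ω, s u y z :=
    h3.1.const_mul _
  have i12 : Integrable fun u => (∑ i, ∑ j ∈ Finset.Ioi i, s u (x i) (x j))
      - ρ * ∑ j, ∫ y in Ω, s u (x j) y := i1.sub i2
  refine ⟨i12.add i3, ?_⟩
  unfold potential
  rw [integral_add i12 i3, integral_sub i1 i2, integral_const_mul, integral_const_mul,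
    integral_finsetSum _ fun j _ => (h2 (x j)).1,
    integral_finsetSum _ fun i _ => integrable_finsetSum _ fun j _ => h1 _ _]
  simp_rw [integral_finsetSum _ fun j _ => h1 _ _]
  have e1 : gam χ * ∑ i, ∑ j ∈ Finset.Ioi i, ∫ u, s u (x i) (x j)
      = ∑ i, ∑ j ∈ Finset.Ioi i, slideAverage χ ω ℓ (x i) (x j) := by
    simp only [Finset.mul_sum, hs, gam_mul_integral_slide hℓ]
  have e2 : gam χ * ∑ j, ∫ u, ∫ y in Ω, s u (x j) y
      = ∑ j, ∫ y in Ω, slideAverage χ ω ℓ (x j) y := by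
    rw [Finset.mul_sum]
    exact Finset.sum_congr rfl fun j _ => (h2 (x j)).2
  rw [← e1, ← e2, ← h3.2]
  ring

/-- At coinciding points the formal values of `coulomb` and `yukawa` at zero distance differ from
the regularized ones. Distinct particles never see the diagonal, and for the background it is a null
set. -/
lemma potential_congr_of_injective {v v' : R3 → R3 → ℝ} (h : ∀ a b, a ≠ b → v a b = v' a b)
    (Ω : Set R3) (ρ : ℝ) {n : ℕ} {x : Config n} (hx : Function.Injective x) :
    potential v Ω ρ x = potential v' Ω ρ x := by
  have h1 : ∀ a, ∫ y in Ω, v a y = ∫ y in Ω, v' a y := by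
    intro a
    refine integral_congr_ae (ae_restrict_of_ae ?_)
    have : ∀ᵐ y : R3, y ≠ a := by simp [ae_iff]
    filter_upwards [this] with y hy using h a y hy.symm
  unfold potential
  simp only [h1]
  congr 2
  refine Finset.sum_congr rfl fun i _ => Finset.sum_congr rfl fun j hj => h _ _ fun e => ?_
  exact absurd (hx e) (ne_of_lt (Finset.mem_Ioi.1 hj))

lemma coulomb_sub_yukawa_le {ν : ℝ} (hν : 0 ≤ ν) (x y : R3) :
    coulomb x y - yukawa ν (x - y) ≤ ν := by
  unfold coulomb yukawa
  set r := ‖x - y‖ with hr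
  have hr0 : 0 ≤ r := norm_nonneg _
  rcases eq_or_lt_of_le hr0 with h | h
  · rw [← h]; simpa using hν
  · have h1 := Real.add_one_le_exp (-ν * r)
    have h2 : r⁻¹ - r⁻¹ * rexp (-ν * r) = r⁻¹ * (1 - rexp (-ν * r)) := by ring
    rw [h2, inv_mul_le_iff₀ h]
    linarith

/-- The sliding estimate. -/
theorem slideAverage_le_potential (hχ : IsCutoff B t χ) (ht0 : 0 < t) (ht : t < 1 / 2)
    (hℓ : 0 < ℓ) (hω : ω = omegaConst B * (t ^ 4)⁻¹) (hΩ : volume Ω ≠ ⊤) {ρ : ℝ} (hρ : 0 ≤ ρ)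
    {n : ℕ} {x : Config n} (hx : Function.Injective x) :
    potential (slideAverage χ ω ℓ) Ω ρ x - ω * n / (2 * ℓ) ≤ potential coulomb Ω ρ x := by
  have hω1 : 1 ≤ ω := by rw [hω]; exact one_le_omega B ht0 ht
  have hω0 : 0 < ω := by linarith
  have hmom := hχ.moment_condition ht0 ht
  rw [← hω] at hmom
  have hK := coulombBounded_slideAverage (χ := χ) hχ ht hω0.le hℓ
  set D := ρ * (n * volume.real Ω) with hD
  -- Onsager's lemma needs a positive mass. With `ω ≥ 1`, the restriction `ν ≤ 1/2` guarantees `ν² ≤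
  -- ω²/2`.
  have hbound : ∀ ν : ℝ, 0 < ν → ν ≤ 1 / 2 →
      potential (slideAverage χ ω ℓ) Ω ρ x - ω * n / (2 * ℓ) - ν / ℓ * D
        ≤ potential coulomb Ω ρ x := by
    intro ν hν hν2
    have hνω : ν ^ 2 ≤ ω ^ 2 / 2 := by nlinarith
    have hP := positiveType_yukawaDiff hχ ht hω0 hν hνω hmom
    have hmeas := (continuous_yukawaDiff (χ := χ) (ν := ν) hχ ht hω0.le).measurable
    -- Scaling to length `ℓ` uses `Y_{a/ℓ}(z) = ℓ⁻¹ Y_a(z/ℓ)`; the value at the origin becomes `(ω -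
    -- ν)/ℓ`.
    let f : R3 → ℝ := fun z => ℓ⁻¹ * yukawaDiff χ ν ω (ℓ⁻¹ • z)
    have hf : PositiveType f := (hP.comp_smul hmeas ℓ⁻¹).const_mul (inv_nonneg.2 hℓ.le)
    have hfm : Measurable f :=
      (hmeas.comp (measurable_const_smul ℓ⁻¹)).const_mul ℓ⁻¹
    have hfe : ∀ z, f (-z) = f z := fun z => by simp only [f, smul_neg, yukawaDiff_neg]
    have h1 := neg_self_energy_le_potential hfm hf hfe hΩ ρ x
    have hf0 : f 0 = ℓ⁻¹ * (ω - ν) := by simp only [f, smul_zero, yukawaDiff_zero]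
    have hνℓ : 0 ≤ ν / ℓ := by positivity
    let Yν : R3 → R3 → ℝ := fun a b => yukawa (ν / ℓ) (a - b)
    have hY : CoulombBounded Yν := by
      have hy := measurable_yukawa (ν / ℓ)
      refine ⟨by simp only [Function.uncurry_def, Yν]; fun_prop, fun a b => ?_⟩
      rw [abs_of_nonneg (yukawa_nonneg _ _)]
      exact yukawa_le_coulomb hνℓ a b
    have hyscale : ∀ (a : ℝ) (z : R3), yukawa (a / ℓ) z = ℓ⁻¹ * yukawa a (ℓ⁻¹ • z) := by
      intro a z
      simp only [yukawa, norm_smul, norm_inv, Real.norm_of_nonneg hℓ.le, mul_inv, inv_inv]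
      rw [← mul_assoc, ← mul_assoc, inv_mul_cancel₀ hℓ.ne', one_mul]
      congr 2
      ring
    have h2 : potential (fun a b => f (a - b)) Ω ρ x
        = potential (fun a b => Yν a b - slideAverage χ ω ℓ a b) Ω ρ x := by
      refine potential_congr_of_injective (fun a b hab => ?_) Ω ρ hx
      have hne : ℓ⁻¹ • (a - b) ≠ 0 := smul_ne_zero (inv_ne_zero hℓ.ne') (sub_ne_zero.2 hab)
      simp only [f, Yν, slideAverage]
      rw [yukawaDiff_of_ne hne, hyscale, hyscale]
      ring
    rw [h2, potential_sub hY hK hΩ, hf0] at h1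
    -- comparison of the Coulomb and Yukawa potentials
    have h3 : potential (fun a b => coulomb a b - Yν a b) Ω ρ x
        = potential coulomb Ω ρ x - potential Yν Ω ρ x :=
      potential_sub coulombBounded_coulomb hY hΩ ρ x
    -- The difference of the kernels lies between `0` and `ν/ℓ`, so only the attraction can be
    -- negative, and it is small with `ν`.
    have h4 : -(ν / ℓ * D) ≤ potential (fun a b => coulomb a b - Yν a b) Ω ρ x := by
      have hnn : ∀ a b, 0 ≤ coulomb a b - Yν a b := fun a b =>
        sub_nonneg.2 (yukawa_le_coulomb hνℓ a b)
      have h5 := pair_sum_nonneg hnn x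
      have h6 := background_nonneg hnn Ω ρ
      have h7 : ∑ j, ∫ y in Ω, (coulomb (x j) y - Yν (x j) y) ≤ n * (ν / ℓ * volume.real Ω) := by
        calc ∑ j, ∫ y in Ω, (coulomb (x j) y - Yν (x j) y)
            ≤ ∑ _j : Fin n, ν / ℓ * volume.real Ω := by
              refine Finset.sum_le_sum fun j _ => ?_
              calc ∫ y in Ω, (coulomb (x j) y - Yν (x j) y) ≤ ∫ y in Ω, ν / ℓ :=
                    integral_mono ((integrableOn_coulomb hΩ _).sub (hY.integrableOn hΩ _))
                      (integrableOn_const hΩ) fun y => coulomb_sub_yukawa_le hνℓ _ _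
                _ = _ := by rw [setIntegral_const, smul_eq_mul, mul_comm]
          _ = _ := by simp
      have h8 := mul_le_mul_of_nonneg_left h7 hρ
      unfold potential
      rw [hD]
      nlinarith
    have h9 : n * (ℓ⁻¹ * (ω - ν)) / 2 ≤ ω * n / (2 * ℓ) := by
      have : ω * n / (2 * ℓ) - n * (ℓ⁻¹ * (ω - ν)) / 2 = n * (ℓ⁻¹ * ν) / 2 := by
        field_simp; ring
      have h10 : 0 ≤ n * (ℓ⁻¹ * ν) / 2 := by positivity
      linarith
    linarith
  have hlim : Tendsto (fun ν : ℝ => potential (slideAverage χ ω ℓ) Ω ρ x - ω * n / (2 * ℓ)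
      - ν / ℓ * D) (𝓝[>] 0) (𝓝 (potential (slideAverage χ ω ℓ) Ω ρ x - ω * n / (2 * ℓ)
      - 0 / ℓ * D)) := by
    refine Tendsto.mono_left (Continuous.tendsto ?_ 0) nhdsWithin_le_nhds
    fun_prop
  rw [zero_div, zero_mul, sub_zero] at hlim
  refine le_of_tendsto hlim ?_
  filter_upwards [Ioo_mem_nhdsGT (show (0 : ℝ) < 1 / 2 by norm_num)] with ν hν
  exact hbound ν hν.1 hν.2.le

end Sliding

/-! ### The sliding average as a sum over the lattice. -/

section Sliding

open Set Filter Topology Real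

variable {B : ℕ → ℝ} {t ω ℓ : ℝ} {χ : R3 → ℝ}

/-- The averages of the slid potential over the unit cells are integrable and summable, and their
sum is the potential of the averaged interaction. -/
lemma slidPotential_lattice (hχ : IsCutoff B t χ) (ht : t < 1 / 2) (hω : 0 ≤ ω) (hℓ : 0 < ℓ)
    (ρ L : ℝ) {N : ℕ} (x : Config N) :
    (∀ k, IntegrableOn (slidPotential χ ω ρ L ℓ x k) (cube (-1 / 2) (1 / 2))) ∧
      (Summable fun k => ∫ μ in cube (-1 / 2) (1 / 2), slidPotential χ ω ρ L ℓ x k μ) ∧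
      gam χ * (∑' k, ∫ μ in cube (-1 / 2) (1 / 2), slidPotential χ ω ρ L ℓ x k μ)
        = potential (slideAverage χ ω ℓ) (cube 0 L) ρ x := by
  obtain ⟨hi, he⟩ := integral_potential_slide hχ ht hω hℓ (volume_cube_lt_top 0 L).ne ρ x
  have hs := hasSum_lattice hi
  refine ⟨fun k => (hi.comp_add_right (latticePoint k)).integrableOn, hs.summable, ?_⟩
  rw [← he, ← hs.tsum_eq]
  rfl

end Sliding

/-! ### Weak differentiability as boundedness of difference quotients in `L²`. -/

section DifferenceQuotients

set_option linter.unusedSectionVars false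

open Set Filter Topology

/-! ### Weak derivatives and difference quotients -/

/-- A functional dominated by the norm of the image under a linear map is represented there by a
vector. -/
lemma exists_inner_eq_of_abs_le {V H : Type*} [AddCommGroup V] [Module ℝ V]
    [NormedAddCommGroup H] [InnerProductSpace ℝ H] [CompleteSpace H] (A : V →ₗ[ℝ] H)
    (T : V →ₗ[ℝ] ℝ) {K : ℝ} (hK : 0 ≤ K) (h : ∀ v, |T v| ≤ K * ‖A v‖) :
    ∃ g : H, ‖g‖ ≤ K ∧ ∀ v, T v = inner ℝ g (A v) := by
  -- The bound makes `T` vanish on the kernel of `A`, so it factors through the range of `A`.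
  -- Hahn–Banach extends the resulting functional and the Riesz theorem represents it.
  have hker : T ∈ (LinearMap.ker A).dualAnnihilator := by
    rw [Submodule.mem_dualAnnihilator]
    intro v hv
    have := h v
    rw [LinearMap.mem_ker.1 hv, norm_zero, mul_zero] at this
    exact abs_nonpos_iff.1 this
  rw [← LinearMap.range_dualMap_eq_dualAnnihilator_ker] at hker
  obtain ⟨S, hS⟩ := hker
  have hSA : ∀ v, S (A v) = T v := fun v => by rw [← hS]; rfl
  let S' : StrongDual ℝ (LinearMap.range A) :=
    (S.comp (LinearMap.range A).subtype).mkContinuous K (by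
      rintro ⟨_, v, rfl⟩
      simpa [hSA] using h v)
  obtain ⟨F, hF, hFn⟩ := exists_extension_norm_eq (LinearMap.range A) S'
  refine ⟨(InnerProductSpace.toDual ℝ H).symm F, ?_, fun v => ?_⟩
  · rw [LinearIsometryEquiv.norm_map, hFn]
    exact LinearMap.mkContinuous_norm_le _ hK _
  · rw [InnerProductSpace.toDual_symm_apply, ← hSA v]
    exact (hF ⟨A v, v, rfl⟩).symm

variable {E : Type*} [NormedAddCommGroup E] [NormedSpace ℝ E] [FiniteDimensional ℝ E]
  [MeasurableSpace E] [BorelSpace E] {μ : Measure E} [μ.IsAddHaarMeasure]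

/-- The smooth functions of compact support. -/
def testFun (E : Type*) [NormedAddCommGroup E] [NormedSpace ℝ E] : Submodule ℝ (E → ℝ) where
  carrier := {f | ContDiff ℝ (⊤ : ℕ∞) f ∧ HasCompactSupport f}
  add_mem' hf hg := ⟨hf.1.add hg.1, hf.2.add hg.2⟩
  zero_mem' := ⟨contDiff_const, HasCompactSupport.zero⟩
  smul_mem' c _ hf := ⟨contDiff_const.smul hf.1, hf.2.smul_left (f := fun _ => c)⟩

lemma memLp_testFun {f : E → ℝ} (hf : f ∈ testFun E) : MemLp f 2 μ :=
  hf.1.continuous.memLp_of_hasCompactSupport hf.2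

lemma fderiv_mem_testFun {f : E → ℝ} (hf : f ∈ testFun E) (v : E) :
    (fun x => fderiv ℝ f x v) ∈ testFun E :=
  ⟨(hf.1.fderiv_right (m := (⊤ : ℕ∞)) (by simp)).clm_apply contDiff_const,
    (hf.2.fderiv (𝕜 := ℝ)).comp_left (g := fun T : E →L[ℝ] ℝ => T v) (by simp)⟩

/-- `g` is the weak derivative of `ψ` in the direction `v`. -/
def HasWeakDeriv (μ : Measure E) (v : E) (ψ g : E → ℝ) : Prop :=
  ∀ f ∈ testFun E, ∫ x, ψ x * fderiv ℝ f x v ∂μ = -∫ x, g x * f x ∂μ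

/-- The embedding of the test functions into `L²`. -/
def testFunToLp (μ : Measure E) [μ.IsAddHaarMeasure] : testFun E →ₗ[ℝ] Lp ℝ 2 μ where
  toFun f := (memLp_testFun f.2).toLp
  map_add' f g := MemLp.toLp_add (memLp_testFun f.2) (memLp_testFun g.2)
  map_smul' c f := MemLp.toLp_const_smul c (memLp_testFun f.2)

lemma inner_testFunToLp (g : Lp ℝ 2 μ) (f : testFun E) :
    inner ℝ g (testFunToLp μ f) = ∫ x, g x * f.1 x ∂μ := by
  rw [L2.inner_def]
  refine integral_congr_ae ?_
  filter_upwards [(memLp_testFun (μ := μ) f.2).coeFn_toLp] with x hx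
  have hx' : testFunToLp μ f x = f.1 x := hx
  rw [hx']
  simp [mul_comm]

lemma norm_sq_toLp {g : E → ℝ} (hg : MemLp g 2 μ) : ‖hg.toLp‖ ^ 2 = ∫ x, g x ^ 2 ∂μ := by
  rw [← real_inner_self_eq_norm_sq, L2.inner_def]
  refine integral_congr_ae ?_
  filter_upwards [hg.coeFn_toLp] with x hx
  rw [hx]
  simp [sq]

lemma integrable_mul_testFun {ψ f : E → ℝ} (hψ : MemLp ψ 2 μ) (hf : f ∈ testFun E) :
    Integrable (fun x => ψ x * f x) μ :=
  MemLp.integrable_mul hψ (memLp_testFun hf)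

/-- Duality: the bound yields a representing vector of norm at most `K`, and test functions separate
it from nothing but `ψ`. -/
lemma norm_le_of_abs_integral_le {ψ : E → ℝ} (hψ : MemLp ψ 2 μ) {K : ℝ} (hK : 0 ≤ K)
    (h : ∀ f : testFun E, |∫ x, ψ x * f.1 x ∂μ| ≤ K * ‖testFunToLp μ f‖) : ‖hψ.toLp‖ ≤ K := by
  let T : testFun E →ₗ[ℝ] ℝ :=
    { toFun f := ∫ x, ψ x * f.1 x ∂μ
      map_add' f g := by
        rw [← integral_add (integrable_mul_testFun hψ f.2) (integrable_mul_testFun hψ g.2)]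
        refine integral_congr_ae (Eventually.of_forall fun x => ?_)
        simp [mul_add]
      map_smul' c f := by
        rw [RingHom.id_apply, smul_eq_mul, ← integral_const_mul]
        refine integral_congr_ae (Eventually.of_forall fun x => ?_)
        simp [mul_left_comm] }
  obtain ⟨g, hgK, hg⟩ := exists_inner_eq_of_abs_le (testFunToLp μ) T hK h
  suffices hψ.toLp = g by rwa [this]
  have hloc : LocallyIntegrable (fun x => ψ x - g x) μ :=
    (hψ.sub (Lp.memLp g)).locallyIntegrable (by norm_num)
  have h0 := ae_eq_zero_of_integral_contDiff_smul_eq_zero hloc fun f hf hc => by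
    have hft : f ∈ testFun E := ⟨hf, hc⟩
    have h1 := hg ⟨f, hft⟩
    rw [inner_testFunToLp] at h1
    have h2 : ∫ x, ψ x * f x ∂μ = ∫ x, g x * f x ∂μ := h1
    rw [← sub_eq_zero, ← integral_sub (integrable_mul_testFun hψ hft)
      (integrable_mul_testFun (Lp.memLp g) hft)] at h2
    rw [← h2]
    refine integral_congr_ae (Eventually.of_forall fun x => ?_)
    simp only [smul_eq_mul]; ring
  refine Lp.ext ?_
  filter_upwards [hψ.coeFn_toLp, h0] with x h1 h2
  rw [h1]; linarith

/-- As a function of the translation this is the convolution of `ψ` with the reflected test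
function, so the derivative falls on the smooth factor. -/
lemma hasDerivAt_integral_translate {ψ f : E → ℝ} (hψ : LocallyIntegrable ψ μ)
    (hf : f ∈ testFun E) (v : E) (s : ℝ) :
    HasDerivAt (fun r : ℝ => ∫ x, ψ x * f (x - r • v) ∂μ)
      (-∫ x, ψ x * fderiv ℝ f (x - s • v) v ∂μ) s := by
  let f' : E → ℝ := fun x => f (-x)
  have hf' : ContDiff ℝ 1 f' := (hf.1.of_le (by simp)).comp contDiff_neg
  have hc' : HasCompactSupport f' := hf.2.comp_homeomorph (Homeomorph.neg E)
  have h1 := hc'.hasFDerivAt_convolution_right (ContinuousLinearMap.mul ℝ ℝ) hψ hf' (s • v)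
  have h2 : HasDerivAt (fun r : ℝ => r • v) v s := by
    simpa using (hasDerivAt_id s).smul_const v
  have h3 := h1.comp_hasDerivAt s h2
  rw [convolution_precompR_apply _ hψ (hc'.fderiv ℝ) (hf'.continuous_fderiv one_ne_zero)] at h3
  have e1 : (-∫ x, ψ x * fderiv ℝ f (x - s • v) v ∂μ)
      = (convolution ψ (fun a => fderiv ℝ f' a v) (ContinuousLinearMap.mul ℝ ℝ) μ) (s • v) := by
    rw [convolution_def, ← integral_neg]
    refine integral_congr_ae (Eventually.of_forall fun x => ?_)
    have : fderiv ℝ f' (s • v - x) = -fderiv ℝ f (x - s • v) := by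
      have h4 : DifferentiableAt ℝ f (-(s • v - x)) := hf.1.differentiable (by simp) _
      have h5 := h4.hasFDerivAt.comp (s • v - x) (hasFDerivAt_id (𝕜 := ℝ) (s • v - x)).neg
      rw [neg_sub] at h5
      refine h5.fderiv.trans ?_
      ext w; simp
    simp only [ContinuousLinearMap.mul_apply', this, neg_apply]
    ring
  rw [e1]
  refine h3.congr_of_eventuallyEq (Eventually.of_forall fun r => ?_)
  simp only [Function.comp_apply, convolution_def, ContinuousLinearMap.mul_apply', f', neg_sub]

lemma translate_mem_testFun {f : E → ℝ} (hf : f ∈ testFun E) (z : E) :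
    (fun x => f (x - z)) ∈ testFun E :=
  ⟨hf.1.comp (contDiff_id.sub contDiff_const), hf.2.comp_homeomorph (Homeomorph.subRight z)⟩

lemma abs_integral_mul_le {φ ψ : E → ℝ} (hφ : MemLp φ 2 μ) (hψ : MemLp ψ 2 μ) :
    |∫ x, φ x * ψ x ∂μ| ≤ ‖hφ.toLp‖ * ‖hψ.toLp‖ := by
  have : ∫ x, φ x * ψ x ∂μ = inner ℝ hφ.toLp hψ.toLp := by
    rw [L2.inner_def]
    refine integral_congr_ae ?_
    filter_upwards [hφ.coeFn_toLp, hψ.coeFn_toLp] with x h1 h2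
    rw [h1, h2]; simp [mul_comm]
  rw [this]
  exact abs_real_inner_le_norm _ _

lemma memLp_translate {ψ : E → ℝ} (hψ : MemLp ψ 2 μ) (z : E) : MemLp (fun x => ψ (x + z)) 2 μ :=
  hψ.comp_measurePreserving (measurePreserving_add_right μ z)

lemma integral_translate_sub_mul {ψ f : E → ℝ} (hψ : MemLp ψ 2 μ) (hf : f ∈ testFun E) (z : E) :
    ∫ x, (ψ (x + z) - ψ x) * f x ∂μ = (∫ x, ψ x * f (x - z) ∂μ) - ∫ x, ψ x * f x ∂μ := by
  rw [← integral_add_right_eq_self (fun x => ψ x * f (x - z)) z, ← integral_sub]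
  · refine integral_congr_ae (Eventually.of_forall fun x => ?_)
    simp only [add_sub_cancel_right]; ring
  · simpa only [add_sub_cancel_right] using integrable_mul_testFun (memLp_translate hψ z) hf
  · exact integrable_mul_testFun hψ hf

/-- The difference quotients of a function are bounded by its weak derivative. -/
lemma HasWeakDeriv.integral_translate_sub_sq_le {ψ g : E → ℝ} {v : E} (hψ : MemLp ψ 2 μ)
    (hg : MemLp g 2 μ) (h : HasWeakDeriv μ v ψ g) (s : ℝ) :
    ∫ x, (ψ (x + s • v) - ψ x) ^ 2 ∂μ ≤ s ^ 2 * ∫ x, g x ^ 2 ∂μ := by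
  have hd := (memLp_translate hψ (s • v)).sub hψ
  have key : ‖hd.toLp‖ ≤ |s| * ‖hg.toLp‖ := by
    refine norm_le_of_abs_integral_le hd (by positivity) fun f => ?_
    -- Paired with a test function, the translate of `ψ` moves with velocity `∫ g f(· - r v)`, which
    -- is bounded uniformly in `r`. The mean value inequality then bounds the total displacement by
    -- `|s| ‖g‖ ‖f‖`.
    have hderiv : ∀ r ∈ (univ : Set ℝ), HasDerivWithinAt
        (fun r : ℝ => ∫ x, ψ x * f.1 (x - r • v) ∂μ)
        (∫ x, g x * f.1 (x - r • v) ∂μ) univ r := by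
      intro r _
      have h1 := hasDerivAt_integral_translate (hψ.locallyIntegrable (by norm_num)) f.2 v r
      have h2 := h _ (translate_mem_testFun f.2 (r • v))
      simp only [fderiv_comp_sub] at h2
      rw [h2, neg_neg] at h1
      exact h1.hasDerivWithinAt
    have hbound : ∀ r ∈ (univ : Set ℝ), ‖∫ x, g x * f.1 (x - r • v) ∂μ‖
        ≤ ‖hg.toLp‖ * ‖testFunToLp μ f‖ := by
      intro r _
      have ht := memLp_testFun (μ := μ) (translate_mem_testFun f.2 (r • v))
      refine (abs_integral_mul_le hg ht).trans (le_of_eq ?_)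
      congr 1
      rw [← sq_eq_sq₀ (norm_nonneg _) (norm_nonneg _), norm_sq_toLp]
      refine Eq.trans ?_ (norm_sq_toLp (memLp_testFun (μ := μ) f.2)).symm
      exact integral_sub_right_eq_self (fun x => f.1 x ^ 2) (r • v)
    have h3 := convex_univ.norm_image_sub_le_of_norm_hasDerivWithin_le hderiv hbound
      (mem_univ 0) (mem_univ s)
    simp only [zero_smul, sub_zero, Real.norm_eq_abs] at h3
    have h4 := integral_translate_sub_mul hψ f.2 (s • v)
    simp only [Pi.sub_apply]
    rw [h4]
    linarith
  have h5 := norm_sq_toLp hd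
  have h6 := pow_le_pow_left₀ (norm_nonneg _) key 2
  rw [h5, mul_pow, norm_sq_toLp, sq_abs] at h6
  simpa using h6

/-- A function with bounded difference quotients has a weak derivative with the same bound. -/
lemma exists_hasWeakDeriv {ψ : E → ℝ} {v : E} (hψ : MemLp ψ 2 μ) {K : ℝ} (hK : 0 ≤ K)
    (h : ∀ s : ℝ, ∫ x, (ψ (x + s • v) - ψ x) ^ 2 ∂μ ≤ s ^ 2 * K ^ 2) :
    ∃ g : E → ℝ, Measurable g ∧ MemLp g 2 μ ∧ HasWeakDeriv μ v ψ g ∧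
      ∫ x, g x ^ 2 ∂μ ≤ K ^ 2 := by
  let T : testFun E →ₗ[ℝ] ℝ :=
    { toFun f := -∫ x, ψ x * fderiv ℝ f.1 x v ∂μ
      map_add' f g := by
        rw [← neg_add, ← integral_add (integrable_mul_testFun hψ (fderiv_mem_testFun f.2 v))
          (integrable_mul_testFun hψ (fderiv_mem_testFun g.2 v))]
        congr 1
        refine integral_congr_ae (Eventually.of_forall fun x => ?_)
        have hf := (f.2.1.differentiable (by simp)) x
        have hg := (g.2.1.differentiable (by simp)) x
        simp only [Submodule.coe_add]
        rw [fderiv_add hf hg, add_apply, mul_add]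
      map_smul' c f := by
        rw [RingHom.id_apply, smul_eq_mul, mul_neg, ← integral_const_mul]
        congr 1
        refine integral_congr_ae (Eventually.of_forall fun x => ?_)
        have hf := (f.2.1.differentiable (by simp)) x
        simp only [Submodule.coe_smul]
        rw [fderiv_const_smul hf, smul_apply, smul_eq_mul, mul_left_comm] }
  -- `T f` is the derivative at zero of `r ↦ ∫ ψ f(· - r v)`, whose increments are pairings with
  -- difference quotients of `ψ`; a Lipschitz bound for a function bounds its derivative.
  have hT : ∀ f, |T f| ≤ K * ‖testFunToLp μ f‖ := by
    intro f
    have h1 := hasDerivAt_integral_translate (hψ.locallyIntegrable (by norm_num)) f.2 v 0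
    simp only [zero_smul, sub_zero] at h1
    refine h1.le_of_lip' (by positivity) (Eventually.of_forall fun s => ?_)
    simp only [zero_smul, sub_zero]
    rw [← integral_translate_sub_mul hψ f.2 (s • v), Real.norm_eq_abs, Real.norm_eq_abs]
    have hd := (memLp_translate hψ (s • v)).sub hψ
    refine (abs_integral_mul_le hd (memLp_testFun f.2)).trans ?_
    have h2 : ‖hd.toLp‖ ≤ |s| * K := by
      refine abs_le_of_sq_le_sq' ?_ (by positivity) |>.2
      rw [norm_sq_toLp, mul_pow, sq_abs]
      exact h s
    calc ‖hd.toLp‖ * ‖testFunToLp μ f‖ ≤ |s| * K * ‖testFunToLp μ f‖ := by gcongr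
      _ = _ := by ring
  obtain ⟨g, hgK, hg⟩ := exists_inner_eq_of_abs_le (testFunToLp μ) T hK hT
  refine ⟨g, (Lp.stronglyMeasurable g).measurable, Lp.memLp g, fun f hf => ?_, ?_⟩
  · have := hg ⟨f, hf⟩
    rw [inner_testFunToLp] at this
    rw [← this]
    exact (neg_neg _).symm
  · rw [← norm_sq_toLp (Lp.memLp g), Lp.toLp_coeFn]
    gcongr

end DifferenceQuotients

/-! ### Reduction to real symmetric wave functions. -/

section Symmetrization

open Set Filter Topology

variable {n : ℕ}

/-! ### Permutations of the particles -/

lemma measurePreserving_perm (σ : Equiv.Perm (Fin n)) :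
    MeasurePreserving (fun (x : Config n) j => x (σ j)) := by
  convert volume_preserving_arrowCongr' σ.symm (MeasurableEquiv.refl R3)
    (MeasurePreserving.id volume) using 1
  rfl

lemma measurableEmbedding_perm (σ : Equiv.Perm (Fin n)) :
    MeasurableEmbedding (fun (x : Config n) j => x (σ j)) := by
  convert (MeasurableEquiv.arrowCongr' σ.symm (MeasurableEquiv.refl R3)).measurableEmbedding using 1
  rfl

lemma unitVec_perm (σ : Equiv.Perm (Fin n)) (j : Fin n) (a : Fin 3) :
    (fun k => unitVec j a (σ k)) = unitVec (σ.symm j) a := by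
  funext k
  unfold unitVec
  by_cases h : σ k = j
  · subst h; simp
  · rw [Pi.single_eq_of_ne h, Pi.single_eq_of_ne]
    rintro rfl
    simp at h

lemma norm_sq_eq_integral {D : Set (Config n)} (ψ : L2 D) : ‖ψ‖ ^ 2 = ∫ x in D, ‖ψ x‖ ^ 2 := by
  have h := inner_self_eq_norm_sq_to_K (𝕜 := ℂ) ψ
  rw [L2.inner_def] at h
  have e : ∫ x in D, inner ℂ (ψ x) (ψ x) = ((∫ x in D, ‖ψ x‖ ^ 2 : ℝ) : ℂ) := by
    refine Eq.trans (integral_congr_ae (Eventually.of_forall fun x => ?_))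
      (integral_ofReal (𝕜 := ℂ))
    simp only [inner_self_eq_norm_sq_to_K]
    norm_cast
  rw [e] at h
  refine Complex.ofReal_injective ?_
  rw [Complex.ofReal_pow]
  exact h.symm

lemma memLp_L2_univ (ψ : L2 (univ : Set (Config n))) : MemLp ψ 2 volume :=
  (Lp.memLp ψ).mono_measure Measure.restrict_univ.ge

/-- Applied with the real and the imaginary part, this makes the real-valued theory of difference
quotients available for complex wave functions. -/
lemma HasWeakGradient.hasWeakDeriv {ψ : L2 (univ : Set (Config n))}
    {g : Fin n → Fin 3 → L2 (univ : Set (Config n))} (h : HasWeakGradient univ ψ g)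
    (T : ℂ →L[ℝ] ℝ) (j : Fin n) (a : Fin 3) :
    HasWeakDeriv volume (unitVec j a) (fun x => T (ψ x)) fun x => T (g j a x) := by
  intro f hf
  have hi : ∀ (φ : L2 (univ : Set (Config n))) {f : Config n → ℝ}, f ∈ testFun (Config n) →
      Integrable fun x => φ x * (f x : ℂ) := fun φ f hf =>
    MemLp.integrable_mul (memLp_L2_univ φ)
      (memLp_ofReal_of_hasCompactSupport hf.1.continuous hf.2 volume)
  have hT : ∀ (φ : L2 (univ : Set (Config n))) {f : Config n → ℝ}, f ∈ testFun (Config n) →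
      ∫ x, T (φ x) * f x = T (∫ x, φ x * (f x : ℂ)) := by
    intro φ f hf
    rw [← T.integral_comp_comm (hi φ hf)]
    refine integral_congr_ae (Eventually.of_forall fun x => ?_)
    have : φ x * (f x : ℂ) = f x • φ x := by rw [Complex.real_smul, mul_comm]
    simp only [this, map_smul, smul_eq_mul]
    ring
  have h1 := h j a f hf.1 hf.2 (subset_univ _)
  simp only [setIntegral_univ] at h1
  rw [hT ψ (fderiv_mem_testFun hf (unitVec j a)), h1, map_neg, hT (g j a) hf]

lemma HasWeakGradient.integral_translate_sub_sq_le {ψ : L2 (univ : Set (Config n))}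
    {g : Fin n → Fin 3 → L2 (univ : Set (Config n))} (h : HasWeakGradient univ ψ g)
    (j : Fin n) (a : Fin 3) (s : ℝ) :
    ∫ x, ‖ψ (x + s • unitVec j a) - ψ x‖ ^ 2 ≤ s ^ 2 * ‖g j a‖ ^ 2 := by
  have hm : ∀ (T : ℂ →L[ℝ] ℝ) (φ : L2 (univ : Set (Config n))),
      MemLp (fun x => T (φ x)) 2 volume := fun T φ => T.comp_memLp' (memLp_L2_univ φ)
  have hb := fun T : ℂ →L[ℝ] ℝ =>
    (h.hasWeakDeriv T j a).integral_translate_sub_sq_le (hm T ψ) (hm T (g j a)) s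
  have hi : ∀ T : ℂ →L[ℝ] ℝ,
      Integrable fun x => (T (ψ (x + s • unitVec j a)) - T (ψ x)) ^ 2 := fun T =>
    ((memLp_translate (hm T ψ) (s • unitVec j a)).sub (hm T ψ)).integrable_sq
  have hsq : ∀ z : ℂ, ‖z‖ ^ 2 = Complex.reCLM z ^ 2 + Complex.imCLM z ^ 2 := fun z => by
    rw [← Complex.normSq_eq_norm_sq, Complex.normSq_apply, Complex.reCLM_apply,
      Complex.imCLM_apply]
    ring
  rw [norm_sq_eq_integral, setIntegral_univ]
  simp only [hsq, map_sub]
  rw [integral_add (hi _) (hi _), integral_add (hm _ _).integrable_sq (hm _ _).integrable_sq]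
  linarith [hb Complex.reCLM, hb Complex.imCLM]

/-- The root mean square of `ψ` over all permutations of the particles. -/
def symmetrization (ψ : Config n → ℂ) (x : Config n) : ℝ :=
  √(Fintype.card (Equiv.Perm (Fin n)) : ℝ)⁻¹ *
    ‖WithLp.toLp 2 fun σ : Equiv.Perm (Fin n) => ψ fun j => x (σ j)‖

lemma symmetrization_sq (ψ : Config n → ℂ) (x : Config n) :
    symmetrization ψ x ^ 2 = (Fintype.card (Equiv.Perm (Fin n)) : ℝ)⁻¹ *
      ∑ σ : Equiv.Perm (Fin n), ‖ψ fun j => x (σ j)‖ ^ 2 := by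
  rw [symmetrization, mul_pow, Real.sq_sqrt (by positivity), EuclideanSpace.norm_sq_eq]

/-- The reverse triangle inequality in `ℓ²` over the permutations. It compares difference quotients
of the root mean square with those of `ψ`, even at zeros, where a chain rule would be delicate. -/
lemma symmetrization_sub_sq_le (ψ : Config n → ℂ) (x y : Config n) :
    (symmetrization ψ x - symmetrization ψ y) ^ 2 ≤ (Fintype.card (Equiv.Perm (Fin n)) : ℝ)⁻¹ *
      ∑ σ : Equiv.Perm (Fin n), ‖(ψ fun j => x (σ j)) - ψ fun j => y (σ j)‖ ^ 2 := by
  rw [symmetrization, symmetrization, ← mul_sub, mul_pow, Real.sq_sqrt (by positivity)]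
  gcongr
  refine le_trans (sq_le_sq.2 ((abs_norm_sub_norm_le _ _).trans (le_abs_self _))) ?_
  rw [EuclideanSpace.norm_sq_eq]
  rfl

lemma symmetrization_perm (ψ : Config n → ℂ) (τ : Equiv.Perm (Fin n)) (x : Config n) :
    symmetrization ψ (fun j => x (τ j)) = symmetrization ψ x := by
  have h0 : ∀ x, 0 ≤ symmetrization ψ x := fun x => by unfold symmetrization; positivity
  rw [← sq_eq_sq₀ (h0 _) (h0 _), symmetrization_sq, symmetrization_sq]
  congr 1
  exact Equiv.sum_comp (Equiv.mulLeft τ) fun σ : Equiv.Perm (Fin n) => ‖ψ fun j => x (σ j)‖ ^ 2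

lemma measurable_symmetrization {ψ : Config n → ℂ} (hψ : Measurable ψ) :
    Measurable (symmetrization ψ) := by
  unfold symmetrization
  refine Measurable.const_mul ?_ _
  simp only [EuclideanSpace.norm_eq]
  refine Measurable.sqrt (Finset.measurable_fun_sum _ fun σ _ => ?_)
  exact ((hψ.comp (measurePreserving_perm σ).measurable).norm).pow_const 2

lemma integrable_mul_symmetrization_sq {ψ : Config n → ℂ} {V : Config n → ℝ}
    (hV : ∀ (σ : Equiv.Perm (Fin n)) x, V (fun j => x (σ j)) = V x)
    (hi : Integrable fun x => V x * ‖ψ x‖ ^ 2) :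
    Integrable (fun x => V x * symmetrization ψ x ^ 2) ∧
      ∫ x, V x * symmetrization ψ x ^ 2 = ∫ x, V x * ‖ψ x‖ ^ 2 := by
  have e : ∀ x, V x * symmetrization ψ x ^ 2 = (Fintype.card (Equiv.Perm (Fin n)) : ℝ)⁻¹ *
      ∑ σ : Equiv.Perm (Fin n), V (fun j => x (σ j)) * ‖ψ fun j => x (σ j)‖ ^ 2 := by
    intro x
    simp only [hV]
    rw [symmetrization_sq, ← Finset.mul_sum]; ring
  have hσ : ∀ σ : Equiv.Perm (Fin n),
      Integrable fun x : Config n => V (fun j => x (σ j)) * ‖ψ fun j => x (σ j)‖ ^ 2 := fun σ =>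
    (measurePreserving_perm σ).integrable_comp_of_integrable hi
  simp only [e]
  refine ⟨(integrable_finsetSum _ fun σ _ => hσ σ).const_mul _, ?_⟩
  rw [integral_const_mul, integral_finsetSum _ fun σ _ => hσ σ]
  have : ∀ σ : Equiv.Perm (Fin n), ∫ x : Config n, V (fun j => x (σ j)) * ‖ψ fun j => x (σ j)‖ ^ 2
      = ∫ x, V x * ‖ψ x‖ ^ 2 := fun σ =>
    (measurePreserving_perm σ).integral_comp (measurableEmbedding_perm σ)
      fun x => V x * ‖ψ x‖ ^ 2
  simp only [this, Finset.sum_const, Finset.card_univ, nsmul_eq_mul]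
  rw [inv_mul_cancel_left₀]
  exact_mod_cast Fintype.card_ne_zero

lemma memLp_symmetrization (ψ : L2 (univ : Set (Config n))) :
    MemLp (symmetrization ψ) 2 volume := by
  have hψm : Measurable ψ := (Lp.stronglyMeasurable ψ).measurable
  rw [memLp_two_iff_integrable_sq (measurable_symmetrization hψm).aestronglyMeasurable]
  have := (integrable_mul_symmetrization_sq (n := n) (ψ := ψ) (V := fun _ => 1) (fun _ _ => rfl)
    (by simpa using (memLp_L2_univ ψ).integrable_norm_pow two_ne_zero)).1
  simpa using this

/-- Symmetrization does not increase the kinetic energy. -/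
theorem exists_hasWeakDeriv_symmetrization {ψ : L2 (univ : Set (Config n))}
    {g : Fin n → Fin 3 → L2 (univ : Set (Config n))} (h : HasWeakGradient univ ψ g) :
    ∃ G : Fin n → Fin 3 → Config n → ℝ,
      (∀ j a, Measurable (G j a) ∧ MemLp (G j a) 2 volume ∧
        HasWeakDeriv volume (unitVec j a) (symmetrization ψ) (G j a)) ∧
      ∑ j, ∑ a, ∫ x, G j a x ^ 2 ≤ ∑ j, ∑ a, ‖g j a‖ ^ 2 := by
  set c : ℝ := (Fintype.card (Equiv.Perm (Fin n)) : ℝ)⁻¹ with hc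
  have hc0 : 0 ≤ c := by positivity
  have hΨ := memLp_symmetrization ψ
  -- Shifting particle `j` before the permutation `σ` is shifting particle `σ⁻¹ j` after it, so the
  -- bound is the mean over `σ` of the kinetic energies of those particles.
  have key : ∀ j a, ∃ G : Config n → ℝ, Measurable G ∧ MemLp G 2 volume ∧
      HasWeakDeriv volume (unitVec j a) (symmetrization ψ) G ∧
      ∫ x, G x ^ 2 ≤ √(c * ∑ σ : Equiv.Perm (Fin n), ‖g (σ.symm j) a‖ ^ 2) ^ 2 := by
    intro j a
    refine exists_hasWeakDeriv hΨ (Real.sqrt_nonneg _) fun s => ?_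
    rw [Real.sq_sqrt (by positivity)]
    have hd : ∀ σ : Equiv.Perm (Fin n), Integrable fun x : Config n =>
        ‖(ψ fun k => (x + s • unitVec j a) (σ k)) - ψ fun k => x (σ k)‖ ^ 2 := by
      intro σ
      have h1 := (memLp_L2_univ ψ).comp_measurePreserving (measurePreserving_perm σ)
      have h2 := h1.comp_measurePreserving (measurePreserving_add_right volume (s • unitVec j a))
      exact (h2.sub h1).integrable_norm_pow two_ne_zero
    calc ∫ x, (symmetrization ψ (x + s • unitVec j a) - symmetrization ψ x) ^ 2
        ≤ ∫ x, c * ∑ σ : Equiv.Perm (Fin n),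
          ‖(ψ fun k => (x + s • unitVec j a) (σ k)) - ψ fun k => x (σ k)‖ ^ 2 := by
          refine integral_mono ((memLp_translate hΨ _).sub hΨ).integrable_sq
            ((integrable_finsetSum _ fun σ _ => hd σ).const_mul c) fun x => ?_
          exact symmetrization_sub_sq_le ψ _ _
      _ = c * ∑ σ : Equiv.Perm (Fin n), ∫ x : Config n,
          ‖(ψ fun k => (x + s • unitVec j a) (σ k)) - ψ fun k => x (σ k)‖ ^ 2 := by
          rw [integral_const_mul, integral_finsetSum _ fun σ _ => hd σ]
      _ ≤ c * ∑ σ : Equiv.Perm (Fin n), s ^ 2 * ‖g (σ.symm j) a‖ ^ 2 := by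
          gcongr with σ
          have h1 : ∀ x : Config n, (fun k => (x + s • unitVec j a) (σ k))
              = (fun k => x (σ k)) + s • unitVec (σ.symm j) a := by
            intro x
            rw [← unitVec_perm]
            rfl
          simp only [h1]
          rw [(measurePreserving_perm σ).integral_comp (measurableEmbedding_perm σ)
            fun y => ‖ψ (y + s • unitVec (σ.symm j) a) - ψ y‖ ^ 2]
          exact h.integral_translate_sub_sq_le _ _ _
      _ = s ^ 2 * (c * ∑ σ : Equiv.Perm (Fin n), ‖g (σ.symm j) a‖ ^ 2) := by
          rw [← Finset.mul_sum]; ring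
  choose G hG1 hG2 hG3 hG4 using key
  refine ⟨G, fun j a => ⟨hG1 j a, hG2 j a, hG3 j a⟩, ?_⟩
  calc ∑ j, ∑ a, ∫ x, G j a x ^ 2
      ≤ ∑ j, ∑ a, c * ∑ σ : Equiv.Perm (Fin n), ‖g (σ.symm j) a‖ ^ 2 := by
        gcongr with j _ a _
        refine (hG4 j a).trans (le_of_eq (Real.sq_sqrt (by positivity)))
    _ = c * ∑ σ : Equiv.Perm (Fin n), ∑ j, ∑ a, ‖g (σ.symm j) a‖ ^ 2 := by
        simp only [← Finset.mul_sum]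
        congr 1
        rw [Finset.sum_comm (s := (Finset.univ : Finset (Equiv.Perm (Fin n))))]
        exact Finset.sum_congr rfl fun j _ => Finset.sum_comm
    -- Each permutation only relabels the sum over particles, so all terms of the mean coincide.
    _ = ∑ j, ∑ a, ‖g j a‖ ^ 2 := by
        have : ∀ σ : Equiv.Perm (Fin n),
            ∑ j, ∑ a, ‖g (σ.symm j) a‖ ^ 2 = ∑ j, ∑ a, ‖g j a‖ ^ 2 := fun σ =>
          Equiv.sum_comp σ.symm fun j => ∑ a, ‖g j a‖ ^ 2
        simp only [this, Finset.sum_const, Finset.card_univ, nsmul_eq_mul]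
        rw [hc, inv_mul_cancel_left₀]
        exact_mod_cast Fintype.card_ne_zero

end Symmetrization

/-! ### The Neumann problem in one small box. -/

section Box

open Set Filter Topology

variable {n : ℕ} {B : ℕ → ℝ} {t ω ℓ ρ : ℝ} {χ : R3 → ℝ}

lemma isOpen_boxConfig (n : ℕ) (a b : ℝ) : IsOpen (boxConfig n a b) := by
  have : boxConfig n a b = ⋂ j, ⋂ i, {x : Config n | a < x j i ∧ x j i < b} := by
    ext x; simp [boxConfig]
  rw [this]
  refine isOpen_iInter_of_finite fun j => isOpen_iInter_of_finite fun i => ?_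
  have h : Continuous fun x : Config n => x j i := by fun_prop
  exact (isOpen_lt continuous_const h).inter (isOpen_lt h continuous_const)

lemma preimage_perm_boxConfig (σ : Equiv.Perm (Fin n)) (a b : ℝ) :
    (fun (x : Config n) j => x (σ j)) ⁻¹' boxConfig n a b = boxConfig n a b := by
  ext x
  exact ⟨fun h j => by simpa using h (σ.symm j), fun h j => h (σ j)⟩

lemma measurePreserving_perm_restrict (σ : Equiv.Perm (Fin n)) (a b : ℝ) :
    MeasurePreserving (fun (x : Config n) j => x (σ j))
      (volume.restrict (boxConfig n a b)) (volume.restrict (boxConfig n a b)) := by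
  have := (measurePreserving_perm σ).restrict_preimage (isOpen_boxConfig n a b).measurableSet
  rwa [preimage_perm_boxConfig] at this

/-- The bosonic wave functions in a box form a subspace. -/
def bosonSpace (n : ℕ) (a b : ℝ) : Submodule ℂ (L2 (boxConfig n a b)) :=
  ⨅ σ : Equiv.Perm (Fin n), LinearMap.eqLocus
    (Lp.compMeasurePreservingₗ ℂ _ (measurePreserving_perm_restrict σ a b)) LinearMap.id

lemma coe_bosonSpace (n : ℕ) (a b : ℝ) :
    (bosonSpace n a b : Set (L2 (boxConfig n a b))) = bosons (boxConfig n a b) := by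
  ext ψ
  simp only [bosonSpace, Submodule.coe_iInf, mem_iInter, SetLike.mem_coe, LinearMap.mem_eqLocus,
    LinearMap.id_apply, bosons, mem_ofPred_eq]
  refine forall_congr' fun σ => ?_
  have h := Lp.coeFn_compMeasurePreserving ψ (measurePreserving_perm_restrict σ a b)
  constructor
  · intro e
    have e' : Lp.compMeasurePreserving _ (measurePreserving_perm_restrict σ a b) ψ = ψ := e
    rw [e'] at h
    filter_upwards [h] with x hx using hx.symm
  · intro e
    refine Lp.ext ?_
    filter_upwards [h, e] with x hx hx'
    exact hx.trans hx'

lemma isClosed_bosonSpace (n : ℕ) (a b : ℝ) :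
    IsClosed (bosonSpace n a b : Set (L2 (boxConfig n a b))) := by
  rw [bosonSpace, Submodule.coe_iInf]
  refine isClosed_iInter fun σ => ?_
  exact isClosed_eq (Lp.compMeasurePreservingₗᵢ ℂ _
    (measurePreserving_perm_restrict σ a b)).continuous continuous_id

/-! ### The potential in the box -/

lemma locYukawa_eq_zero_left (hχ : IsCutoff B t χ) (ht0 : 0 < t) (hℓ : 0 < ℓ) {x : R3}
    (hx : ¬ ∀ i, -ℓ / 2 < x i ∧ x i < ℓ / 2) (y : R3) : locYukawa χ ω ℓ x y = 0 := by
  have : χ (ℓ⁻¹ • x) = 0 := by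
    by_contra h
    have h1 := hχ.support_subset (subset_tsupport _ h)
    refine hx fun i => ?_
    have h2 := h1 i
    simp only [PiLp.smul_apply, smul_eq_mul] at h2
    have e : x i = ℓ * (ℓ⁻¹ * x i) := by rw [mul_inv_cancel_left₀ hℓ.ne']
    rw [e]
    constructor <;> nlinarith [h2.1, h2.2, mul_pos ht0 hℓ]
  rw [locYukawa, this]; ring

lemma locYukawa_comm (χ : R3 → ℝ) (ω ℓ : ℝ) (x y : R3) :
    locYukawa χ ω ℓ x y = locYukawa χ ω ℓ y x := by
  unfold locYukawa yukawa
  rw [norm_sub_rev]; ring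

lemma locYukawa_eq_zero_right (hχ : IsCutoff B t χ) (ht0 : 0 < t) (hℓ : 0 < ℓ) {y : R3}
    (hy : ¬ ∀ i, -ℓ / 2 < y i ∧ y i < ℓ / 2) (x : R3) : locYukawa χ ω ℓ x y = 0 := by
  rw [locYukawa_comm, locYukawa_eq_zero_left hχ ht0 hℓ hy]

lemma potential_of_forall_eq_zero {v : R3 → R3 → ℝ} {Ω : Set R3}
    (h1 : ∀ x y, x ∉ Ω → v x y = 0) (h2 : ∀ x y, y ∉ Ω → v x y = 0) (ρ : ℝ) (x : Config n) :
    potential v Ω ρ x = potential v univ ρ x := by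
  have e : ∀ a, ∫ y in Ω, v a y = ∫ y, v a y := fun a =>
    setIntegral_eq_integral_of_forall_compl_eq_zero fun y hy => h2 a y hy
  unfold potential
  simp only [e, setIntegral_univ]
  rw [setIntegral_eq_integral_of_forall_compl_eq_zero fun y hy => by simp [h1 y _ hy]]

lemma notMem_cube_of {x : R3} (hx : x ∉ cube (-ℓ / 2) (ℓ / 2)) :
    ¬ ∀ i, -ℓ / 2 < x i ∧ x i < ℓ / 2 :=
  fun h => hx fun i => ⟨(h i).1.le, (h i).2.le⟩

/-- The interaction vanishes outside the cube. Restricting the background to finite volume makes the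
Coulomb bounds applicable. -/
lemma potential_locYukawa_univ (hχ : IsCutoff B t χ) (ht0 : 0 < t) (hℓ : 0 < ℓ) (ρ : ℝ)
    (x : Config n) : potential (locYukawa χ ω ℓ) univ ρ x
      = potential (locYukawa χ ω ℓ) (cube (-ℓ / 2) (ℓ / 2)) ρ x :=
  (potential_of_forall_eq_zero
    (fun _ _ hx => locYukawa_eq_zero_left hχ ht0 hℓ (notMem_cube_of hx) _)
    (fun _ _ hy => locYukawa_eq_zero_right hχ ht0 hℓ (notMem_cube_of hy) _) ρ x).symm

/-- The ground state energy of the box is a lower bound for the energy of symmetric functions. -/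
lemma boxEnergy_mul_le (hχ : IsCutoff B t χ) (ht0 : 0 < t) (ht : t < 1 / 2) (hω : 0 ≤ ω)
    (hℓ : 0 < ℓ) (hρ : 0 ≤ ρ) {φ : Config n → ℝ} {γ : Fin n → Fin 3 → Config n → ℝ}
    (hφ : MemLp φ 2 (volume.restrict (boxConfig n (-ℓ / 2) (ℓ / 2))))
    (hsym : ∀ (σ : Equiv.Perm (Fin n)) x, φ (fun j => x (σ j)) = φ x)
    (hγ : ∀ j a, MemLp (γ j a) 2 (volume.restrict (boxConfig n (-ℓ / 2) (ℓ / 2))))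
    (hw : ∀ j a, ∀ f ∈ testFun (Config n), tsupport f ⊆ boxConfig n (-ℓ / 2) (ℓ / 2) →
      ∫ x, φ x * fderiv ℝ f x (unitVec j a) = -∫ x, γ j a x * f x)
    (hi : IntegrableOn (fun x => potential (locYukawa χ ω ℓ) univ ρ x * φ x ^ 2)
      (boxConfig n (-ℓ / 2) (ℓ / 2))) :
    boxEnergy χ ω ρ ℓ n * ∫ x in boxConfig n (-ℓ / 2) (ℓ / 2), φ x ^ 2
      ≤ 1 / 2 * (gam χ)⁻¹ * (∑ j, ∑ a, ∫ x in boxConfig n (-ℓ / 2) (ℓ / 2), γ j a x ^ 2)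
        + ∫ x in boxConfig n (-ℓ / 2) (ℓ / 2),
          potential (locYukawa χ ω ℓ) univ ρ x * φ x ^ 2 := by
  set D := boxConfig n (-ℓ / 2) (ℓ / 2) with hD
  have hwB := coulombBounded_locYukawa hχ hω hℓ
  have hcube : volume (cube (-ℓ / 2) (ℓ / 2)) ≠ ⊤ := (volume_cube_lt_top _ _).ne
  have hV : Measurable (potential (locYukawa χ ω ℓ) univ ρ : Config n → ℝ) :=
    measurable_potential hwB _ _ _
  have hVb : ∀ x : Config n, -(ρ * (n * backgroundBound (cube (-ℓ / 2) (ℓ / 2))))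
      ≤ potential (locYukawa χ ω ℓ) univ ρ x := fun x => by
    rw [potential_locYukawa_univ hχ ht0 hℓ]
    exact neg_le_potential hwB (locYukawa_nonneg hχ) hcube hρ x
  have toC : ∀ {h : Config n → ℝ}, MemLp h 2 (volume.restrict D) →
      MemLp (fun x => (h x : ℂ)) 2 (volume.restrict D) := fun hh => hh.ofReal
  have hnorm : ∀ {h : Config n → ℝ} (hh : MemLp h 2 (volume.restrict D)),
      ‖(toC hh).toLp‖ ^ 2 = ∫ x in D, h x ^ 2 := by
    intro h hh
    rw [norm_sq_eq_integral]
    refine integral_congr_ae ?_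
    filter_upwards [(toC hh).coeFn_toLp] with x hx
    rw [hx, Complex.norm_real, Real.norm_eq_abs, sq_abs]
  have hVeq : (fun x => potential (locYukawa χ ω ℓ) univ ρ x * ‖MemLp.toLp _ (toC hφ) x‖ ^ 2)
      =ᵐ[volume.restrict D] fun x => potential (locYukawa χ ω ℓ) univ ρ x * φ x ^ 2 := by
    filter_upwards [(toC hφ).coeFn_toLp] with x hx
    rw [hx, Complex.norm_real, Real.norm_eq_abs, sq_abs]
  have hmem : (toC hφ).toLp ∈ bosonSpace n (-ℓ / 2) (ℓ / 2) := by
    have : (toC hφ).toLp ∈ bosons D := by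
      intro σ
      have h1 := (toC hφ).coeFn_toLp
      have h2 := (measurePreserving_perm_restrict (n := n) σ (-ℓ / 2)
        (ℓ / 2)).quasiMeasurePreserving.ae h1
      filter_upwards [h1, h2] with x hx hx'
      rw [hx, hx', hsym]
    rwa [← coe_bosonSpace] at this
  have hgrad : HasWeakGradient D (toC hφ).toLp fun j a => (toC (hγ j a)).toLp := by
    intro j a f hf hc hs
    have e1 : ∀ {h : Config n → ℝ} (hh : MemLp h 2 (volume.restrict D)) {q : Config n → ℝ},
        (∀ x ∉ D, q x = 0) →
        ∫ x in D, MemLp.toLp _ (toC hh) x * ((q x : ℝ) : ℂ) = ((∫ x, h x * q x : ℝ) : ℂ) := by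
      intro h hh q hq
      have e2 : ∫ x in D, h x * q x = ∫ x, h x * q x :=
        setIntegral_eq_integral_of_forall_compl_eq_zero fun x hx => by rw [hq x hx, mul_zero]
      rw [← e2]
      refine Eq.trans (integral_congr_ae ?_) (integral_ofReal (𝕜 := ℂ))
      filter_upwards [(toC hh).coeFn_toLp] with x hx
      rw [hx]; norm_cast
    have hz1 : ∀ x ∉ D, f x = 0 := fun x hx =>
      image_eq_zero_of_notMem_tsupport fun h => hx (hs h)
    have hz2 : ∀ x ∉ D, fderiv ℝ f x (unitVec j a) = 0 := fun x hx => by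
      have : fderiv ℝ f x = 0 := image_eq_zero_of_notMem_tsupport fun h =>
        hx (hs (tsupport_fderiv_subset ℝ h))
      rw [this]; rfl
    rw [e1 hφ hz2, e1 (hγ j a) hz1, hw j a f ⟨hf, hc⟩ hs]
    push_cast; rfl
  have hκ : 0 < 1 / 2 * (gam χ)⁻¹ := by
    have := hχ.gam_pos ht
    positivity
  have h := sInf_spec_mul_norm_sq_le hκ
    (isOpen_boxConfig n (-ℓ / 2) (ℓ / 2)) hV hVb (isClosed_bosonSpace n _ _) hmem hgrad
    (hi.congr hVeq.symm)
  rw [coe_bosonSpace, hnorm hφ, integral_congr_ae hVeq] at h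
  have e : ∑ j, ∑ a, ‖MemLp.toLp _ (toC (hγ j a))‖ ^ 2 = ∑ j, ∑ a, ∫ x in D, γ j a x ^ 2 :=
    Finset.sum_congr rfl fun j _ => Finset.sum_congr rfl fun a _ => hnorm (hγ j a)
  rw [e] at h
  exact h

/-- The self energy of the background in the box. -/
def selfEnergy (χ : R3 → ℝ) (ω ρ ℓ : ℝ) : ℝ :=
  1 / 2 * ρ ^ 2 * ∫ y, ∫ z, locYukawa χ ω ℓ y z

/-- Trial function: the constant, with no kinetic energy under Neumann conditions, no pair term, and
an attraction that only lowers the energy. This lets the infimum over `n ≥ 1` also bound the energy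
of a box without particles. -/
lemma boxEnergy_one_le (hχ : IsCutoff B t χ) (ht0 : 0 < t) (ht : t < 1 / 2) (hω : 0 ≤ ω)
    (hℓ : 0 < ℓ) (hρ : 0 ≤ ρ) : boxEnergy χ ω ρ ℓ 1 ≤ selfEnergy χ ω ρ ℓ := by
  set D := boxConfig 1 (-ℓ / 2) (ℓ / 2) with hD
  have hwB := coulombBounded_locYukawa hχ hω hℓ
  have hcube : volume (cube (-ℓ / 2) (ℓ / 2)) ≠ ⊤ := (volume_cube_lt_top _ _).ne
  have hV : Measurable (potential (locYukawa χ ω ℓ) univ ρ : Config 1 → ℝ) :=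
    measurable_potential hwB _ _ _
  have hDo : IsOpen D := isOpen_boxConfig 1 (-ℓ / 2) (ℓ / 2)
  have hDb : Bornology.IsBounded D := by
    refine (Metric.isBounded_closedBall (x := (0 : Config 1)) (r := √3 * (ℓ / 2))).subset
      fun x hx => ?_
    rw [mem_closedBall_zero_iff, pi_norm_le_iff_of_nonneg (by positivity)]
    intro j
    rw [EuclideanSpace.norm_eq, Real.sqrt_le_left (by positivity), mul_pow,
      Real.sq_sqrt (by norm_num)]
    have : ∀ i, ‖x j i‖ ^ 2 ≤ (ℓ / 2) ^ 2 := fun i => by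
      rw [Real.norm_eq_abs, sq_abs]
      have := hx j i
      exact sq_le_sq' (by linarith [this.1]) this.2.le
    calc ∑ i, ‖x j i‖ ^ 2 ≤ ∑ _i : Fin 3, (ℓ / 2) ^ 2 := Finset.sum_le_sum fun i _ => this i
      _ = _ := by simp
  have hDfin : volume D ≠ ⊤ := hDb.measure_lt_top.ne
  have : IsFiniteMeasure (volume.restrict D) := isFiniteMeasure_restrict.2 hDfin
  have hDpos : 0 < volume.real D := by
    refine ENNReal.toReal_pos (hDo.measure_pos volume ⟨0, fun j i => ?_⟩).ne' hDfin
    simp only [Pi.zero_apply, PiLp.zero_apply]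
    constructor <;> linarith
  have hVle : ∀ x : Config 1, potential (locYukawa χ ω ℓ) univ ρ x ≤ selfEnergy χ ω ρ ℓ := by
    intro x
    have := potential_le_pair_sum (locYukawa_nonneg hχ (ω := ω) (ℓ := ℓ)) hρ (Ω := univ) x
    simpa [selfEnergy] using this
  have hVb : ∀ x : Config 1, -(ρ * ((1 : ℕ) * backgroundBound (cube (-ℓ / 2) (ℓ / 2))))
      ≤ potential (locYukawa χ ω ℓ) univ ρ x := fun x => by
    rw [potential_locYukawa_univ hχ ht0 hℓ]
    exact neg_le_potential hwB (locYukawa_nonneg hχ) hcube hρ x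
  have hVi : IntegrableOn (fun x => potential (locYukawa χ ω ℓ) univ ρ x * 1 ^ 2) D := by
    simp only [one_pow, mul_one]
    refine Integrable.of_bound hV.aestronglyMeasurable
      (max (selfEnergy χ ω ρ ℓ) (ρ * ((1 : ℕ) * backgroundBound (cube (-ℓ / 2) (ℓ / 2)))))
      (Eventually.of_forall fun x => ?_)
    rw [Real.norm_eq_abs, abs_le]
    exact ⟨by linarith [hVb x, le_max_right (selfEnergy χ ω ρ ℓ) (ρ * ((1 : ℕ) *
      backgroundBound (cube (-ℓ / 2) (ℓ / 2))))], (hVle x).trans (le_max_left _ _)⟩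
  have h := boxEnergy_mul_le hχ ht0 ht hω hℓ hρ (n := 1) (φ := fun _ => 1) (γ := fun _ _ _ => 0)
    (memLp_const 1) (fun _ _ => rfl) (fun _ _ => MemLp.zero) (fun j a f hf _ => ?_) hVi
  · have h2 : ∫ x in D, potential (locYukawa χ ω ℓ) univ ρ x * 1 ^ 2
        ≤ ∫ x in D, selfEnergy χ ω ρ ℓ :=
      integral_mono hVi (integrable_const _) fun x => by simpa using hVle x
    rw [setIntegral_const] at h2
    simp only [one_pow, setIntegral_const, smul_eq_mul, mul_one, ne_eq, OfNat.ofNat_ne_zero,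
      not_false_eq_true, zero_pow, integral_zero, Finset.sum_const_zero, mul_zero, zero_add]
      at h h2
    have h3 : boxEnergy χ ω ρ ℓ 1 * volume.real D ≤ selfEnergy χ ω ρ ℓ * volume.real D := by
      linarith
    exact le_of_mul_le_mul_right h3 hDpos
  · have h1 := fderiv_mem_testFun hf (unitVec j a)
    have hi1 : Integrable fun x => fderiv ℝ f x (unitVec j a) :=
      h1.1.continuous.integrable_of_hasCompactSupport h1.2
    have := integral_mul_fderiv_eq_neg_fderiv_mul_of_integrable (μ := volume)
      (f := fun _ : Config 1 => (1 : ℝ)) (g := f) (v := unitVec j a) (by simp) (by simpa using hi1)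
      (by simpa using hf.1.continuous.integrable_of_hasCompactSupport hf.2)
      (fun x _ => differentiableAt_const _) (fun x _ => hf.1.differentiable (by simp) x)
    rw [this]; simp

end Box

/-! ### Fubini for weak derivatives. -/

section Slices

open Set Filter Topology

set_option linter.unusedSectionVars false

variable {E Z : Type*} [NormedAddCommGroup E] [NormedSpace ℝ E] [FiniteDimensional ℝ E]
  [MeasurableSpace E] [BorelSpace E] {μ : Measure E} [μ.IsAddHaarMeasure]
  [NormedAddCommGroup Z] [NormedSpace ℝ Z] [FiniteDimensional ℝ Z]
  [MeasurableSpace Z] [BorelSpace Z] {ν : Measure Z} [ν.IsAddHaarMeasure]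

/-! ### Weak derivatives of slices -/

lemma ae_memLp_slice {F : E × Z → ℝ} (hFm : Measurable F) (hF : MemLp F 2 (μ.prod ν)) :
    ∀ᵐ z ∂ν, MemLp (fun y => F (y, z)) 2 μ := by
  filter_upwards [hF.integrable_sq.prod_left_ae] with z hz
  have hm : Measurable fun y => F (y, z) := hFm.comp measurable_prodMk_right
  exact (memLp_two_iff_integrable_sq hm.aestronglyMeasurable).2 hz

lemma memLp_tensor {f : E → ℝ} {θ : Z → ℝ} (hf : f ∈ testFun E) (hθ : θ ∈ testFun Z) :
    MemLp (fun p : E × Z => f p.1 * θ p.2) 2 (μ.prod ν) := by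
  have hc : Continuous fun p : E × Z => f p.1 * θ p.2 :=
    (hf.1.continuous.comp continuous_fst).mul (hθ.1.continuous.comp continuous_snd)
  refine hc.memLp_of_hasCompactSupport (HasCompactSupport.intro (hf.2.isCompact.prod hθ.2.isCompact)
    fun p hp => ?_)
  rw [mem_prod, not_and_or] at hp
  rcases hp with hp | hp
  · rw [image_eq_zero_of_notMem_tsupport hp, zero_mul]
  · rw [image_eq_zero_of_notMem_tsupport hp, mul_zero]

lemma integrableOn_integral_slice {F : E × Z → ℝ} (hF : MemLp F 2 (μ.prod ν)) {f : E → ℝ}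
    (hf : f ∈ testFun E) {K : Set Z} (hK : IsCompact K) :
    IntegrableOn (fun z => ∫ y, F (y, z) * f y ∂μ) K ν := by
  have : IsFiniteMeasure (ν.restrict K) := isFiniteMeasure_restrict.2 hK.measure_lt_top.ne
  have hle : μ.prod (ν.restrict K) ≤ μ.prod ν := by
    have h := Measure.prod_restrict (μ := μ) (ν := ν) univ K
    rw [Measure.restrict_univ] at h
    rw [h]
    exact Measure.restrict_le_self
  have h1 : Integrable (fun p : E × Z => F p * f p.1) (μ.prod (ν.restrict K)) :=
    (hF.mono_measure hle).integrable_mul ((memLp_testFun (μ := μ) hf).comp_fst _)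
  exact h1.integral_prod_right

lemma integral_slice_mul {F : E × Z → ℝ} (hF : MemLp F 2 (μ.prod ν)) {f : E → ℝ} {θ : Z → ℝ}
    (hf : f ∈ testFun E) (hθ : θ ∈ testFun Z) :
    ∫ z, θ z * ∫ y, F (y, z) * f y ∂μ ∂ν = ∫ p, F p * (f p.1 * θ p.2) ∂(μ.prod ν) := by
  have hi : Integrable (fun p => F p * (f p.1 * θ p.2)) (μ.prod ν) :=
    hF.integrable_mul (memLp_tensor hf hθ)
  rw [integral_prod_symm _ hi]
  refine integral_congr_ae (Eventually.of_forall fun z => ?_)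
  simp only
  rw [← integral_const_mul]
  refine integral_congr_ae (Eventually.of_forall fun y => ?_)
  simp only; ring

/-- Almost all slices of a function with a weak derivative have a weak derivative. -/
lemma ae_hasWeakDeriv_slice {F H : E × Z → ℝ} (hFm : Measurable F) (hHm : Measurable H)
    (hF : MemLp F 2 (μ.prod ν)) (hH : MemLp H 2 (μ.prod ν)) {v : E}
    (h : ∀ f ∈ testFun E, ∀ θ ∈ testFun Z,
      ∫ p, F p * (fderiv ℝ f p.1 v * θ p.2) ∂(μ.prod ν)
        = -∫ p, H p * (f p.1 * θ p.2) ∂(μ.prod ν)) :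
    ∀ᵐ z ∂ν, HasWeakDeriv μ v (fun y => F (y, z)) fun y => H (y, z) := by
  -- For a fixed `f`, the defect is a locally integrable function of `z` whose pairing with every
  -- `θ` vanishes.
  have step : ∀ f ∈ testFun E, ∀ᵐ z ∂ν,
      (∫ y, F (y, z) * fderiv ℝ f y v ∂μ) + ∫ y, H (y, z) * f y ∂μ = 0 := by
    intro f hf
    have hloc : ∀ {F : E × Z → ℝ}, MemLp F 2 (μ.prod ν) → ∀ {f : E → ℝ}, f ∈ testFun E →
        LocallyIntegrable (fun z => ∫ y, F (y, z) * f y ∂μ) ν := fun hF f hf =>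
      locallyIntegrable_iff.2 fun K hK => integrableOn_integral_slice hF hf hK
    have h1 := hloc hF (fderiv_mem_testFun hf v)
    have h2 := hloc hH hf
    refine ae_eq_zero_of_integral_contDiff_smul_eq_zero (h1.add h2) fun θ hθ hc => ?_
    have hθt : θ ∈ testFun Z := ⟨hθ, hc⟩
    have i1 := h1.integrable_smul_left_of_hasCompactSupport hθ.continuous hc
    have i2 := h2.integrable_smul_left_of_hasCompactSupport hθ.continuous hc
    simp only [smul_add]
    rw [integral_add i1 i2]
    simp only [smul_eq_mul]
    rw [integral_slice_mul hF (fderiv_mem_testFun hf v) hθt, integral_slice_mul hH hf hθt,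
      h f hf θ hθt, neg_add_cancel]
  have : Fact ((2 : ENNReal) ≠ ⊤) := ⟨by norm_num⟩
  -- The exceptional null set must not depend on `f`. The identity is continuous in the pair `(f,
  -- ∂ᵥf)` in `L² × L²`, so a countable dense set of such pairs suffices.
  let P : testFun E → Lp ℝ 2 μ × Lp ℝ 2 μ := fun f =>
    (testFunToLp μ f, testFunToLp μ ⟨_, fderiv_mem_testFun f.2 v⟩)
  obtain ⟨S, hSc, hSd⟩ := TopologicalSpace.exists_countable_dense (range P)
  have hae : ∀ᵐ z ∂ν, ∀ p ∈ S,
      (∫ y, F (y, z) * fderiv ℝ (p.2.choose : testFun E).1 y v ∂μ)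
        + ∫ y, H (y, z) * (p.2.choose : testFun E).1 y ∂μ = 0 :=
    (ae_ball_iff hSc).2 fun p _ => step _ p.2.choose.2
  filter_upwards [hae, ae_memLp_slice hFm hF, ae_memLp_slice hHm hH] with z hz hFz hHz f hf
  have hval : ∀ {G : E → ℝ} (hG : MemLp G 2 μ) (f : testFun E),
      inner ℝ hG.toLp (testFunToLp μ f) = ∫ y, G y * f.1 y ∂μ := by
    intro G hG f
    rw [inner_testFunToLp]
    refine integral_congr_ae ?_
    filter_upwards [hG.coeFn_toLp] with y hy
    rw [hy]
  let Φ : range P → ℝ := fun p => inner ℝ hFz.toLp p.1.2 + inner ℝ hHz.toLp p.1.1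
  have hΦ : Continuous Φ := by fun_prop
  have hzero : S ⊆ {p | Φ p = 0} := by
    intro p hp
    have h1 := hz p hp
    have h2 := p.2.choose_spec
    change inner ℝ hFz.toLp p.1.2 + inner ℝ hHz.toLp p.1.1 = 0
    rw [← h2]
    simp only [P]
    rw [hval hFz, hval hHz]
    exact h1
  have hall := hSd.closure_eq ▸ (isClosed_eq hΦ continuous_const).closure_subset_iff.2 hzero
  have h3 : Φ ⟨P ⟨f, hf⟩, mem_range_self _⟩ = 0 := hall (mem_univ _)
  simp only [Φ, P] at h3
  rw [hval hFz, hval hHz] at h3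
  linarith

end Slices

/-! ### Product structure of the configurations with given particles in the box. -/

section Splitting

open Set Filter Topology

variable {N n : ℕ} {A : Finset (Fin N)}

/-! ### Separating the particles in a box from the others -/

/-- The configurations of the particles that are not in `A`. -/
abbrev OuterConfig (A : Finset (Fin N)) : Type := {j : Fin N // ¬ j ∈ A} → R3

/-- The separation of a configuration into the particles in `A`, shifted by `s`, and the others. -/
def splitEquiv (h : A.card = n) (s : R3) : Config N ≃ᵐ Config n × OuterConfig A :=
  (MeasurableEquiv.piEquivPiSubtypeProd (fun _ : Fin N => R3) (· ∈ A)).trans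
    ((MeasurableEquiv.arrowCongr' (A.orderIsoOfFin h).symm.toEquiv
      (MeasurableEquiv.addRight s)).prodCongr (MeasurableEquiv.refl _))

lemma splitEquiv_fst (h : A.card = n) (s : R3) (x : Config N) :
    (splitEquiv h s x).1 = fun k => x (A.orderEmbOfFin h k) + s := rfl

lemma splitEquiv_snd (h : A.card = n) (s : R3) (x : Config N) :
    (splitEquiv h s x).2 = fun j => x j.1 := rfl

lemma measurePreserving_splitEquiv (h : A.card = n) (s : R3) :
    MeasurePreserving (splitEquiv h s) := by
  let _ : Fintype {j // j ∈ A} := Subtype.fintype (· ∈ A)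
  have h1 := volume_preserving_piEquivPiSubtypeProd (fun _ : Fin N => R3) (· ∈ A)
  have h2 := volume_preserving_arrowCongr' (A.orderIsoOfFin h).symm.toEquiv
    (MeasurableEquiv.addRight s) (measurePreserving_add_right volume s)
  exact (h2.prod (MeasurePreserving.id (volume : Measure (OuterConfig A)))).comp h1

lemma continuous_splitEquiv_symm (h : A.card = n) (s : R3) :
    Continuous (splitEquiv h s).symm := by
  have e : ∀ p, (splitEquiv h s).symm p = fun j =>
      if hj : j ∈ A then p.1 ((A.orderIsoOfFin h).symm ⟨j, hj⟩) - s else p.2 ⟨j, hj⟩ := by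
    intro p
    rw [MeasurableEquiv.symm_apply_eq]
    refine Prod.ext ?_ ?_
    · rw [splitEquiv_fst]
      funext k
      have hk := A.orderEmbOfFin_mem h k
      have e : (⟨A.orderEmbOfFin h k, hk⟩ : {j // j ∈ A}) = A.orderIsoOfFin h k := rfl
      rw [dif_pos hk, e, OrderIso.symm_apply_apply, sub_add_cancel]
    · rw [splitEquiv_snd]
      funext j
      rw [dif_neg j.2]
  rw [funext e]
  refine continuous_pi fun j => ?_
  by_cases hj : j ∈ A
  · simp only [dif_pos hj]; fun_prop
  · simp only [dif_neg hj]; fun_prop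

/-- A product of test functions of the two groups of particles is a test function. -/
lemma tensor_mem_testFun (h : A.card = n) (s : R3) {f : Config n → ℝ} {θ : OuterConfig A → ℝ}
    (hf : f ∈ testFun (Config n)) (hθ : θ ∈ testFun (OuterConfig A)) :
    (fun x => f (splitEquiv h s x).1 * θ (splitEquiv h s x).2) ∈ testFun (Config N) := by
  constructor
  · simp only [splitEquiv_fst, splitEquiv_snd]
    refine (hf.1.comp ?_).mul (hθ.1.comp ?_)
    · exact contDiff_pi' fun k => (contDiff_apply ℝ R3 _).add contDiff_const
    · exact contDiff_pi' fun j => contDiff_apply ℝ R3 _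
  · refine HasCompactSupport.intro ((hf.2.isCompact.prod hθ.2.isCompact).image
      (continuous_splitEquiv_symm h s)) fun x hx => ?_
    have hx' : splitEquiv h s x ∉ tsupport f ×ˢ tsupport θ := fun hm =>
      hx ⟨_, hm, MeasurableEquiv.symm_apply_apply _ _⟩
    rw [mem_prod, not_and_or] at hx'
    rcases hx' with hp | hp
    · rw [image_eq_zero_of_notMem_tsupport hp, zero_mul]
    · rw [image_eq_zero_of_notMem_tsupport hp, mul_zero]

lemma fderiv_tensor (h : A.card = n) (s : R3) {f : Config n → ℝ} {θ : OuterConfig A → ℝ}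
    (hf : f ∈ testFun (Config n)) (hθ : θ ∈ testFun (OuterConfig A)) (k : Fin n) (a : Fin 3)
    (x : Config N) :
    fderiv ℝ (fun x => f (splitEquiv h s x).1 * θ (splitEquiv h s x).2) x
        (unitVec (A.orderEmbOfFin h k) a)
      = fderiv ℝ f (splitEquiv h s x).1 (unitVec k a) * θ (splitEquiv h s x).2 := by
  let L₁ : Config N →L[ℝ] Config n :=
    ContinuousLinearMap.pi fun k => ContinuousLinearMap.proj (A.orderEmbOfFin h k)
  let L₂ : Config N →L[ℝ] OuterConfig A :=
    ContinuousLinearMap.pi fun j => ContinuousLinearMap.proj j.1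
  have h1 : HasFDerivAt (fun x : Config N => (splitEquiv h s x).1) L₁ x :=
    L₁.hasFDerivAt.add_const fun _ => s
  have h2 : HasFDerivAt (fun x : Config N => (splitEquiv h s x).2) L₂ x := L₂.hasFDerivAt
  have hf' := (hf.1.differentiable (by simp) (splitEquiv h s x).1).hasFDerivAt.comp x h1
  have hθ' := (hθ.1.differentiable (by simp) (splitEquiv h s x).2).hasFDerivAt.comp x h2
  have e1 : L₁ (unitVec (A.orderEmbOfFin h k) a) = unitVec k a := by
    funext l
    change unitVec (A.orderEmbOfFin h k) a (A.orderEmbOfFin h l) = _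
    unfold unitVec
    by_cases hl : l = k
    · subst hl; simp
    · rw [Pi.single_eq_of_ne hl, Pi.single_eq_of_ne]
      exact fun e => hl ((A.orderEmbOfFin h).injective e)
  have e2 : L₂ (unitVec (A.orderEmbOfFin h k) a) = 0 := by
    funext j
    change unitVec (A.orderEmbOfFin h k) a j.1 = 0
    unfold unitVec
    rw [Pi.single_eq_of_ne]
    rintro e
    exact j.2 (e ▸ A.orderEmbOfFin_mem h k)
  have h3 := (hf'.mul hθ').fderiv
  refine (congrArg (fun T => T (unitVec (A.orderEmbOfFin h k) a)) h3).trans ?_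
  simp [e1, e2, mul_comm]

/-- A permutation of the particles in the box extends to all particles by fixing the others. Hence
slices of a symmetric function are symmetric, as the bosonic box problem requires. -/
lemma splitEquiv_symm_perm (h : A.card = n) (s : R3) (σ : Equiv.Perm (Fin n)) (y : Config n)
    (z : OuterConfig A) : ∃ τ : Equiv.Perm (Fin N),
    (splitEquiv h s).symm (fun k => y (σ k), z) = fun j => (splitEquiv h s).symm (y, z) (τ j) := by
  refine ⟨σ.extendDomain (A.orderIsoOfFin h).toEquiv, ?_⟩
  rw [MeasurableEquiv.symm_apply_eq]
  have h1 : (splitEquiv h s ((splitEquiv h s).symm (y, z))) = (y, z) :=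
    MeasurableEquiv.apply_symm_apply _ _
  refine Prod.ext ?_ ?_
  · rw [splitEquiv_fst]
    funext k
    have h2 := congrFun (congrArg Prod.fst h1) (σ k)
    rw [splitEquiv_fst] at h2
    have h3 : σ.extendDomain (A.orderIsoOfFin h).toEquiv (A.orderEmbOfFin h k)
        = A.orderEmbOfFin h (σ k) :=
      Equiv.Perm.extendDomain_apply_image σ (A.orderIsoOfFin h).toEquiv k
    rw [h3]
    exact h2.symm
  · rw [splitEquiv_snd]
    funext j
    have h2 := congrFun (congrArg Prod.snd h1) j
    rw [splitEquiv_snd] at h2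
    have h3 : σ.extendDomain (A.orderIsoOfFin h).toEquiv j.1 = j.1 :=
      Equiv.Perm.extendDomain_apply_not_subtype σ (A.orderIsoOfFin h).toEquiv j.2
    rw [h3]
    exact h2.symm

/-- The configurations with exactly the particles in `A` in the open cube of side `ℓ` around `-s`. -/
def occupied (ℓ : ℝ) (s : R3) (A : Finset (Fin N)) : Set (Config N) :=
  {x | ∀ j, (∀ i, -ℓ / 2 < (x j + s) i ∧ (x j + s) i < ℓ / 2) ↔ j ∈ A}

/-- The configurations of the particles outside `A` that avoid the cube. -/
def outerSet (ℓ : ℝ) (s : R3) (A : Finset (Fin N)) : Set (OuterConfig A) :=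
  {z | ∀ j, ¬ ∀ i, -ℓ / 2 < (z j + s) i ∧ (z j + s) i < ℓ / 2}

lemma measurableSet_outerSet (ℓ : ℝ) (s : R3) (A : Finset (Fin N)) :
    MeasurableSet (outerSet ℓ s A) := by
  have e : outerSet ℓ s A = ⋂ j, (⋂ i, {z : OuterConfig A |
      -ℓ / 2 < (z j + s) i ∧ (z j + s) i < ℓ / 2})ᶜ := by
    ext z; simp only [outerSet, mem_iInter, mem_compl_iff, mem_ofPred_eq]
  rw [e]
  refine MeasurableSet.iInter fun j => (MeasurableSet.iInter fun i => ?_).compl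
  have h : Measurable fun z : OuterConfig A => (z j + s) i := by fun_prop
  exact (measurableSet_lt measurable_const h).inter (measurableSet_lt h measurable_const)

lemma preimage_splitEquiv (h : A.card = n) (ℓ : ℝ) (s : R3) :
    splitEquiv h s ⁻¹' (boxConfig n (-ℓ / 2) (ℓ / 2) ×ˢ outerSet ℓ s A) = occupied ℓ s A := by
  ext x
  rw [mem_preimage, mem_prod, splitEquiv_fst, splitEquiv_snd]
  constructor
  · rintro ⟨h1, h2⟩ j
    by_cases hj : j ∈ A
    · refine ⟨fun _ => hj, fun _ => ?_⟩
      have := h1 ((A.orderIsoOfFin h).symm ⟨j, hj⟩)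
      have e : A.orderEmbOfFin h ((A.orderIsoOfFin h).symm ⟨j, hj⟩) = j := by
        rw [← Finset.coe_orderIsoOfFin_apply, OrderIso.apply_symm_apply]
      simpa only [e] using this
    · exact ⟨fun hx => absurd hx (h2 ⟨j, hj⟩), fun hj' => absurd hj' hj⟩
  · intro hx
    exact ⟨fun k => (hx _).2 (A.orderEmbOfFin_mem h k), fun j hj => j.2 ((hx j.1).1 hj)⟩

lemma measurableSet_occupied (ℓ : ℝ) (s : R3) (A : Finset (Fin N)) :
    MeasurableSet (occupied ℓ s A) := by
  rw [← preimage_splitEquiv rfl]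
  exact (splitEquiv rfl s).measurable
    ((isOpen_boxConfig _ _ _).measurableSet.prod (measurableSet_outerSet ℓ s A))

lemma integrable_split (h : A.card = n) (ℓ : ℝ) (s : R3) {g : Config N → ℝ}
    (hg : IntegrableOn g (occupied ℓ s A)) :
    Integrable (fun p => g ((splitEquiv h s).symm p))
      ((volume.restrict (boxConfig n (-ℓ / 2) (ℓ / 2))).prod
        (volume.restrict (outerSet ℓ s A))) := by
  rw [Measure.prod_restrict]
  rw [← preimage_splitEquiv h] at hg
  have := ((measurePreserving_splitEquiv h s).restrict_preimage_emb
    (splitEquiv h s).measurableEmbedding (boxConfig n (-ℓ / 2) (ℓ / 2) ×ˢ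
      outerSet ℓ s A)).integrable_comp_emb (splitEquiv h s).measurableEmbedding
    (g := fun p => g ((splitEquiv h s).symm p))
  refine this.1 (hg.congr (Eventually.of_forall fun x => ?_))
  simp

lemma setIntegral_occupied (h : A.card = n) (ℓ : ℝ) (s : R3) {g : Config N → ℝ}
    (hg : IntegrableOn g (occupied ℓ s A)) :
    ∫ x in occupied ℓ s A, g x = ∫ z in outerSet ℓ s A,
      ∫ y in boxConfig n (-ℓ / 2) (ℓ / 2), g ((splitEquiv h s).symm (y, z)) := by
  have h1 := integral_prod_symm _ (integrable_split h ℓ s hg)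
  rw [← h1, Measure.prod_restrict, ← preimage_splitEquiv h]
  have := (measurePreserving_splitEquiv h s).setIntegral_preimage_emb
    (splitEquiv h s).measurableEmbedding (fun p => g ((splitEquiv h s).symm p))
    (boxConfig n (-ℓ / 2) (ℓ / 2) ×ˢ outerSet ℓ s A)
  simp only [MeasurableEquiv.symm_apply_apply] at this
  exact this

end Splitting

/-! ### The box energy as a lower bound with the outer particles frozen. -/

section BoxBound

open Set Filter Topology

variable {N n : ℕ} {A : Finset (Fin N)} {B : ℕ → ℝ} {t ω ℓ ρ : ℝ} {χ : R3 → ℝ}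

lemma sum_eq_sum_orderEmbOfFin (h : A.card = n) (F : Fin N → ℝ) :
    ∑ j ∈ A, F j = ∑ k, F (A.orderEmbOfFin h k) := by
  conv_lhs => rw [← A.map_orderEmbOfFin_univ h, Finset.sum_map]
  rfl

lemma hasWeakDeriv_split (h : A.card = n) (s : R3) {Ψ G : Config N → ℝ} {k : Fin n} {a : Fin 3}
    (hw : HasWeakDeriv volume (unitVec (A.orderEmbOfFin h k) a) Ψ G) {f : Config n → ℝ}
    (hf : f ∈ testFun (Config n)) {θ : OuterConfig A → ℝ} (hθ : θ ∈ testFun (OuterConfig A)) :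
    ∫ p, Ψ ((splitEquiv h s).symm p) * (fderiv ℝ f p.1 (unitVec k a) * θ p.2)
        ∂((volume : Measure (Config n)).prod (volume : Measure (OuterConfig A)))
      = -∫ p, G ((splitEquiv h s).symm p) * (f p.1 * θ p.2)
        ∂((volume : Measure (Config n)).prod (volume : Measure (OuterConfig A))) := by
  have h1 := hw _ (tensor_mem_testFun h s hf hθ)
  simp only [fderiv_tensor h s hf hθ] at h1
  have hmp := measurePreserving_splitEquiv h s
  have hme := (splitEquiv h s).measurableEmbedding
  have e1 := hmp.integral_comp hme fun p =>
    Ψ ((splitEquiv h s).symm p) * (fderiv ℝ f p.1 (unitVec k a) * θ p.2)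
  have e2 := hmp.integral_comp hme fun p => G ((splitEquiv h s).symm p) * (f p.1 * θ p.2)
  simp only [MeasurableEquiv.symm_apply_apply] at e1 e2
  exact e1.symm.trans (h1.trans (congrArg Neg.neg e2))

/-- The energy of the particles in the box, the others being outside, is bounded below by the
ground state energy of the box. -/
theorem boxEnergy_mul_setIntegral_le (hχ : IsCutoff B t χ) (ht0 : 0 < t) (ht : t < 1 / 2)
    (hω : 0 ≤ ω) (hℓ : 0 < ℓ) (hρ : 0 ≤ ρ) (h : A.card = n) (s : R3) {Ψ : Config N → ℝ}
    (hΨm : Measurable Ψ) (hΨ : MemLp Ψ 2 volume)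
    (hsym : ∀ (σ : Equiv.Perm (Fin N)) x, Ψ (fun j => x (σ j)) = Ψ x)
    {G : Fin N → Fin 3 → Config N → ℝ}
    (hG : ∀ j a, Measurable (G j a) ∧ MemLp (G j a) 2 volume ∧
      HasWeakDeriv volume (unitVec j a) Ψ (G j a))
    (hi : IntegrableOn (fun x => potential (locYukawa χ ω ℓ) univ ρ (splitEquiv h s x).1 * Ψ x ^ 2)
      (occupied ℓ s A)) :
    boxEnergy χ ω ρ ℓ n * ∫ x in occupied ℓ s A, Ψ x ^ 2
      ≤ 1 / 2 * (gam χ)⁻¹ * (∑ j ∈ A, ∑ a, ∫ x in occupied ℓ s A, G j a x ^ 2)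
        + ∫ x in occupied ℓ s A,
          potential (locYukawa χ ω ℓ) univ ρ (splitEquiv h s x).1 * Ψ x ^ 2 := by
  have hmp := measurePreserving_splitEquiv h s
  have hmps : MeasurePreserving (splitEquiv h s).symm := hmp.symm _
  set D := boxConfig n (-ℓ / 2) (ℓ / 2) with hD
  set ι := A.orderEmbOfFin h with hι
  have hF : ∀ {F : Config N → ℝ}, MemLp F 2 volume → MemLp (fun p => F ((splitEquiv h s).symm p)) 2
      ((volume : Measure (Config n)).prod (volume : Measure (OuterConfig A))) := fun hF =>
    hF.comp_measurePreserving hmps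
  have hFm : ∀ {F : Config N → ℝ}, Measurable F →
      Measurable fun p => F ((splitEquiv h s).symm p) := fun hF =>
    hF.comp (splitEquiv h s).symm.measurable
  -- the estimate for almost every slice
  have hslice : ∀ᵐ z : OuterConfig A, ∀ k a, HasWeakDeriv volume (unitVec k a)
      (fun y => Ψ ((splitEquiv h s).symm (y, z)))
      fun y => G (ι k) a ((splitEquiv h s).symm (y, z)) := by
    rw [ae_all_iff]; intro k
    rw [ae_all_iff]; intro a
    exact ae_hasWeakDeriv_slice (hFm hΨm) (hFm (hG _ a).1) (hF hΨ) (hF (hG _ a).2.1)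
      fun f hf θ hθ => hasWeakDeriv_split h s (hG _ a).2.2 hf hθ
  have hsliceG : ∀ᵐ z : OuterConfig A, ∀ k a,
      MemLp (fun y => G (ι k) a ((splitEquiv h s).symm (y, z))) 2 volume := by
    rw [ae_all_iff]; intro k
    rw [ae_all_iff]; intro a
    exact ae_memLp_slice (hFm (hG _ a).1) (hF (hG _ a).2.1)
  have iΨ := integrable_split h ℓ s (hΨ.integrable_sq.integrableOn (s := occupied ℓ s A))
  have iG := fun k a => integrable_split h ℓ s
    ((hG (ι k) a).2.1.integrable_sq.integrableOn (s := occupied ℓ s A))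
  have iV := integrable_split h ℓ s hi
  -- For almost every position of the outer particles, the slice is an admissible trial function in
  -- the box. No boundary condition has to be checked, as the box carries Neumann conditions.
  have hbound : ∀ᵐ z ∂(volume.restrict (outerSet ℓ s A)),
      boxEnergy χ ω ρ ℓ n * ∫ y in D, Ψ ((splitEquiv h s).symm (y, z)) ^ 2
        ≤ 1 / 2 * (gam χ)⁻¹ * (∑ k, ∑ a, ∫ y in D, G (ι k) a ((splitEquiv h s).symm (y, z)) ^ 2)
          + ∫ y in D, potential (locYukawa χ ω ℓ) univ ρ
            (splitEquiv h s ((splitEquiv h s).symm (y, z))).1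
              * Ψ ((splitEquiv h s).symm (y, z)) ^ 2 := by
    filter_upwards [ae_restrict_of_ae hslice, ae_restrict_of_ae hsliceG,
      ae_restrict_of_ae (ae_memLp_slice (hFm hΨm) (hF hΨ)), iV.prod_left_ae] with z h1 h2 h3 h4
    simp only [MeasurableEquiv.apply_symm_apply] at h4 ⊢
    refine boxEnergy_mul_le hχ ht0 ht hω hℓ hρ (h3.restrict _) (fun σ y => ?_)
      (fun k a => (h2 k a).restrict _) (fun k a f hf _ => h1 k a f hf) h4
    obtain ⟨τ, hτ⟩ := splitEquiv_symm_perm h s σ y z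
    rw [hτ, hsym]
  have jΨ := iΨ.integral_prod_right
  have jG := fun k a => (iG k a).integral_prod_right
  have jV := iV.integral_prod_right
  have jGs : Integrable (fun z => ∑ k, ∑ a,
      ∫ y in D, G (ι k) a ((splitEquiv h s).symm (y, z)) ^ 2)
      (volume.restrict (outerSet ℓ s A)) :=
    integrable_finsetSum _ fun k _ => integrable_finsetSum _ fun a _ => jG k a
  have hmono := integral_mono_ae (jΨ.const_mul (boxEnergy χ ω ρ ℓ n))
    ((jGs.const_mul (1 / 2 * (gam χ)⁻¹)).add jV) hbound
  simp only [Pi.add_apply] at hmono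
  rw [integral_const_mul, integral_add (jGs.const_mul _) jV, integral_const_mul,
    integral_finsetSum _ fun k _ => integrable_finsetSum _ fun a _ => jG k a] at hmono
  simp_rw [integral_finsetSum _ fun a _ => jG _ a] at hmono
  have e : ∑ j ∈ A, ∑ a, ∫ x in occupied ℓ s A, G j a x ^ 2
      = ∑ k, ∑ a, ∫ x in occupied ℓ s A, G (ι k) a x ^ 2 :=
    sum_eq_sum_orderEmbOfFin h fun j => ∑ a, ∫ x in occupied ℓ s A, G j a x ^ 2
  rw [e, setIntegral_occupied h ℓ s hΨ.integrable_sq.integrableOn,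
    setIntegral_occupied h ℓ s hi]
  have e2 : ∀ k a, ∫ x in occupied ℓ s A, G (ι k) a x ^ 2 = _ := fun k a =>
    setIntegral_occupied h ℓ s (hG (ι k) a).2.1.integrable_sq.integrableOn
  simp only [e2]
  exact hmono

end BoxBound

/-! ### The slid potential compared with the potential of a full box. -/

section Comparison

open Set Filter Topology

variable {N n : ℕ} {A : Finset (Fin N)} {B : ℕ → ℝ} {t ω ℓ ρ : ℝ} {χ : R3 → ℝ} {Ω : Set R3}

/-- The open cube of side `ℓ` centred at the origin. -/
def openCube (ℓ : ℝ) : Set R3 := {x | ∀ i, -ℓ / 2 < x i ∧ x i < ℓ / 2}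

lemma integrable_locYukawa (hχ : IsCutoff B t χ) (ht0 : 0 < t) (hω : 0 ≤ ω) (hℓ : 0 < ℓ) (x : R3) :
    Integrable (locYukawa χ ω ℓ x) := by
  rw [← integrableOn_iff_integrable_of_support_subset (s := cube (-ℓ / 2) (ℓ / 2))]
  · exact (coulombBounded_locYukawa hχ hω hℓ).integrableOn (volume_cube_lt_top _ _).ne x
  · intro y hy
    by_contra h
    exact hy (locYukawa_eq_zero_right hχ ht0 hℓ (notMem_cube_of h) x)

lemma integrable_slide_right (hχ : IsCutoff B t χ) (ht0 : 0 < t) (hω : 0 ≤ ω) (hℓ : 0 < ℓ)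
    (s x : R3) : Integrable (slide (locYukawa χ ω ℓ) s x) :=
  (integrable_locYukawa hχ ht0 hω hℓ (x + s)).comp_add_right s

lemma integral_slide_right (s x : R3) :
    ∫ y, slide (locYukawa χ ω ℓ) s x y = ∫ z, locYukawa χ ω ℓ (x + s) z :=
  integral_add_right_eq_self (fun z => locYukawa χ ω ℓ (x + s) z) s

lemma sum_eq_sum_occupied (h : A.card = n) {F : Fin N → ℝ} (hF : ∀ j, j ∉ A → F j = 0) :
    ∑ j, F j = ∑ k, F (A.orderEmbOfFin h k) := by
  rw [← sum_eq_sum_orderEmbOfFin h]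
  exact (Finset.sum_subset (Finset.subset_univ A) fun j _ hj => hF j hj).symm

lemma slide_eq_zero_of_occupied (hχ : IsCutoff B t χ) (ht0 : 0 < t) (hℓ : 0 < ℓ) {s : R3}
    {x : Config N} (hx : x ∈ occupied ℓ s A) {j : Fin N} (hj : j ∉ A) (y : R3) :
    slide (locYukawa χ ω ℓ) s (x j) y = 0 :=
  locYukawa_eq_zero_left hχ ht0 hℓ (fun hb => hj ((hx j).1 hb)) _

/-- Pairs with a particle outside the box do not interact, and the enumeration of `A` is increasing,
so the pairs `i < j` in `A` correspond to the pairs `k < l`. -/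
lemma pair_sum_occupied (hχ : IsCutoff B t χ) (ht0 : 0 < t) (hℓ : 0 < ℓ) (h : A.card = n) {s : R3}
    {x : Config N} (hx : x ∈ occupied ℓ s A) :
    ∑ i, ∑ j ∈ Finset.Ioi i, slide (locYukawa χ ω ℓ) s (x i) (x j)
      = ∑ k, ∑ l ∈ Finset.Ioi k,
        locYukawa χ ω ℓ ((splitEquiv h s x).1 k) ((splitEquiv h s x).1 l) := by
  rw [sum_eq_sum_occupied h fun i hi => Finset.sum_eq_zero fun j _ =>
    slide_eq_zero_of_occupied hχ ht0 hℓ hx hi _]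
  refine Finset.sum_congr rfl fun k _ => ?_
  have e1 : ∀ (m : ℕ) (k : Fin m) (F : Fin m → ℝ),
      ∑ l ∈ Finset.Ioi k, F l = ∑ l, if k < l then F l else 0 := fun m k F => by
    rw [← Finset.sum_filter]
    congr 1
    ext l; simp
  rw [e1, e1, sum_eq_sum_occupied h fun j hj => ?_]
  · refine Finset.sum_congr rfl fun l _ => ?_
    exact if_congr (A.orderEmbOfFin h).lt_iff_lt rfl rfl
  · have : slide (locYukawa χ ω ℓ) s (x (A.orderEmbOfFin h k)) (x j) = 0 := by
      rw [slide, locYukawa_comm]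
      exact slide_eq_zero_of_occupied hχ ht0 hℓ hx hj _
    rw [this, ite_self]

lemma attraction_occupied (hχ : IsCutoff B t χ) (ht0 : 0 < t) (hℓ : 0 < ℓ) (h : A.card = n)
    {s : R3} {x : Config N} (hx : x ∈ occupied ℓ s A) :
    ∑ j, ∫ y, slide (locYukawa χ ω ℓ) s (x j) y
      = ∑ k, ∫ z, locYukawa χ ω ℓ ((splitEquiv h s x).1 k) z := by
  rw [sum_eq_sum_occupied h fun j hj => ?_]
  · exact Finset.sum_congr rfl fun k _ => integral_slide_right _ _
  · simp [slide_eq_zero_of_occupied hχ ht0 hℓ hx hj]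

lemma attraction_le (hχ : IsCutoff B t χ) (ht0 : 0 < t) (hω : 0 ≤ ω) (hℓ : 0 < ℓ) (s : R3)
    (x : Config N) : ∑ j, ∫ y in Ω, slide (locYukawa χ ω ℓ) s (x j) y
      ≤ ∑ j, ∫ y, slide (locYukawa χ ω ℓ) s (x j) y :=
  Finset.sum_le_sum fun _ _ => setIntegral_le_integral (integrable_slide_right hχ ht0 hω hℓ s _)
    (Eventually.of_forall fun _ => locYukawa_nonneg hχ _ _)

lemma potential_univ_eq (y : Config n) :
    potential (locYukawa χ ω ℓ) univ ρ y
      = (∑ k, ∑ l ∈ Finset.Ioi k, locYukawa χ ω ℓ (y k) (y l))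
        - ρ * (∑ k, ∫ z, locYukawa χ ω ℓ (y k) z) + selfEnergy χ ω ρ ℓ := by
  simp only [potential, selfEnergy, setIntegral_univ]

lemma selfEnergy_nonneg (hχ : IsCutoff B t χ) : 0 ≤ selfEnergy χ ω ρ ℓ := by
  have := background_nonneg (locYukawa_nonneg hχ (ω := ω) (ℓ := ℓ)) univ ρ
  simpa only [selfEnergy, setIntegral_univ] using this

/-- Removing the background outside `Ω` lowers the energy of a box by at most its self energy. -/
lemma potential_sub_selfEnergy_le (hχ : IsCutoff B t χ) (ht0 : 0 < t) (hω : 0 ≤ ω) (hℓ : 0 < ℓ)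
    (hρ : 0 ≤ ρ) (h : A.card = n) {s : R3} {x : Config N} (hx : x ∈ occupied ℓ s A) :
    potential (locYukawa χ ω ℓ) univ ρ (splitEquiv h s x).1 - selfEnergy χ ω ρ ℓ
      ≤ potential (slide (locYukawa χ ω ℓ) s) Ω ρ x := by
  have h1 := attraction_le (Ω := Ω) hχ ht0 hω hℓ s x
  rw [attraction_occupied hχ ht0 hℓ h hx] at h1
  have h2 := background_nonneg (fun y z => locYukawa_nonneg hχ (ω := ω) (ℓ := ℓ) (y + s) (z + s))
    Ω ρ
  have h3 := mul_le_mul_of_nonneg_left h1 hρ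
  rw [potential_univ_eq, ← pair_sum_occupied hχ ht0 hℓ h hx]
  unfold potential
  have h4 : 0 ≤ 1 / 2 * ρ ^ 2 * ∫ y in Ω, ∫ z in Ω, slide (locYukawa χ ω ℓ) s y z := h2
  linarith

/-- If the box lies in `Ω`, its energy is not changed. -/
lemma potential_le_of_subset (hχ : IsCutoff B t χ) (ht0 : 0 < t) (hω : 0 ≤ ω) (hℓ : 0 < ℓ)
    (hρ : 0 ≤ ρ) (h : A.card = n) {s : R3} (hs : ∀ y, y + s ∈ openCube ℓ → y ∈ Ω) {x : Config N}
    (hx : x ∈ occupied ℓ s A) :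
    potential (locYukawa χ ω ℓ) univ ρ (splitEquiv h s x).1
      ≤ potential (slide (locYukawa χ ω ℓ) s) Ω ρ x := by
  have h1 := attraction_le (Ω := Ω) hχ ht0 hω hℓ s x
  rw [attraction_occupied hχ ht0 hℓ h hx] at h1
  have h3 := mul_le_mul_of_nonneg_left h1 hρ
  have h4 : ∫ y in Ω, ∫ z in Ω, slide (locYukawa χ ω ℓ) s y z
      = ∫ y, ∫ z, locYukawa χ ω ℓ y z := by
    have e1 : ∀ y, ∫ z in Ω, slide (locYukawa χ ω ℓ) s y z
        = ∫ z, locYukawa χ ω ℓ (y + s) z := fun y => by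
      rw [← integral_slide_right]
      exact setIntegral_eq_integral_of_forall_compl_eq_zero fun z hz =>
        locYukawa_eq_zero_right hχ ht0 hℓ (fun hb => hz (hs z hb)) _
    simp only [e1]
    rw [setIntegral_eq_integral_of_forall_compl_eq_zero fun y hy => ?_]
    · exact integral_add_right_eq_self (fun y => ∫ z, locYukawa χ ω ℓ y z) s
    · simp [locYukawa_eq_zero_left hχ ht0 hℓ (fun hb => hy (hs y hb))]
  rw [potential_univ_eq, ← pair_sum_occupied hχ ht0 hℓ h hx]
  unfold potential
  rw [h4]
  have h5 : selfEnergy χ ω ρ ℓ = 1 / 2 * ρ ^ 2 * ∫ y, ∫ z, locYukawa χ ω ℓ y z := rfl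
  linarith

/-- If the box does not meet `Ω`, its energy is nonnegative. -/
lemma potential_nonneg_of_disjoint (hχ : IsCutoff B t χ) (ht0 : 0 < t) (hℓ : 0 < ℓ)
    {s : R3} (hs : ∀ y ∈ Ω, y + s ∉ openCube ℓ) (x : Config N) :
    0 ≤ potential (slide (locYukawa χ ω ℓ) s) Ω ρ x := by
  have h1 : ∀ a, ∫ y in Ω, slide (locYukawa χ ω ℓ) s a y = 0 := fun a =>
    setIntegral_eq_zero_of_forall_eq_zero fun y hy =>
      locYukawa_eq_zero_right hχ ht0 hℓ (hs y hy) _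
  unfold potential
  simp only [h1, integral_zero, Finset.sum_const_zero, mul_zero, sub_zero, add_zero]
  exact pair_sum_nonneg (v := slide (locYukawa χ ω ℓ) s)
    (fun a b => locYukawa_nonneg hχ (a + s) (b + s)) x

/-- Reversing the sign of the background charge makes all three terms nonnegative, which gives a
dominating function of the same shape. -/
lemma abs_potential_le {v : R3 → R3 → ℝ} (hv0 : ∀ x y, 0 ≤ v x y) (hρ : 0 ≤ ρ) (x : Config N) :
    |potential v Ω ρ x| ≤ potential v Ω (-ρ) x := by
  have h1 := pair_sum_nonneg hv0 x
  have h2 := background_nonneg hv0 Ω ρ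
  have h3 : 0 ≤ ρ * ∑ j, ∫ y in Ω, v (x j) y :=
    mul_nonneg hρ (Finset.sum_nonneg fun j _ => integral_nonneg fun _ => hv0 _ _)
  unfold potential
  rw [neg_sq, abs_le]
  constructor <;> linarith

lemma potential_neg_le {v : R3 → R3 → ℝ} (hv : CoulombBounded v) (hΩ : volume Ω ≠ ⊤) (hρ : 0 ≤ ρ)
    (x : Config N) : potential v Ω (-ρ) x ≤ (∑ i, ∑ j ∈ Finset.Ioi i, coulomb (x i) (x j))
      + (ρ * (N * backgroundBound Ω) + 1 / 2 * ρ ^ 2 * ∫ y in Ω, ∫ z in Ω, v y z) := by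
  have h1 : ∑ i, ∑ j ∈ Finset.Ioi i, v (x i) (x j)
      ≤ ∑ i, ∑ j ∈ Finset.Ioi i, coulomb (x i) (x j) :=
    Finset.sum_le_sum fun i _ => Finset.sum_le_sum fun j _ => (le_abs_self _).trans (hv.abs_le _ _)
  have h2 : ∑ j, ∫ y in Ω, v (x j) y ≤ N * backgroundBound Ω := by
    calc ∑ j, ∫ y in Ω, v (x j) y ≤ ∑ _j : Fin N, backgroundBound Ω :=
          Finset.sum_le_sum fun j _ => hv.setIntegral_le hΩ _
      _ = _ := by simp
  have h3 := mul_le_mul_of_nonneg_left h2 hρ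
  unfold potential
  rw [neg_sq]
  linarith

/-- Potentials that are dominated by the Coulomb repulsion are integrable. -/
lemma integrableOn_mul_sq_of_le {Ψ f P : Config N → ℝ} {S : Set (Config N)} (hS : MeasurableSet S)
    (hfm : Measurable f) (hΨm : Measurable Ψ) (hΨ : MemLp Ψ 2 volume)
    (hP : Integrable fun x => P x * Ψ x ^ 2) {c : ℝ} (h : ∀ x ∈ S, |f x| ≤ P x + c) :
    IntegrableOn (fun x => f x * Ψ x ^ 2) S := by
  refine ((hP.add (hΨ.integrable_sq.const_mul c)).integrableOn (s := S)).mono'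
    (hfm.mul (hΨm.pow_const 2)).aestronglyMeasurable ?_
  filter_upwards [ae_restrict_mem hS] with x hx
  rw [norm_mul, Real.norm_eq_abs, Real.norm_of_nonneg (sq_nonneg (Ψ x))]
  simp only [Pi.add_apply]
  nlinarith [h x hx, sq_nonneg (Ψ x)]

end Comparison

/-! ### The energy in one box, summed over its possible occupants. -/

section OneBox

open Set Filter Topology

variable {N : ℕ} {B : ℕ → ℝ} {t ω ℓ ρ : ℝ} {χ : R3 → ℝ} {Ω : Set R3}

lemma measurableSet_openCube (ℓ : ℝ) : MeasurableSet (openCube ℓ) := by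
  have e : openCube ℓ = ⋂ i, {x : R3 | -ℓ / 2 < x i ∧ x i < ℓ / 2} := by
    ext x; simp only [openCube, mem_iInter, mem_ofPred_eq]
  rw [e]
  refine MeasurableSet.iInter fun i => ?_
  have h : Measurable fun x : R3 => x i := by fun_prop
  exact (measurableSet_lt measurable_const h).inter (measurableSet_lt h measurable_const)

lemma integral_eq_sum_occupied (ℓ : ℝ) (s : R3) {F : Config N → ℝ} (hF : Integrable F) :
    ∫ x, F x = ∑ A : Finset (Fin N), ∫ x in occupied ℓ s A, F x := by
  rw [← integral_iUnion_fintype (fun A => measurableSet_occupied ℓ s A) ?_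
    fun A => hF.integrableOn]
  · have : ⋃ A : Finset (Fin N), occupied ℓ s A = univ := by
      classical
      refine eq_univ_of_forall fun x => mem_iUnion.2
        ⟨Finset.univ.filter fun j => ∀ i, -ℓ / 2 < (x j + s) i ∧ (x j + s) i < ℓ / 2, fun j => ?_⟩
      rw [Finset.mem_filter_univ]
    rw [this, setIntegral_univ]
  · intro A A' hAA
    refine disjoint_left.2 fun x hx hx' => hAA ?_
    ext j
    rw [← hx j, ← hx' j]

lemma setIntegral_occupied_indicator (ℓ : ℝ) (s : R3) (A : Finset (Fin N)) (j : Fin N)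
    (g : Config N → ℝ) :
    ∫ x in occupied ℓ s A, (openCube ℓ).indicator (fun _ => (1 : ℝ)) (x j + s) * g x
      = if j ∈ A then ∫ x in occupied ℓ s A, g x else 0 := by
  have h : ∀ x ∈ occupied ℓ s A, (openCube ℓ).indicator (fun _ => (1 : ℝ)) (x j + s) * g x
      = if j ∈ A then g x else 0 := by
    intro x hx
    by_cases hj : j ∈ A
    · have hm : x j + s ∈ openCube ℓ := (hx j).2 hj
      rw [indicator_of_mem hm, one_mul, if_pos hj]
    · have hm : x j + s ∉ openCube ℓ := fun hb => hj ((hx j).1 hb)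
      rw [indicator_of_notMem hm, zero_mul, if_neg hj]
  rw [setIntegral_congr_fun (measurableSet_occupied ℓ s A) h]
  by_cases hj : j ∈ A <;> simp [hj]

lemma integrable_indicator_mul (ℓ : ℝ) (s : R3) (j : Fin N) {g : Config N → ℝ}
    (hg : Integrable g) :
    Integrable fun x => (openCube ℓ).indicator (fun _ => (1 : ℝ)) (x j + s) * g x := by
  refine hg.bdd_mul (c := 1) ?_ (Eventually.of_forall fun x => ?_)
  · have h1 : Measurable fun x : Config N => x j + s := by fun_prop
    exact ((measurable_const.indicator (measurableSet_openCube ℓ)).comp h1).aestronglyMeasurable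
  · rw [Real.norm_eq_abs, abs_le]
    by_cases hm : x j + s ∈ openCube ℓ <;> simp [hm]

lemma measurable_pair_sum {v : R3 → R3 → ℝ} (hv : Measurable (Function.uncurry v)) :
    Measurable fun x : Config N => ∑ i, ∑ j ∈ Finset.Ioi i, v (x i) (x j) := by
  refine Finset.measurable_fun_sum _ fun i _ => Finset.measurable_fun_sum _ fun j _ => ?_
  have h1 : Measurable fun x : Config N => (x i, x j) := by fun_prop
  exact hv.comp h1

/-- The energy of all particles, with the interaction and the kinetic energy restricted to one
box. -/
theorem mul_integral_le_energy_in_box (hχ : IsCutoff B t χ) (ht0 : 0 < t) (ht : t < 1 / 2)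
    (hω : 0 ≤ ω) (hℓ : 0 < ℓ) (hρ : 0 ≤ ρ) (hΩ : volume Ω ≠ ⊤) {s : R3} {Ψ : Config N → ℝ}
    (hΨm : Measurable Ψ) (hΨ : MemLp Ψ 2 volume)
    (hsym : ∀ (σ : Equiv.Perm (Fin N)) x, Ψ (fun j => x (σ j)) = Ψ x)
    {G : Fin N → Fin 3 → Config N → ℝ}
    (hG : ∀ j a, Measurable (G j a) ∧ MemLp (G j a) 2 volume ∧
      HasWeakDeriv volume (unitVec j a) Ψ (G j a))
    (hP : Integrable fun x => (∑ i, ∑ j ∈ Finset.Ioi i, coulomb (x i) (x j)) * Ψ x ^ 2)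
    {e δ : ℝ} (he : ∀ n, 1 ≤ n → n ≤ N → e ≤ boxEnergy χ ω ρ ℓ n)
    (heb : e ≤ selfEnergy χ ω ρ ℓ)
    (hδ : ∀ (A : Finset (Fin N)), ∀ x ∈ occupied ℓ s A,
      potential (locYukawa χ ω ℓ) univ ρ (splitEquiv (A := A) rfl s x).1 - δ
        ≤ potential (slide (locYukawa χ ω ℓ) s) Ω ρ x) :
    (e - δ) * ∫ x, Ψ x ^ 2
      ≤ 1 / 2 * (gam χ)⁻¹ * (∑ j, ∑ a,
          ∫ x, (openCube ℓ).indicator (fun _ => (1 : ℝ)) (x j + s) * G j a x ^ 2)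
        + ∫ x, potential (slide (locYukawa χ ω ℓ) s) Ω ρ x * Ψ x ^ 2 := by
  have hsB := coulombBounded_slide_locYukawa hχ hω hℓ s
  have hwB := coulombBounded_locYukawa hχ hω hℓ
  have hcube : volume (cube (-ℓ / 2) (ℓ / 2)) ≠ ⊤ := (volume_cube_lt_top _ _).ne
  have hnn : ∀ x y, 0 ≤ slide (locYukawa χ ω ℓ) s x y := fun x y =>
    locYukawa_nonneg hχ (x + s) (y + s)
  have hΨ2 := hΨ.integrable_sq
  have hW : Integrable fun x => potential (slide (locYukawa χ ω ℓ) s) Ω ρ x * Ψ x ^ 2 := by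
    rw [← integrableOn_univ]
    exact integrableOn_mul_sq_of_le MeasurableSet.univ (measurable_potential hsB Ω ρ N) hΨm hΨ hP
      fun x _ => (abs_potential_le hnn hρ x).trans (potential_neg_le hsB hΩ hρ x)
  have hV : ∀ A : Finset (Fin N), IntegrableOn (fun x =>
      potential (locYukawa χ ω ℓ) univ ρ (splitEquiv (A := A) rfl s x).1 * Ψ x ^ 2)
      (occupied ℓ s A) := by
    intro A
    set c : ℝ := ρ * (A.card * backgroundBound (cube (-ℓ / 2) (ℓ / 2))) + selfEnergy χ ω ρ ℓ
      with hc
    have hb := selfEnergy_nonneg (ω := ω) (ρ := ρ) (ℓ := ℓ) hχ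
    have hbg : 0 ≤ ρ * (A.card * backgroundBound (cube (-ℓ / 2) (ℓ / 2))) := by
      have := ballPotential_nonneg
      unfold backgroundBound
      positivity
    refine integrableOn_mul_sq_of_le (c := c) (measurableSet_occupied ℓ s A)
      ((measurable_potential hwB univ ρ A.card).comp
        (measurable_fst.comp (splitEquiv rfl s).measurable)) hΨm hΨ hP fun x hx => ?_
    have h0 : 0 ≤ ∑ i, ∑ j ∈ Finset.Ioi i, coulomb (x i) (x j) := pair_sum_nonneg coulomb_nonneg x
    rw [abs_le]
    constructor
    · have := neg_le_potential hwB (locYukawa_nonneg hχ) hcube hρ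
        (splitEquiv (A := A) rfl s x).1
      rw [← potential_locYukawa_univ hχ ht0 hℓ] at this
      linarith
    · have h1 := potential_le_pair_sum (locYukawa_nonneg hχ (ω := ω) (ℓ := ℓ)) hρ (Ω := univ)
        (splitEquiv (A := A) rfl s x).1
      rw [← pair_sum_occupied hχ ht0 hℓ rfl hx] at h1
      have h2 : ∑ i, ∑ j ∈ Finset.Ioi i, slide (locYukawa χ ω ℓ) s (x i) (x j)
          ≤ ∑ i, ∑ j ∈ Finset.Ioi i, coulomb (x i) (x j) :=
        Finset.sum_le_sum fun i _ => Finset.sum_le_sum fun j _ =>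
          (le_abs_self _).trans (hsB.abs_le _ _)
      have h3 : selfEnergy χ ω ρ ℓ
          = 1 / 2 * ρ ^ 2 * ∫ y in univ, ∫ z in univ, locYukawa χ ω ℓ y z := by
        simp only [selfEnergy, setIntegral_univ]
      linarith
  have hκ : 0 ≤ 1 / 2 * (gam χ)⁻¹ := by
    have := hχ.gam_pos ht
    positivity
  have hpiece : ∀ A : Finset (Fin N), (e - δ) * ∫ x in occupied ℓ s A, Ψ x ^ 2
      ≤ 1 / 2 * (gam χ)⁻¹ * (∑ j ∈ A, ∑ a, ∫ x in occupied ℓ s A, G j a x ^ 2)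
        + ∫ x in occupied ℓ s A, potential (slide (locYukawa χ ω ℓ) s) Ω ρ x * Ψ x ^ 2 := by
    intro A
    have h0 : 0 ≤ ∫ x in occupied ℓ s A, Ψ x ^ 2 := integral_nonneg fun x => sq_nonneg _
    have h1 : (∫ x in occupied ℓ s A,
        potential (locYukawa χ ω ℓ) univ ρ (splitEquiv (A := A) rfl s x).1 * Ψ x ^ 2)
          - δ * ∫ x in occupied ℓ s A, Ψ x ^ 2
        ≤ ∫ x in occupied ℓ s A, potential (slide (locYukawa χ ω ℓ) s) Ω ρ x * Ψ x ^ 2 := by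
      rw [← integral_const_mul, ← integral_sub (hV A) (hΨ2.integrableOn.const_mul δ)]
      refine setIntegral_mono_on ((hV A).sub (hΨ2.integrableOn.const_mul δ)) hW.integrableOn
        (measurableSet_occupied ℓ s A) fun x hx => ?_
      nlinarith [hδ A x hx, sq_nonneg (Ψ x)]
    have h2 : e * ∫ x in occupied ℓ s A, Ψ x ^ 2
        ≤ 1 / 2 * (gam χ)⁻¹ * (∑ j ∈ A, ∑ a, ∫ x in occupied ℓ s A, G j a x ^ 2)
          + ∫ x in occupied ℓ s A,
            potential (locYukawa χ ω ℓ) univ ρ (splitEquiv (A := A) rfl s x).1 * Ψ x ^ 2 := by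
      -- The empty box is not among `1 ≤ n ≤ N`; its potential is exactly the self energy, and `heb`
      -- covers it.
      rcases A.eq_empty_or_nonempty with rfl | hA
      · have e1 : ∀ x, potential (locYukawa χ ω ℓ) univ ρ
            (splitEquiv (A := (∅ : Finset (Fin N))) rfl s x).1 = selfEnergy χ ω ρ ℓ := by
          intro x
          have : ∀ F : Fin (∅ : Finset (Fin N)).card → ℝ, ∑ k, F k = 0 := fun F =>
            Finset.sum_eq_zero fun k _ => absurd k.2 (by simp)
          rw [potential_univ_eq, this, this]
          ring
        simp only [e1, Finset.sum_empty, mul_zero, zero_add]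
        rw [integral_const_mul]
        exact mul_le_mul_of_nonneg_right heb h0
      · have hc1 : 1 ≤ A.card := Finset.card_pos.2 hA
        have hc2 : A.card ≤ N := by simpa using Finset.card_le_univ A
        exact (mul_le_mul_of_nonneg_right (he _ hc1 hc2) h0).trans
          (boxEnergy_mul_setIntegral_le hχ ht0 ht hω hℓ hρ rfl s hΨm hΨ hsym hG (hV A))
    linarith
  have hG2 : ∀ j a, Integrable fun x => G j a x ^ 2 := fun j a => (hG j a).2.1.integrable_sq
  rw [integral_eq_sum_occupied ℓ s hΨ2, integral_eq_sum_occupied ℓ s hW]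
  -- On the piece labelled `A` the indicator selects precisely the particles `j ∈ A`, so the
  -- localized kinetic energy is the sum of the kinetic energies seen by the boxes.
  have hkin : ∑ j, ∑ a, ∫ x, (openCube ℓ).indicator (fun _ => (1 : ℝ)) (x j + s) * G j a x ^ 2
      = ∑ A : Finset (Fin N), ∑ j ∈ A, ∑ a, ∫ x in occupied ℓ s A, G j a x ^ 2 := by
    have e1 : ∀ j a, ∫ x, (openCube ℓ).indicator (fun _ => (1 : ℝ)) (x j + s) * G j a x ^ 2
        = ∑ A : Finset (Fin N), if j ∈ A then ∫ x in occupied ℓ s A, G j a x ^ 2 else 0 := by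
      intro j a
      rw [integral_eq_sum_occupied ℓ s (integrable_indicator_mul ℓ s j (hG2 j a))]
      exact Finset.sum_congr rfl fun A _ => setIntegral_occupied_indicator ℓ s A j _
    simp only [e1]
    have e2 : ∀ A : Finset (Fin N), ∑ j ∈ A, ∑ a, ∫ x in occupied ℓ s A, G j a x ^ 2
        = ∑ j, ∑ a, if j ∈ A then ∫ x in occupied ℓ s A, G j a x ^ 2 else 0 := by
      intro A
      have e3 : ∀ j, (∑ a, if j ∈ A then ∫ x in occupied ℓ s A, G j a x ^ 2 else 0)
          = if j ∈ A then ∑ a, ∫ x in occupied ℓ s A, G j a x ^ 2 else 0 := fun j => by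
        by_cases hj : j ∈ A <;> simp [hj]
      simp only [e3]
      rw [Finset.sum_ite_mem, Finset.univ_inter]
    simp only [e2]
    symm
    rw [Finset.sum_comm]
    exact Finset.sum_congr rfl fun j _ => Finset.sum_comm
  rw [hkin, Finset.mul_sum, Finset.mul_sum, ← Finset.sum_add_distrib]
  exact Finset.sum_le_sum fun A _ => hpiece A

end OneBox

/-! ### Fubini for the kinetic and potential energies over all box positions. -/

section Averaging

open Set Filter Topology

variable {N : ℕ} {B : ℕ → ℝ} {t ω ℓ ρ : ℝ} {χ : R3 → ℝ} {Ω : Set R3}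

/-! ### Averaging over the position of the box -/

lemma integrable_indicator_translate (hℓ : 0 < ℓ) (a : R3) :
    Integrable fun u : R3 => (openCube ℓ).indicator (fun _ => (1 : ℝ)) (a + ℓ • u) := by
  have hfin : volume (openCube ℓ) ≠ ⊤ :=
    ((measure_mono fun x hx i => ⟨(hx i).1.le, (hx i).2.le⟩).trans_lt
      (volume_cube_lt_top (-ℓ / 2) (ℓ / 2))).ne
  have h1 : Integrable ((openCube ℓ).indicator fun _ : R3 => (1 : ℝ)) :=
    (integrable_indicator_iff (measurableSet_openCube ℓ)).2 (integrableOn_const hfin)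
  exact (h1.comp_add_left a).comp_smul hℓ.ne'

lemma integral_indicator_translate_le (hℓ : 0 < ℓ) (a : R3) :
    ∫ u : R3, (openCube ℓ).indicator (fun _ => (1 : ℝ)) (a + ℓ • u) ≤ 1 := by
  have hsub : openCube ℓ ⊆ cube (-ℓ / 2) (ℓ / 2) := fun x hx i => ⟨(hx i).1.le, (hx i).2.le⟩
  have h1 : volume.real (openCube ℓ) ≤ ℓ ^ 3 := by
    refine (measureReal_mono hsub (volume_cube_lt_top _ _).ne).trans (le_of_eq ?_)
    rw [volume_real_cube (by linarith)]
    ring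
  rw [Measure.integral_comp_smul volume
    (fun v => (openCube ℓ).indicator (fun _ => (1 : ℝ)) (a + v)) ℓ,
    integral_add_left_eq_self (fun v => (openCube ℓ).indicator (fun _ => (1 : ℝ)) v) a,
    integral_indicator (measurableSet_openCube ℓ), setIntegral_const, finrank_euclideanSpace,
    Fintype.card_fin, smul_eq_mul, smul_eq_mul, mul_one, abs_of_pos (by positivity),
    inv_mul_le_iff₀ (by positivity), mul_one]
  exact h1

/-- In the variable `u`, the positions of the box that contain a given particle have total volume at
most one. The average thus costs no kinetic energy beyond the original. -/
lemma kinetic_average (hℓ : 0 < ℓ) (j : Fin N) {g : Config N → ℝ} (hgm : Measurable g)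
    (hg : Integrable g) (hg0 : ∀ x, 0 ≤ g x) :
    Integrable (Function.uncurry fun (u : R3) (x : Config N) =>
      (openCube ℓ).indicator (fun _ => (1 : ℝ)) (x j + ℓ • u) * g x) ∧
    ∫ u : R3, ∫ x : Config N, (openCube ℓ).indicator (fun _ => (1 : ℝ)) (x j + ℓ • u) * g x
      ≤ ∫ x, g x := by
  have hind : Measurable ((openCube ℓ).indicator fun _ : R3 => (1 : ℝ)) :=
    measurable_const.indicator (measurableSet_openCube ℓ)
  have hnn : ∀ v : R3, 0 ≤ (openCube ℓ).indicator (fun _ => (1 : ℝ)) v := fun v =>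
    indicator_nonneg (fun _ _ => zero_le_one) v
  have hm : Measurable (Function.uncurry fun (u : R3) (x : Config N) =>
      (openCube ℓ).indicator (fun _ => (1 : ℝ)) (x j + ℓ • u) * g x) := by
    have h1 : Measurable fun p : R3 × Config N => p.2 j + ℓ • p.1 := by fun_prop
    exact (hind.comp h1).mul (hgm.comp measurable_snd)
  have hin : ∀ x : Config N, ∫ u : R3,
      (openCube ℓ).indicator (fun _ => (1 : ℝ)) (x j + ℓ • u) * g x ≤ g x := fun x => by
    rw [integral_mul_const]
    exact mul_le_of_le_one_left (hg0 x) (integral_indicator_translate_le hℓ _)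
  have hmi : Measurable fun x : Config N => ∫ u : R3,
      (openCube ℓ).indicator (fun _ => (1 : ℝ)) (x j + ℓ • u) * g x :=
    hm.stronglyMeasurable.integral_prod_left.measurable
  have hii : Integrable fun x : Config N => ∫ u : R3,
      (openCube ℓ).indicator (fun _ => (1 : ℝ)) (x j + ℓ • u) * g x := by
    refine hg.mono' hmi.aestronglyMeasurable (Eventually.of_forall fun x => ?_)
    rw [Real.norm_of_nonneg (integral_nonneg fun u => mul_nonneg (hnn _) (hg0 x))]
    exact hin x
  have hint : Integrable (Function.uncurry fun (u : R3) (x : Config N) =>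
      (openCube ℓ).indicator (fun _ => (1 : ℝ)) (x j + ℓ • u) * g x) := by
    refine (integrable_prod_iff' hm.aestronglyMeasurable).2 ⟨Eventually.of_forall fun x =>
      (integrable_indicator_translate hℓ (x j)).mul_const (g x), ?_⟩
    refine hii.congr (Eventually.of_forall fun x => ?_)
    refine integral_congr_ae (Eventually.of_forall fun u => ?_)
    exact (Real.norm_of_nonneg (mul_nonneg (hnn _) (hg0 x))).symm
  refine ⟨hint, ?_⟩
  rw [integral_integral_swap hint]
  exact integral_mono hii hg hin

lemma measurable_potential_slide (hχ : IsCutoff B t χ) (Ω : Set R3) (ρ : ℝ) :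
    Measurable fun p : R3 × Config N => potential (slide (locYukawa χ ω ℓ) (ℓ • p.1)) Ω ρ p.2 := by
  have h0 := measurable_slide_uncurry (ω := ω) (ℓ := ℓ) hχ
  have h1 : ∀ i j : Fin N, Measurable fun p : R3 × Config N =>
      slide (locYukawa χ ω ℓ) (ℓ • p.1) (p.2 i) (p.2 j) := fun i j => by
    have h : Measurable fun p : R3 × Config N => ((p.2 i, p.2 j), p.1) :=
      (((measurable_pi_apply i).comp measurable_snd).prodMk
        ((measurable_pi_apply j).comp measurable_snd)).prodMk measurable_fst
    simpa only [Function.comp_def] using h0.comp h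
  have h2 : ∀ j : Fin N, Measurable fun p : R3 × Config N =>
      ∫ y in Ω, slide (locYukawa χ ω ℓ) (ℓ • p.1) (p.2 j) y := fun j => by
    have h : Measurable fun q : (R3 × Config N) × R3 => ((q.1.2 j, q.2), q.1.1) :=
      (((measurable_pi_apply j).comp (measurable_snd.comp measurable_fst)).prodMk
        measurable_snd).prodMk (measurable_fst.comp measurable_fst)
    have h' : Measurable fun q : (R3 × Config N) × R3 =>
        slide (locYukawa χ ω ℓ) (ℓ • q.1.1) (q.1.2 j) q.2 := by
      simpa only [Function.comp_def] using h0.comp h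
    exact (h'.stronglyMeasurable.integral_prod_right' (ν := volume.restrict Ω)).measurable
  have h3 : Measurable fun q : R3 × R3 => ∫ z in Ω, slide (locYukawa χ ω ℓ) (ℓ • q.1) q.2 z := by
    have h : Measurable fun q : (R3 × R3) × R3 => ((q.1.2, q.2), q.1.1) :=
      ((measurable_snd.comp measurable_fst).prodMk measurable_snd).prodMk
        (measurable_fst.comp measurable_fst)
    have h' : Measurable fun q : (R3 × R3) × R3 =>
        slide (locYukawa χ ω ℓ) (ℓ • q.1.1) q.1.2 q.2 := by
      simpa only [Function.comp_def] using h0.comp h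
    exact (h'.stronglyMeasurable.integral_prod_right' (ν := volume.restrict Ω)).measurable
  have h4 : Measurable fun u : R3 =>
      ∫ y in Ω, ∫ z in Ω, slide (locYukawa χ ω ℓ) (ℓ • u) y z :=
    (h3.stronglyMeasurable.integral_prod_right' (ν := volume.restrict Ω)).measurable
  have h5 : Measurable fun p : R3 × Config N =>
      ∑ i, ∑ j ∈ Finset.Ioi i, slide (locYukawa χ ω ℓ) (ℓ • p.1) (p.2 i) (p.2 j) :=
    Finset.measurable_fun_sum _ fun i _ => Finset.measurable_fun_sum _ fun j _ => h1 i j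
  have h6 : Measurable fun p : R3 × Config N =>
      ∑ j, ∫ y in Ω, slide (locYukawa χ ω ℓ) (ℓ • p.1) (p.2 j) y :=
    Finset.measurable_fun_sum _ fun j _ => h2 j
  exact (h5.sub (h6.const_mul ρ)).add ((h4.comp measurable_fst).const_mul _)

/-- The pointwise averaging identity is integrated against `Ψ²`; the interchange of integrals is
where the integrable Coulomb repulsion `hP` is needed. -/
lemma potential_average (hχ : IsCutoff B t χ) (ht : t < 1 / 2) (hω : 0 ≤ ω) (hℓ : 0 < ℓ)
    (hρ : 0 ≤ ρ) (hΩ : volume Ω ≠ ⊤) {Ψ : Config N → ℝ} (hΨm : Measurable Ψ)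
    (hΨ : MemLp Ψ 2 volume)
    (hP : Integrable fun x => (∑ i, ∑ j ∈ Finset.Ioi i, coulomb (x i) (x j)) * Ψ x ^ 2) :
    Integrable (Function.uncurry fun (u : R3) (x : Config N) =>
      potential (slide (locYukawa χ ω ℓ) (ℓ • u)) Ω ρ x * Ψ x ^ 2) ∧
    Integrable (fun x => potential (slideAverage χ ω ℓ) Ω ρ x * Ψ x ^ 2) ∧
    gam χ * ∫ u : R3, ∫ x : Config N, potential (slide (locYukawa χ ω ℓ) (ℓ • u)) Ω ρ x * Ψ x ^ 2
      = ∫ x, potential (slideAverage χ ω ℓ) Ω ρ x * Ψ x ^ 2 := by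
  have hK := coulombBounded_slideAverage (χ := χ) hχ ht hω hℓ
  have hK0 : ∀ x y, 0 ≤ slideAverage χ ω ℓ x y := fun x y =>
    mul_nonneg (corr_nonneg hχ ht _) (yukawa_nonneg _ _)
  have hγ := hχ.gam_pos ht
  have hm : Measurable (Function.uncurry fun (u : R3) (x : Config N) =>
      potential (slide (locYukawa χ ω ℓ) (ℓ • u)) Ω ρ x * Ψ x ^ 2) :=
    (measurable_potential_slide hχ Ω ρ).mul ((hΨm.comp measurable_snd).pow_const 2)
  have hAi : ∀ σ : ℝ, |σ| = ρ →
      Integrable fun x => potential (slideAverage χ ω ℓ) Ω σ x * Ψ x ^ 2 := by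
    intro σ hσ
    rw [← integrableOn_univ]
    refine integrableOn_mul_sq_of_le MeasurableSet.univ (measurable_potential hK Ω σ N) hΨm hΨ hP
      fun x _ => le_trans ?_ (potential_neg_le hK hΩ hρ x)
    rcases abs_choice σ with h | h
    · rw [hσ] at h
      rw [← h]
      exact abs_potential_le hK0 hρ x
    · rw [hσ] at h
      have : σ = -ρ := by linarith
      rw [this]
      have h1 := (abs_nonneg _).trans (abs_potential_le (Ω := Ω) hK0 hρ x)
      rw [abs_of_nonneg h1]
  have hswap : ∀ x : Config N, ∫ u, potential (slide (locYukawa χ ω ℓ) (ℓ • u)) Ω ρ x * Ψ x ^ 2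
      = (gam χ)⁻¹ * (potential (slideAverage χ ω ℓ) Ω ρ x * Ψ x ^ 2) := fun x => by
    rw [integral_mul_const, ← (integral_potential_slide hχ ht hω hℓ hΩ ρ x).2]
    field_simp
  have hint : Integrable (Function.uncurry fun (u : R3) (x : Config N) =>
      potential (slide (locYukawa χ ω ℓ) (ℓ • u)) Ω ρ x * Ψ x ^ 2) := by
    refine (integrable_prod_iff' hm.aestronglyMeasurable).2 ⟨Eventually.of_forall fun x =>
      (integral_potential_slide hχ ht hω hℓ hΩ ρ x).1.mul_const (Ψ x ^ 2), ?_⟩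
    refine ((hAi (-ρ) (by rw [abs_neg, abs_of_nonneg hρ])).const_mul (gam χ)⁻¹).mono'
      hm.norm.stronglyMeasurable.integral_prod_left'.aestronglyMeasurable
      (Eventually.of_forall fun x => ?_)
    rw [Real.norm_of_nonneg (integral_nonneg fun u => norm_nonneg _)]
    -- The averaging identity at `-ρ` computes the average of the dominating potential exactly.
    have h1 := integral_potential_slide hχ ht hω hℓ hΩ (-ρ) x
    calc ∫ u, ‖potential (slide (locYukawa χ ω ℓ) (ℓ • u)) Ω ρ x * Ψ x ^ 2‖
        ≤ ∫ u, potential (slide (locYukawa χ ω ℓ) (ℓ • u)) Ω (-ρ) x * Ψ x ^ 2 := by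
          refine integral_mono
            ((integral_potential_slide hχ ht hω hℓ hΩ ρ x).1.mul_const _).norm
            (h1.1.mul_const _) fun u => ?_
          simp only
          rw [norm_mul, Real.norm_eq_abs, Real.norm_of_nonneg (sq_nonneg _)]
          refine mul_le_mul_of_nonneg_right (abs_potential_le (fun a b => ?_) hρ x) (sq_nonneg _)
          exact locYukawa_nonneg hχ (a + ℓ • u) (b + ℓ • u)
      _ = (gam χ)⁻¹ * (potential (slideAverage χ ω ℓ) Ω (-ρ) x * Ψ x ^ 2) := by
          rw [integral_mul_const, ← h1.2]
          field_simp
  refine ⟨hint, hAi ρ (abs_of_nonneg hρ), ?_⟩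
  rw [integral_integral_swap hint]
  simp only [hswap]
  rw [integral_const_mul, mul_inv_cancel_left₀ hγ.ne']

end Averaging

/-! ### Symmetry, self energy and form domain for the ground state bound. -/

section GroundState

open Set Filter Topology

variable {N : ℕ} {B : ℕ → ℝ} {t ω ℓ L ρ : ℝ} {χ : R3 → ℝ} {Ω : Set R3}

lemma pair_sum_perm {v : R3 → R3 → ℝ} (hv : ∀ x y, v x y = v y x) (σ : Equiv.Perm (Fin N))
    (x : Config N) :
    ∑ i, ∑ j ∈ Finset.Ioi i, v (x (σ i)) (x (σ j)) = ∑ i, ∑ j ∈ Finset.Ioi i, v (x i) (x j) := by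
  have h1 := sum_sum_eq_two_mul_add (f := fun i j => v (x i) (x j)) fun i j => hv _ _
  have h2 := sum_sum_eq_two_mul_add (f := fun i j => v (x (σ i)) (x (σ j))) fun i j => hv _ _
  have h3 : ∑ i, ∑ j, v (x (σ i)) (x (σ j)) = ∑ i, ∑ j, v (x i) (x j) := by
    rw [Equiv.sum_comp σ fun i => ∑ j, v (x i) (x (σ j))]
    exact Finset.sum_congr rfl fun i _ => Equiv.sum_comp σ fun j => v (x i) (x j)
  have h4 : ∑ i, v (x (σ i)) (x (σ i)) = ∑ i, v (x i) (x i) :=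
    Equiv.sum_comp σ fun i => v (x i) (x i)
  linarith

lemma potential_perm {v : R3 → R3 → ℝ} (hv : ∀ x y, v x y = v y x) (Ω : Set R3) (ρ : ℝ)
    (σ : Equiv.Perm (Fin N)) (x : Config N) :
    potential v Ω ρ (fun j => x (σ j)) = potential v Ω ρ x := by
  unfold potential
  rw [pair_sum_perm hv, Equiv.sum_comp σ fun j => ∫ y in Ω, v (x j) y]

lemma ae_injective (N : ℕ) : ∀ᵐ x : Config N, Function.Injective x := by
  have h : ∀ i j : Fin N, i ≠ j → ∀ᵐ x : Config N, x i ≠ x j := by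
    intro i j hij
    let S : Submodule ℝ (Config N) := LinearMap.ker
      (LinearMap.proj (R := ℝ) (φ := fun _ : Fin N => R3) i - LinearMap.proj j)
    have hS : S ≠ ⊤ := by
      intro htop
      have hm : (Pi.single i (EuclideanSpace.single 0 (1 : ℝ)) : Config N) ∈ S :=
        htop ▸ Submodule.mem_top
      simp only [S, LinearMap.mem_ker, LinearMap.sub_apply, LinearMap.proj_apply, Pi.single_eq_same,
        Pi.single_eq_of_ne hij.symm, sub_zero] at hm
      have := congrFun (congrArg WithLp.ofLp hm) 0
      simp at this
    have h0 := Measure.addHaar_submodule volume S hS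
    rw [← compl_mem_ae_iff] at h0
    filter_upwards [h0] with x hx hxe
    refine hx ?_
    simp only [S, SetLike.mem_coe, LinearMap.mem_ker, LinearMap.sub_apply, LinearMap.proj_apply]
    exact sub_eq_zero.2 hxe
  have h' : ∀ᵐ x : Config N, ∀ i j : Fin N, i ≠ j → x i ≠ x j := by
    rw [ae_all_iff]; intro i
    rw [ae_all_iff]; intro j
    by_cases hij : i = j
    · exact Eventually.of_forall fun x hne => absurd hij hne
    · filter_upwards [h i j hij] with x hx _ using hx
  filter_upwards [h'] with x hx i j hij
  by_contra hne
  exact hx i j hne hij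

/-- The product of the two cutoffs is replaced by the mean of their squares, so that `∫ χ² = γ⁻¹`
appears and cancels the factor `γ` in the next estimate. -/
lemma locYukawa_le (hχ : IsCutoff B t χ) (hω : 0 ≤ ω) (hℓ : 0 < ℓ) (x y : R3) :
    locYukawa χ ω ℓ x y
      ≤ 1 / 2 * (χ (ℓ⁻¹ • x) ^ 2 * coulomb x y) + 1 / 2 * (χ (ℓ⁻¹ • y) ^ 2 * coulomb x y) := by
  have h1 := yukawa_le_coulomb (div_nonneg hω hℓ.le) x y
  have h2 := hχ.nonneg (ℓ⁻¹ • x)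
  have h3 := hχ.nonneg (ℓ⁻¹ • y)
  have h4 := coulomb_nonneg x y
  have h5 : locYukawa χ ω ℓ x y ≤ χ (ℓ⁻¹ • x) * coulomb x y * χ (ℓ⁻¹ • y) := by
    unfold locYukawa
    gcongr
  nlinarith [mul_nonneg h4 (sq_nonneg (χ (ℓ⁻¹ • x) - χ (ℓ⁻¹ • y)))]

/-- The self energy of the background in a box is at most of the order `ℓ⁵`. -/
lemma gam_mul_selfEnergy_le (hχ : IsCutoff B t χ) (ht0 : 0 < t) (ht : t < 1 / 2) (hω : 0 ≤ ω)
    (hℓ : 0 < ℓ) : gam χ * selfEnergy χ ω ρ ℓ ≤ 1 / 2 * ρ ^ 2 * ((ballPotential + 1) * ℓ ^ 5) := by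
  set Q := cube (-ℓ / 2) (ℓ / 2) with hQ
  have hQf : volume Q ≠ ⊤ := (volume_cube_lt_top _ _).ne
  have : IsFiniteMeasure (volume.restrict Q) := isFiniteMeasure_restrict.2 hQf
  have hwB := coulombBounded_locYukawa hχ hω hℓ
  have hγ := hχ.gam_pos ht
  have hbp := ballPotential_nonneg
  have hχm := hχ.continuous.measurable
  have hsq : ∀ z, χ z ^ 2 ≤ 1 := fun z => pow_le_one₀ (hχ.nonneg z) (hχ.le_one z)
  let F : R3 → R3 → ℝ := fun y z => χ (ℓ⁻¹ • y) ^ 2 * coulomb y z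
  have hF : CoulombBounded F := by
    have hc := measurable_coulomb
    constructor
    · have h1 : Measurable fun p : R3 × R3 => χ (ℓ⁻¹ • p.1) ^ 2 := by fun_prop
      exact h1.mul hc
    · intro y z
      rw [abs_of_nonneg (mul_nonneg (sq_nonneg _) (coulomb_nonneg _ _))]
      exact mul_le_of_le_one_left (coulomb_nonneg _ _) (hsq _)
  have hFi := hF.integrable_prod hQf hQf
  have hF' : ∫ y in Q, ∫ z in Q, F z y = ∫ y in Q, ∫ z in Q, F y z :=
    (integral_integral_swap hFi).symm
  have h1 : ∫ y, ∫ z, locYukawa χ ω ℓ y z = ∫ y in Q, ∫ z in Q, locYukawa χ ω ℓ y z := by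
    -- With no particles and `ρ = 1` the potential is just half the double integral.
    have := potential_locYukawa_univ (n := 0) (ω := ω) hχ ht0 hℓ 1 (fun _ => 0)
    simpa [potential] using this
  have h2 : ∫ y in Q, ∫ z in Q, locYukawa χ ω ℓ y z ≤ ∫ y in Q, ∫ z in Q, F y z := by
    have hFs : Integrable (Function.uncurry fun y z => F z y)
        ((volume.restrict Q).prod (volume.restrict Q)) := hFi.swap
    have h3 : ∫ y in Q, ∫ z in Q, locYukawa χ ω ℓ y z
        ≤ ∫ y in Q, ∫ z in Q, (1 / 2 * F y z + 1 / 2 * F z y) := by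
      have hi := hwB.integrable_prod hQf hQf
      have hj := (hFi.const_mul (1 / 2)).add (hFs.const_mul (1 / 2))
      have e1 := integral_prod _ hi
      have e2 := integral_prod _ hj
      refine (e1.symm.le.trans (integral_mono hi hj fun p => ?_)).trans e2.le
      have := locYukawa_le hχ hω hℓ p.1 p.2
      simp only [Function.uncurry_def, Pi.add_apply, F, coulomb_comm p.2 p.1]
      exact this
    refine h3.trans (le_of_eq ?_)
    have e3 : ∀ᵐ y ∂(volume.restrict Q), ∫ z in Q, (1 / 2 * F y z + 1 / 2 * F z y)
        = 1 / 2 * (∫ z in Q, F y z) + 1 / 2 * ∫ z in Q, F z y := by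
      filter_upwards [hFs.prod_right_ae] with y hy
      have hy' : Integrable (fun z => F z y) (volume.restrict Q) := hy
      have hy'' : Integrable (fun z => F y z) (volume.restrict Q) := hF.integrableOn hQf y
      exact (integral_add (hy''.const_mul (1 / 2)) (hy'.const_mul (1 / 2))).trans
        (congrArg₂ (· + ·) (integral_const_mul _ _) (integral_const_mul _ _))
    have i1 : Integrable (fun y => ∫ z in Q, F y z) (volume.restrict Q) := hFi.integral_prod_left
    have i2 : Integrable (fun y => ∫ z in Q, F z y) (volume.restrict Q) := hFs.integral_prod_left
    rw [integral_congr_ae e3, integral_add (i1.const_mul _) (i2.const_mul _), integral_const_mul,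
      integral_const_mul, hF']
    ring
  -- The inner Coulomb integral over a cube of side `ℓ` is `O(ℓ²)`, and `∫ χ(y/ℓ)² = ℓ³/γ`. The
  -- constant is therefore independent of `χ` and `t`.
  have h3 : ∫ y in Q, ∫ z in Q, F y z ≤ (gam χ)⁻¹ * ((ballPotential + 1) * ℓ ^ 5) := by
    have hs : Integrable fun y : R3 => χ (ℓ⁻¹ • y) ^ 2 :=
      hχ.integrable_sq.comp_smul (inv_ne_zero hℓ.ne')
    have hb : ∀ y, ∫ z in Q, F y z ≤ χ (ℓ⁻¹ • y) ^ 2 * ((ballPotential + 1) * ℓ ^ 2) := by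
      intro y
      simp only [F]
      rw [integral_const_mul]
      refine mul_le_mul_of_nonneg_left ((setIntegral_coulomb_le hQf y hℓ).trans (le_of_eq ?_))
        (sq_nonneg _)
      rw [hQ, volume_real_cube (by linarith)]
      field_simp
      ring
    calc ∫ y in Q, ∫ z in Q, F y z
        ≤ ∫ y in Q, χ (ℓ⁻¹ • y) ^ 2 * ((ballPotential + 1) * ℓ ^ 2) :=
          integral_mono hFi.integral_prod_left (hs.integrableOn.mul_const _) hb
      _ ≤ ∫ y, χ (ℓ⁻¹ • y) ^ 2 * ((ballPotential + 1) * ℓ ^ 2) :=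
          setIntegral_le_integral (hs.mul_const _) (Eventually.of_forall fun y => by positivity)
      _ = (gam χ)⁻¹ * ((ballPotential + 1) * ℓ ^ 5) := by
          rw [integral_mul_const, Measure.integral_comp_inv_smul volume (fun y => χ y ^ 2) ℓ,
            finrank_euclideanSpace, Fintype.card_fin, smul_eq_mul, abs_of_pos (by positivity), gam,
            inv_inv]
          ring
  have h4 : gam χ * ∫ y, ∫ z, locYukawa χ ω ℓ y z ≤ (ballPotential + 1) * ℓ ^ 5 := by
    rw [h1]
    calc gam χ * ∫ y in Q, ∫ z in Q, locYukawa χ ω ℓ y z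
        ≤ gam χ * ((gam χ)⁻¹ * ((ballPotential + 1) * ℓ ^ 5)) :=
          mul_le_mul_of_nonneg_left (h2.trans h3) hγ.le
      _ = _ := mul_inv_cancel_left₀ hγ.ne' _
  unfold selfEnergy
  calc gam χ * (1 / 2 * ρ ^ 2 * ∫ y, ∫ z, locYukawa χ ω ℓ y z)
      = 1 / 2 * ρ ^ 2 * (gam χ * ∫ y, ∫ z, locYukawa χ ω ℓ y z) := by ring
    _ ≤ _ := mul_le_mul_of_nonneg_left h4 (by positivity)

/-- The form domain of the Coulomb Hamiltonian is not trivial. -/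
lemma exists_memFormDomain (hΩ : volume Ω ≠ ⊤) (hρ : 0 ≤ ρ) (N : ℕ) :
    ∃ ψ : L2 (univ : Set (Config N)), ψ ≠ 0 ∧ MemFormDomain univ (potential coulomb Ω ρ) ψ := by
  -- Particles on a line at mutual distance at least one. A bump of radius `1/3` keeps them `1/3`
  -- apart, so every pair repulsion is at most `3` on its support.
  let x₀ : Config N := fun j => EuclideanSpace.single 0 ((j : ℕ) : ℝ)
  let b : ContDiffBump x₀ := ⟨1 / 6, 1 / 3, by norm_num, by norm_num⟩
  have hb : (b : Config N → ℝ) ∈ testFun (Config N) := ⟨b.contDiff, b.hasCompactSupport⟩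
  have hbL : MemLp (b : Config N → ℝ) 2 volume := memLp_testFun hb
  have toC : ∀ {h : Config N → ℝ}, h ∈ testFun (Config N) →
      MemLp (fun x => (h x : ℂ)) 2 (volume.restrict univ) := fun hh =>
    memLp_ofReal_of_hasCompactSupport hh.1.continuous hh.2 _
  have hco := (toC hb).coeFn_toLp
  refine ⟨MemLp.toLp _ (toC hb), fun h0 => ?_, ⟨fun j a =>
    MemLp.toLp _ (toC (fderiv_mem_testFun hb (unitVec j a))), fun j a f hf hc _ => ?_⟩, ?_⟩
  · rw [h0] at hco
    have h1 : (fun x => ((b x : ℝ) : ℂ)) =ᵐ[volume] fun _ => 0 := by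
      have h1 : (fun x => ((b x : ℝ) : ℂ)) =ᵐ[volume.restrict univ] fun _ => 0 :=
        hco.symm.trans (Lp.coeFn_zero ℂ 2 _)
      rwa [Measure.restrict_univ] at h1
    have h2 := (Continuous.ae_eq_iff_eq volume
      (Complex.continuous_ofReal.comp hb.1.continuous) continuous_const).1 h1
    have h3 := congrFun h2 x₀
    have h4 : b x₀ = 1 := b.one_of_mem_closedBall (Metric.mem_closedBall_self b.rIn_pos.le)
    simp [h4] at h3
  · have hft : f ∈ testFun (Config N) := ⟨hf, hc⟩
    have e1 : ∀ {h q : Config N → ℝ} (hh : h ∈ testFun (Config N)),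
        ∫ x in univ, MemLp.toLp _ (toC hh) x * ((q x : ℝ) : ℂ) = ((∫ x, h x * q x : ℝ) : ℂ) := by
      intro h q hh
      rw [← setIntegral_univ (f := fun x => h x * q x)]
      refine Eq.trans (integral_congr_ae ?_) (integral_ofReal (𝕜 := ℂ))
      filter_upwards [(toC hh).coeFn_toLp] with x hx
      rw [hx]; norm_cast
    have h1 : ∫ x, b x * fderiv ℝ f x (unitVec j a) = -∫ x, fderiv ℝ b x (unitVec j a) * f x :=
      integral_mul_fderiv_eq_neg_fderiv_mul_of_integrable
        (integrable_mul_testFun (memLp_testFun (fderiv_mem_testFun hb _)) hft)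
        (integrable_mul_testFun hbL (fderiv_mem_testFun hft _))
        (integrable_mul_testFun hbL hft)
        (fun x _ => hb.1.differentiable (by simp) x) (fun x _ => hf.differentiable (by simp) x)
    rw [e1 hb, e1 (fderiv_mem_testFun hb _), h1]
    push_cast; rfl
  · have hm : Measurable (potential coulomb Ω ρ : Config N → ℝ) :=
      measurable_potential coulombBounded_coulomb Ω ρ N
    have hbound : ∀ x ∈ Metric.closedBall x₀ (1 / 3), |potential coulomb Ω ρ x|
        ≤ 0 + ((∑ i : Fin N, ∑ _j ∈ Finset.Ioi i, 3) + (ρ * (N * backgroundBound Ω)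
          + 1 / 2 * ρ ^ 2 * ∫ y in Ω, ∫ z in Ω, coulomb y z)) := by
      intro x hx
      rw [zero_add]
      refine (abs_potential_le coulomb_nonneg hρ x).trans
        ((potential_neg_le coulombBounded_coulomb hΩ hρ x).trans ?_)
      gcongr with i _ j hj
      have hij : (i : ℕ) + 1 ≤ j := Finset.mem_Ioi.1 hj
      have hij' : ((i : ℕ) : ℝ) + 1 ≤ (j : ℕ) := by exact_mod_cast hij
      have hd : ∀ k, ‖x k - x₀ k‖ ≤ 1 / 3 := fun k => by
        rw [← Pi.sub_apply]
        exact (norm_le_pi_norm _ k).trans (mem_closedBall_iff_norm.1 hx)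
      have h0 : ‖x₀ j - x₀ i‖ = (j : ℕ) - (i : ℕ) := by
        have : x₀ j - x₀ i = EuclideanSpace.single 0 (((j : ℕ) : ℝ) - (i : ℕ)) := by
          ext k
          by_cases hk : k = 0 <;> simp [x₀, hk]
        rw [this, PiLp.norm_single, Real.norm_of_nonneg (by linarith)]
      have h1 : ‖x₀ j - x₀ i‖ ≤ ‖x j - x₀ j‖ + ‖x i - x j‖ + ‖x i - x₀ i‖ := by
        have e : x₀ j - x₀ i = -(x j - x₀ j) - (x i - x j) + (x i - x₀ i) := by abel
        rw [e]
        refine (norm_add_le _ _).trans ?_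
        gcongr
        refine (norm_sub_le _ _).trans ?_
        rw [norm_neg]
      have h2 : 1 / 3 ≤ ‖x i - x j‖ := by linarith [hd i, hd j]
      unfold coulomb
      rw [inv_le_comm₀ (by linarith) (by norm_num)]
      linarith
    have h1 := integrableOn_mul_sq_of_le (P := fun _ => 0) Metric.isClosed_closedBall.measurableSet
      hm hb.1.continuous.measurable hbL (by simp) hbound
    rw [integrableOn_iff_integrable_of_support_subset] at h1
    · refine h1.integrableOn.congr ?_
      filter_upwards [hco] with x hx
      rw [hx, Complex.norm_real, Real.norm_eq_abs, sq_abs]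
    · intro x hx
      by_contra hx'
      refine hx ?_
      have : b x = 0 := b.zero_of_le_dist (not_le.1 hx').le
      simp [this]

end GroundState

/-! ### The lower bound for the ground state energy. -/

section EnergyBound

open Set Filter Topology

variable {N : ℕ} {B : ℕ → ℝ} {t ω ℓ L ρ : ℝ} {χ : R3 → ℝ}

lemma slide_notMem_openCube (hℓ : 0 < ℓ) {u : R3} (hu : u ∉ cube (-1 / 2 - L / ℓ) (1 / 2)) :
    ∀ y ∈ cube 0 L, y + ℓ • u ∉ openCube ℓ := by
  intro y hy h
  refine hu fun i => ?_
  have h1 := h i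
  have h2 := hy i
  simp only [PiLp.add_apply, PiLp.smul_apply, smul_eq_mul] at h1
  have h3 : L / ℓ * ℓ = L := div_mul_cancel₀ _ hℓ.ne'
  constructor <;> nlinarith

lemma mem_cube_of_slide_mem (hℓ : 0 < ℓ) {u : R3} (hu : u ∈ cube (1 / 2 - L / ℓ) (-1 / 2)) :
    ∀ y, y + ℓ • u ∈ openCube ℓ → y ∈ cube 0 L := by
  intro y h i
  have h1 := h i
  have h2 := hu i
  simp only [PiLp.add_apply, PiLp.smul_apply, smul_eq_mul] at h1
  have h3 : L / ℓ * ℓ = L := div_mul_cancel₀ _ hℓ.ne'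
  constructor <;> nlinarith

/-- The energy of a symmetric function is at least the average of its energies in the small
boxes; the boxes that meet the boundary of the background cause the error `(L/ℓ)² ρ² ℓ⁵`. -/
theorem energy_lower_bound_of_symmetric (hχ : IsCutoff B t χ) (ht0 : 0 < t) (ht : t < 1 / 2)
    (hω : ω = omegaConst B * (t ^ 4)⁻¹) (hℓ : 0 < ℓ) (hℓL : ℓ ≤ L) (hρ : 0 ≤ ρ)
    {Ψ : Config N → ℝ} (hΨm : Measurable Ψ) (hΨ : MemLp Ψ 2 volume)
    (hsym : ∀ (σ : Equiv.Perm (Fin N)) x, Ψ (fun j => x (σ j)) = Ψ x)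
    {G : Fin N → Fin 3 → Config N → ℝ}
    (hG : ∀ j a, Measurable (G j a) ∧ MemLp (G j a) 2 volume ∧
      HasWeakDeriv volume (unitVec j a) Ψ (G j a))
    (hU : Integrable fun x => potential coulomb (cube 0 L) ρ x * Ψ x ^ 2)
    {e : ℝ} (he : ∀ n, 1 ≤ n → n ≤ N → e ≤ boxEnergy χ ω ρ ℓ n)
    (heb : e ≤ selfEnergy χ ω ρ ℓ) :
    ((1 + L / ℓ) ^ 3 * gam χ * e - 4 * (ballPotential + 1) * (L / ℓ) ^ 2 * ρ ^ 2 * ℓ ^ 5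
        - ω * N / (2 * ℓ)) * ∫ x, Ψ x ^ 2
      ≤ 1 / 2 * (∑ j, ∑ a, ∫ x, G j a x ^ 2)
        + ∫ x, potential coulomb (cube 0 L) ρ x * Ψ x ^ 2 := by
  set Ω := cube 0 L
  set R := L / ℓ with hR
  have hR1 : 1 ≤ R := (one_le_div hℓ).2 hℓL
  have hω1 : 1 ≤ ω := hω ▸ one_le_omega B ht0 ht
  have hω0 : 0 ≤ ω := zero_le_one.trans hω1
  have hΩ : volume Ω ≠ ⊤ := (volume_cube_lt_top 0 L).ne
  have hγ := hχ.gam_pos ht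
  set b := selfEnergy χ ω ρ ℓ with hb
  have hb0 : 0 ≤ b := selfEnergy_nonneg hχ
  set m := ∫ x, Ψ x ^ 2 with hm
  have hm0 : 0 ≤ m := integral_nonneg fun x => sq_nonneg _
  -- Finite total potential energy gives finite repulsion, since the attraction is bounded and the
  -- background energy nonnegative.
  have hP : Integrable fun x => (∑ i, ∑ j ∈ Finset.Ioi i, coulomb (x i) (x j)) * Ψ x ^ 2 := by
    refine (hU.add (hΨ.integrable_sq.const_mul (ρ * (N * backgroundBound Ω)))).mono'
      ((measurable_pair_sum measurable_coulomb).mul (hΨm.pow_const 2)).aestronglyMeasurable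
      (Eventually.of_forall fun x => ?_)
    have h1 := pair_sum_le_potential coulombBounded_coulomb coulomb_nonneg hΩ hρ x
    have h2 := pair_sum_nonneg coulomb_nonneg x
    rw [Real.norm_of_nonneg (mul_nonneg h2 (sq_nonneg _))]
    simp only [Pi.add_apply]
    nlinarith [sq_nonneg (Ψ x)]
  obtain ⟨hp1, hp2, hp3⟩ := potential_average (ω := ω) hχ ht hω0 hℓ hρ hΩ hΨm hΨ hP
  have hK := fun j a => kinetic_average hℓ j (g := fun x => G j a x ^ 2)
    ((hG j a).1.pow_const 2) (hG j a).2.1.integrable_sq fun x => sq_nonneg _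
  let K : Fin N → Fin 3 → R3 → ℝ := fun j a u =>
    ∫ x : Config N, (openCube ℓ).indicator (fun _ => (1 : ℝ)) (x j + ℓ • u) * G j a x ^ 2
  let W : R3 → ℝ := fun u =>
    ∫ x : Config N, potential (slide (locYukawa χ ω ℓ) (ℓ • u)) Ω ρ x * Ψ x ^ 2
  have hKi : ∀ j a, Integrable (K j a) := fun j a => (hK j a).1.integral_prod_left
  have hWi : Integrable W := hp1.integral_prod_left
  have hK0 : ∀ j a u, 0 ≤ K j a u := fun j a u => integral_nonneg fun x =>
    mul_nonneg (indicator_nonneg (fun _ _ => zero_le_one) _) (sq_nonneg _)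
  -- In units of `ℓ`: outside `M` the open box misses the background, and in `I` it lies inside the
  -- background. The sides are `R + 1` and `R - 1`.
  set M := cube (-1 / 2 - R) (1 / 2)
  set I := cube (1 / 2 - R) (-1 / 2)
  have hMm : MeasurableSet M := (isCompact_cube _ _).measurableSet
  have hIm : MeasurableSet I := (isCompact_cube _ _).measurableSet
  -- The lower bound per position: `e` in the interior, `e - b` for boxes across the boundary, and
  -- `0` for boxes away from the background.
  let q : R3 → ℝ := fun u => M.indicator (fun _ => (e - b) * m) u + I.indicator (fun _ => b * m) u
  have hIM : I ⊆ M := fun u hu i => ⟨by linarith [(hu i).1], by linarith [(hu i).2]⟩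
  have hqi1 : Integrable (M.indicator fun _ => (e - b) * m) :=
    (integrable_indicator_iff hMm).2 (integrableOn_const (volume_cube_lt_top _ _).ne)
  have hqi2 : Integrable (I.indicator fun _ => b * m) :=
    (integrable_indicator_iff hIm).2 (integrableOn_const (volume_cube_lt_top _ _).ne)
  have hq : ∀ u, q u ≤ 1 / 2 * (gam χ)⁻¹ * (∑ j, ∑ a, K j a u) + W u := by
    intro u
    by_cases hM : u ∈ M
    · by_cases hI : u ∈ I
      · have h := mul_integral_le_energy_in_box (s := ℓ • u) (δ := 0) hχ ht0 ht hω0 hℓ hρ hΩ hΨm hΨ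
          hsym hG hP he heb fun A x hx => by
            rw [sub_zero]
            exact potential_le_of_subset hχ ht0 hω0 hℓ hρ rfl (mem_cube_of_slide_mem hℓ hI) hx
        refine le_trans (le_of_eq ?_) h
        simp only [q, indicator_of_mem hM, indicator_of_mem hI]
        ring
      · have h := mul_integral_le_energy_in_box (s := ℓ • u) (δ := b) hχ ht0 ht hω0 hℓ hρ hΩ hΨm hΨ
          hsym hG hP he heb fun A x hx => potential_sub_selfEnergy_le hχ ht0 hω0 hℓ hρ rfl hx
        refine le_trans (le_of_eq ?_) h
        simp only [q, indicator_of_mem hM, indicator_of_notMem hI, add_zero, hm]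
    · have hI : u ∉ I := fun h => hM (hIM h)
      simp only [q, indicator_of_notMem hM, indicator_of_notMem hI, add_zero]
      refine add_nonneg (mul_nonneg (by positivity) (Finset.sum_nonneg fun j _ =>
        Finset.sum_nonneg fun a _ => hK0 j a u)) (integral_nonneg fun x => ?_)
      exact mul_nonneg (potential_nonneg_of_disjoint hχ ht0 hℓ (slide_notMem_openCube hℓ hM) x)
        (sq_nonneg _)
  have hKs : Integrable fun u => ∑ j, ∑ a, K j a u :=
    integrable_finsetSum _ fun j _ => integrable_finsetSum _ fun a _ => hKi j a
  have h1 : ∫ u, q u ≤ ∫ u, (1 / 2 * (gam χ)⁻¹ * (∑ j, ∑ a, K j a u) + W u) :=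
    integral_mono (hqi1.add hqi2) ((hKs.const_mul _).add hWi) hq
  have h2 : ∫ u, q u = ((1 + R) ^ 3 * (e - b) + (R - 1) ^ 3 * b) * m := by
    simp only [q]
    rw [integral_add hqi1 hqi2, integral_indicator_const _ hMm, integral_indicator_const _ hIm,
      volume_real_cube (by linarith), volume_real_cube (by linarith), smul_eq_mul, smul_eq_mul]
    ring
  have h3 : ∫ u, (1 / 2 * (gam χ)⁻¹ * (∑ j, ∑ a, K j a u) + W u)
      ≤ 1 / 2 * (gam χ)⁻¹ * (∑ j, ∑ a, ∫ x, G j a x ^ 2) + ∫ u, W u := by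
    rw [integral_add (hKs.const_mul _) hWi, integral_const_mul,
      integral_finsetSum _ fun j _ => integrable_finsetSum _ fun a _ => hKi j a]
    have : ∀ j, ∫ u, ∑ a, K j a u = ∑ a, ∫ u, K j a u := fun j =>
      integral_finsetSum _ fun a _ => hKi j a
    simp only [this]
    gcongr with j _ a _
    exact (hK j a).2
  have h4 : (∫ x, potential (slideAverage χ ω ℓ) Ω ρ x * Ψ x ^ 2) - ω * N / (2 * ℓ) * m
      ≤ ∫ x, potential coulomb Ω ρ x * Ψ x ^ 2 := by
    rw [hm, ← integral_const_mul, ← integral_sub hp2 (hΨ.integrable_sq.const_mul _)]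
    refine integral_mono_ae (hp2.sub (hΨ.integrable_sq.const_mul _)) hU ?_
    filter_upwards [ae_injective N] with x hx
    rw [← sub_mul]
    exact mul_le_mul_of_nonneg_right (slideAverage_le_potential hχ ht0 ht hℓ hω hΩ hρ hx)
      (sq_nonneg _)
  have h5 := gam_mul_selfEnergy_le (ρ := ρ) hχ ht0 ht hω0 hℓ
  -- Multiplying by `γ` cancels the `γ⁻¹` in front of the box kinetic energy and turns the averaged
  -- potential into that of `slideAverage`.
  have h6 : gam χ * (((1 + R) ^ 3 * (e - b) + (R - 1) ^ 3 * b) * m)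
      ≤ 1 / 2 * (∑ j, ∑ a, ∫ x, G j a x ^ 2)
        + ∫ x, potential (slideAverage χ ω ℓ) Ω ρ x * Ψ x ^ 2 := by
    rw [← h2, ← hp3]
    refine (mul_le_mul_of_nonneg_left (h1.trans h3) hγ.le).trans (le_of_eq ?_)
    rw [mul_add]
    congr 1
    field_simp
  -- The boundary layer has volume `(1 + R)³ - (R - 1)³ = 6R² + 2 ≤ 8R²`, since `R ≥ 1`. Together
  -- with the `1/2` in the self energy this gives the constant `4 (ballPotential + 1)`.
  have h7 : (6 * R ^ 2 + 2) * (gam χ * b)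
      ≤ 8 * R ^ 2 * (1 / 2 * ρ ^ 2 * ((ballPotential + 1) * ℓ ^ 5)) :=
    mul_le_mul (by nlinarith) h5 (mul_nonneg hγ.le hb0) (by positivity)
  have h8 := mul_le_mul_of_nonneg_right h7 hm0
  calc ((1 + R) ^ 3 * gam χ * e - 4 * (ballPotential + 1) * R ^ 2 * ρ ^ 2 * ℓ ^ 5
        - ω * N / (2 * ℓ)) * m
      = gam χ * (((1 + R) ^ 3 * (e - b) + (R - 1) ^ 3 * b) * m) - ω * N / (2 * ℓ) * m
        + ((6 * R ^ 2 + 2) * (gam χ * b) * m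
          - 8 * R ^ 2 * (1 / 2 * ρ ^ 2 * ((ballPotential + 1) * ℓ ^ 5)) * m) := by ring
    _ ≤ _ := by linarith

/-- The energy of the large system is bounded below by the energies of the small box. -/
theorem le_groundEnergy (hχ : IsCutoff B t χ) (ht0 : 0 < t) (ht : t < 1 / 2)
    (hω : ω = omegaConst B * (t ^ 4)⁻¹) (hℓ : 0 < ℓ) (hℓL : ℓ ≤ L) (hρ : 0 ≤ ρ) {e : ℝ}
    (he : ∀ n, 1 ≤ n → n ≤ N → e ≤ boxEnergy χ ω ρ ℓ n) (heb : e ≤ selfEnergy χ ω ρ ℓ) :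
    (1 + L / ℓ) ^ 3 * gam χ * e - 4 * (ballPotential + 1) * (L / ℓ) ^ 2 * ρ ^ 2 * ℓ ^ 5
      - ω * N / (2 * ℓ) ≤ groundEnergy N ρ L := by
  have hΩ : volume (cube 0 L) ≠ ⊤ := (volume_cube_lt_top 0 L).ne
  have h := le_sInf_spec (κ := 1 / 2) (D := (univ : Set (Config N)))
    (V := potential coulomb (cube 0 L) ρ) (S := ⊤)
    (b := (1 + L / ℓ) ^ 3 * gam χ * e - 4 * (ballPotential + 1) * (L / ℓ) ^ 2 * ρ ^ 2 * ℓ ^ 5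
      - ω * N / (2 * ℓ)) (by norm_num) isOpen_univ
    (measurable_potential coulombBounded_coulomb _ ρ N)
    (neg_le_potential coulombBounded_coulomb coulomb_nonneg hΩ hρ)
    (by rw [Submodule.top_coe]; exact isClosed_univ) ?_ ?_
  · rwa [Submodule.top_coe] at h
  · obtain ⟨ψ, h0, h1⟩ := exists_memFormDomain hΩ hρ N
    exact ⟨ψ, Submodule.mem_top, h0, h1⟩
  · intro ψ _ g hg hi
    have hψ : Measurable ψ := (Lp.stronglyMeasurable ψ).measurable
    -- An arbitrary state of finite energy is replaced by its symmetrization, with equal norm and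
    -- potential energy and no more kinetic energy.
    obtain ⟨G, hG, hGg⟩ := exists_hasWeakDeriv_symmetrization hg
    rw [integrableOn_univ] at hi
    obtain ⟨hU, hU'⟩ := integrable_mul_symmetrization_sq
      (fun σ x => potential_perm coulomb_comm (cube 0 L) ρ σ x) hi
    have hn : ‖ψ‖ ^ 2 = ∫ x, symmetrization ψ x ^ 2 := by
      have hi1 : Integrable fun x => (1 : ℝ) * ‖ψ x‖ ^ 2 := by
        simpa using (memLp_L2_univ ψ).integrable_norm_pow two_ne_zero
      have := (integrable_mul_symmetrization_sq (V := fun _ => 1) (fun _ _ => rfl) hi1).2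
      simp only [one_mul] at this
      rw [norm_sq_eq_integral, setIntegral_univ, this]
    rw [hn, setIntegral_univ, ← hU']
    refine (energy_lower_bound_of_symmetric hχ ht0 ht hω hℓ hℓL hρ (measurable_symmetrization hψ)
      (memLp_symmetrization ψ) (fun σ x => symmetrization_perm _ σ x) hG hU he heb).trans ?_
    gcongr

end EnergyBound

end Jellium

end

/-! ### Assembly of the theorem. -/

theorem mainTheorem4 :
    ∃ C : ℝ, 0 < C ∧ ∀ B : ℕ → ℝ, ∃ (c : ℝ) (ω : ℝ → ℝ),
      0 < c ∧ (∀ t : ℝ, ω t = c * (t ^ 4)⁻¹) ∧ (∀ t : ℝ, 0 < t → t < 1 / 2 → 1 ≤ ω t) ∧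
      ∀ (t : ℝ) (χ : Jellium.R3 → ℝ), 0 < t → t < 1 / 2 → Jellium.IsCutoff B t χ →
        (1 ≤ Jellium.gam χ ∧ Jellium.gam χ ≤ ((1 - 2 * t) ^ 3)⁻¹) ∧
        ∀ (N : ℕ) (ρ L ℓ : ℝ), 0 < ρ → 0 < L → 0 < ℓ →
          (∀ x : Jellium.Config N, Function.Injective x →
            (∀ k : Fin 3 → ℤ, IntegrableOn (Jellium.slidPotential χ (ω t) ρ L ℓ x k)
              (Jellium.cube (-1 / 2) (1 / 2))) ∧
            (Summable fun k : Fin 3 → ℤ =>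
              ∫ μ in Jellium.cube (-1 / 2) (1 / 2), Jellium.slidPotential χ (ω t) ρ L ℓ x k μ) ∧
            Jellium.gam χ * (∑' k : Fin 3 → ℤ,
                ∫ μ in Jellium.cube (-1 / 2) (1 / 2), Jellium.slidPotential χ (ω t) ρ L ℓ x k μ)
              - ω t * N / (2 * ℓ)
              ≤ Jellium.potential Jellium.coulomb (Jellium.cube 0 L) ρ x) ∧
          (1 ≤ N → ℓ ≤ L →
            (1 + L / ℓ) ^ 3 * Jellium.gam χ *
                (⨅ n : Set.Icc 1 N, Jellium.boxEnergy χ (ω t) ρ ℓ n)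
              - C * (L / ℓ) ^ 2 * ρ ^ 2 * ℓ ^ 5 - ω t * N / (2 * ℓ)
              ≤ Jellium.groundEnergy N ρ L) := by
  refine ⟨4 * (Jellium.ballPotential + 1), by linarith [Jellium.ballPotential_nonneg], fun B => ?_⟩
  refine ⟨Jellium.omegaConst B, fun t => Jellium.omegaConst B * (t ^ 4)⁻¹,
    by linarith [Jellium.one_le_omegaConst B], fun t => rfl,
    fun t ht0 ht => Jellium.one_le_omega B ht0 ht, fun t χ ht0 ht hχ => ?_⟩
  refine ⟨⟨hχ.one_le_gam ht0 ht, hχ.gam_le ht⟩, fun N ρ L ℓ hρ hL hℓ => ?_⟩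
  have hω1 := Jellium.one_le_omega B ht0 ht
  refine ⟨fun x hx => ?_, fun hN hℓL => ?_⟩
  · obtain ⟨h1, h2, h3⟩ := Jellium.slidPotential_lattice hχ ht (ω := Jellium.omegaConst B * (t ^ 4)⁻¹)
      (zero_le_one.trans hω1) hℓ ρ L x
    refine ⟨h1, h2, ?_⟩
    rw [h3]
    exact Jellium.slideAverage_le_potential hχ ht0 ht hℓ rfl
      (Jellium.volume_cube_lt_top 0 L).ne hρ.le hx
  · have hbdd : BddBelow (Set.range fun n : Set.Icc 1 N =>
        Jellium.boxEnergy χ (Jellium.omegaConst B * (t ^ 4)⁻¹) ρ ℓ n) :=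
      (Set.finite_range _).bddBelow
    have he : ∀ n (h1 : 1 ≤ n) (h2 : n ≤ N),
        ⨅ n : Set.Icc 1 N, Jellium.boxEnergy χ (Jellium.omegaConst B * (t ^ 4)⁻¹) ρ ℓ n
          ≤ Jellium.boxEnergy χ (Jellium.omegaConst B * (t ^ 4)⁻¹) ρ ℓ n := fun n h1 h2 =>
      ciInf_le hbdd ⟨n, h1, h2⟩
    -- The bound needed for empty boxes comes from `n = 1`, which belongs to the range of the
    -- infimum because `N ≥ 1`.
    exact Jellium.le_groundEnergy hχ ht0 ht rfl hℓ hℓL hρ.le he ((he 1 le_rfl hN).trans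
      (Jellium.boxEnergy_one_le hχ ht0 ht (zero_le_one.trans hω1) hℓ hρ.le))
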